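/- **Setting.** Let $(Y,Z,W)$ be a random vector with values in $\mathbb R\times\mathbb R^{d_z}\times\mathbb R^{d_w}$ satisfying $Y=\varphi(Z)+U$, $E[U\mid W]=0$, with $E\varphi(Z)^2<\infty$ and $EU^2<\infty$, and let $(Y_i,Z_i,W_i)_{i\ge1}$ be i.i.d. copies of it. Let $\mathcal Z,\mathcal W$ be the supports of $Z$ and $W$, let $p_W$ be a Lebesgue density of $W$, and let $\nu$ be a probability density on $\mathbb R^{d_w}$ that is strictly positive on $\mathcal W$. Let $(f_l)_{l\ge1}$ be an orthonormal basis of $L^2_\nu(\mathbb R^{d_w})=\{\phi:\int\phi^2\nu<\infty\}$, let $(e_l)_{l\ge1}$ be functions with $E[e_l(Z)^2]<\infty$, and write $e_{\underline k}=(e_1,\dots,e_k)^t$. Let $\tau=(\tau_j)_{j\ge1}$ and $w=(w_j)_{j\ge1}$ be real sequences, let $m_n,k_n$ be sequences of integers, and put $f_j^\tau=\sqrt{\tau_j}\,f_j$. Let $\varphi_0$ be a function with $\varphi_0(Z)=E[Y\mid Z]$. **Assumptions.** * (A1) There are $\eta_f,\eta_p\ge1$ with $\sup_{l}\int|f_l|^4\nu\le\eta_f$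 and $\sup_{x\in\mathcal W}p_W(x)/\nu(x)\le\eta_p$. * (A2) There is $\sigma>0$ with $E[U^4\mid W]\le\sigma^4$. * (A3) The operator $T\phi=E[\phi(Z)\mid W]$ on $L^2_Z=\{\phi:E\phi(Z)^2<\infty\}$ is injective. * (A4) $\tau$ is positive and nonincreasing with $\tau_1=1$. * (A6) (i) $w$ is nondecreasing, $w_1=1$, $j^2=o(w_j)$, $\varphi_0\in L^2_Z$, and there are $\beta_n\in\mathbb R^{k_n}$ with $\sup_{z\in\mathcal Z}|\varphi_0(z)-e_{\underline{k_n}}(z)^t\beta_n|^2=O(w_{k_n}^{-1})$. (ii) There is $\eta_e\ge1$ with $\sup_{z\in\mathcal Z}\|e_{\underline{k_n}}(z)\|^2\le\eta_e k_n$ for all $n$. (iii) The smallest eigenvalue of $E[e_{\underline k}(Z)e_{\underline k}(Z)^t]$ is bounded away from zero uniformly in $k$. (iv) $E[U^2\mid Z]$ is bounded. **Statistic.** With $\mathbf Z_k=(e_l(Z_i))_{i\le n,\,l\le k}$, $\mathbf Y_n=(Y_1,\dots,Y_n)^t$ and $(\cdot)^-$ any generalized inverse ($AA^-A=A$), put $$\overline\varphi_k=e_{\underline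 k}(\cdot)^t(\mathbf Z_k^t\mathbf Z_k)^-\mathbf Z_k^t\mathbf Y_n,\qquad S_n^{e}=\sum_{j=1}^{m_n}\tau_j\Big|n^{-1}\sum_{i=1}^n\big(Y_i-\overline\varphi_{k_n}(Z_i)\big)f_j(W_i)\Big|^2 .$$ **Limit.** Let $(\tilde e_l(Z))_{l\ge1}$ be the Gram–Schmidt orthonormalization of $(e_l(Z))_{l\ge1}$ in $L^2$ (so $\tilde e_l=e_l$ if the $e_l(Z)$ are orthonormal). Let $\Sigma^e$ be the infinite covariance matrix of the vector $$\Big(U\Big(f_j^\tau(W)-\sum_{l\ge1}E[f_j^\tau(W)\tilde e_l(Z)]\,\tilde e_l(Z)\Big)\Big)_{j\ge1},$$ the series converging in $L^2$. Let $\lambda_1^e\ge\lambda_2^e\ge\dots\ge0$ be the eigenvalues of $\Sigma^e$ as an operator on $\ell^2$: its positive eigenvalues listed in nonincreasing order with multiplicity, followed by zeros if there are only finitely many. **Theorem.** Assume A1–A4 and A6, and $$\sum_{j=1}^{m_n}\tau_j=O(1),\qquad n=O(w_{k_n}),\qquad k_n^3=o(n),\qquad m_n\to\infty .$$ Suppose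 that $Z$ is exogenous, that is, $\varphi(Z)=\varphi_0(Z)$ almost surely (equivalently $E[U\mid Z]=0$). Then the sequence $(\lambda_j^e)$ exists and, for independent random variables $\chi^2_{1j}$, $j\ge1$, each chi-square distributed with one degree of freedom, the series $\sum_j\lambda_j^e\chi^2_{1j}$ converges almost surely and $$n\,S_n^{e}\ \xrightarrow{\ d\ }\ \sum_{j=1}^\infty\lambda_j^e\,\chi^2_{1j}\qquad(n\to\infty).$$ -/

import Mathlib

open MeasureTheory ProbabilityTheory Filter Topology Asymptotics

/-! Sequences that are usually indexed by `j ≥ 1` (the functions `f_j`, `e_j`, the weights `τ_j`, the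
eigenvalues) are indexed here by `ℕ`, so that `f 0` is the first function, `f 1` the second one, and
so on.  The approximation weights `w_k` keep their index `k`, the number of functions used. -/

noncomputable section

namespace ExogeneityTest

variable {Ω : Type*} [MeasurableSpace Ω] {E F : Type*} [MeasurableSpace E] [MeasurableSpace F]

/-! ### Sampling, the model and the hypothesis -/

/-- `(Ys i, Zs i, Ws i)`, `i = 0, 1, …`, are i.i.d. copies of `(Y, Z, W)`. -/
structure IsIIDSample (P : Measure Ω) (Y : Ω → ℝ) (Z : Ω → E) (W : Ω → F)
    (Ys : ℕ → Ω → ℝ) (Zs : ℕ → Ω → E) (Ws : ℕ → Ω → F) : Prop where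
  measurable_Y : ∀ i, Measurable (Ys i)
  measurable_Z : ∀ i, Measurable (Zs i)
  measurable_W : ∀ i, Measurable (Ws i)
  indep : iIndepFun (fun i ω => (Ys i ω, Zs i ω, Ws i ω)) P
  identDistrib : ∀ i, IdentDistrib (fun ω => (Ys i ω, Zs i ω, Ws i ω))
    (fun ω => (Y ω, Z ω, W ω)) P P

/-- The error term `U = Y - φ(Z)`. -/
def errorTerm (Y : Ω → ℝ) (Z : Ω → E) (φ : E → ℝ) : Ω → ℝ := fun ω => Y ω - φ (Z ω)

/-- The instrumental regression model `Y = φ(Z) + U`, `E[U | W] = 0`, with `φ(Z)` and `U` square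
integrable. -/
structure IsIVModel (P : Measure Ω) (Y : Ω → ℝ) (Z : Ω → E) (W : Ω → F) (φ : E → ℝ) : Prop where
  measurable_Y : Measurable Y
  measurable_Z : Measurable Z
  measurable_W : Measurable W
  measurable_phi : Measurable φ
  memLp_phi : MemLp (fun ω => φ (Z ω)) 2 P
  memLp_error : MemLp (errorTerm Y Z φ) 2 P
  condExp_error : P[errorTerm Y Z φ | MeasurableSpace.comap W inferInstance] =ᵐ[P] 0

/-- `φ₀(Z) = E[Y | Z]`. -/
def IsRegressionFunction (P : Measure Ω) (Y : Ω → ℝ) (Z : Ω → E) (φ₀ : E → ℝ) : Prop :=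
  Measurable φ₀ ∧
    (fun ω => φ₀ (Z ω)) =ᵐ[P] P[Y | MeasurableSpace.comap Z inferInstance]

/-- The hypothesis of exogeneity: `φ = φ₀` as elements of `L²_Z`. -/
def Exogenous (P : Measure Ω) (Z : Ω → E) (φ φ₀ : E → ℝ) : Prop :=
  (fun ω => φ (Z ω)) =ᵐ[P] fun ω => φ₀ (Z ω)

/-! ### The assumptions -/

/-- `p` is a Lebesgue density of the random vector `W`. -/
def IsDensityOf {d : ℕ} (P : Measure Ω) (W : Ω → EuclideanSpace ℝ (Fin d))
    (p : EuclideanSpace ℝ (Fin d) → ℝ) : Prop :=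
  Measurable p ∧ (∀ x, 0 ≤ p x) ∧
    P.map W = (volume : Measure (EuclideanSpace ℝ (Fin d))).withDensity fun x => ENNReal.ofReal (p x)

/-- The measure `ν(s) ds`. -/
def weightMeasure {d : ℕ} (ν : EuclideanSpace ℝ (Fin d) → ℝ) :
    Measure (EuclideanSpace ℝ (Fin d)) :=
  volume.withDensity fun x => ENNReal.ofReal (ν x)

/-- `ν` is a probability density on `ℝ^d`, strictly positive on the support of `W`. -/
structure IsWeightDensity {d : ℕ} (P : Measure Ω) (W : Ω → EuclideanSpace ℝ (Fin d))
    (ν : EuclideanSpace ℝ (Fin d) → ℝ) : Prop where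
  measurable : Measurable ν
  nonneg : ∀ x, 0 ≤ ν x
  isProbabilityMeasure : IsProbabilityMeasure (weightMeasure ν)
  pos : ∀ x ∈ (P.map W).support, 0 < ν x

/-- The functions `f_l` form an orthonormal basis of `L²_ν(ℝ^d)`. -/
def IsOrthonormalBasisOf {d : ℕ} (ν : EuclideanSpace ℝ (Fin d) → ℝ)
    (f : ℕ → EuclideanSpace ℝ (Fin d) → ℝ) : Prop :=
  (∀ l, Measurable (f l)) ∧
    ∃ b : HilbertBasis ℕ ℝ (Lp ℝ 2 (weightMeasure ν)), ∀ l, b l =ᵐ[weightMeasure ν] f l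

/-- Bounds on the basis functions (fourth moments) and on the density ratio `p_W / ν`. -/
def AssumptionA1 {d : ℕ} (P : Measure Ω) (W : Ω → EuclideanSpace ℝ (Fin d))
    (p ν : EuclideanSpace ℝ (Fin d) → ℝ) (f : ℕ → EuclideanSpace ℝ (Fin d) → ℝ) : Prop :=
  ∃ ηf ηp : ℝ, 1 ≤ ηf ∧ 1 ≤ ηp ∧
    (∀ l, Integrable (fun s => |f l s| ^ 4) (weightMeasure ν) ∧
      ∫ s, |f l s| ^ 4 ∂(weightMeasure ν) ≤ ηf) ∧
    ∀ x ∈ (P.map W).support, p x / ν x ≤ ηp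

/-- `E[U⁴ | W] ≤ σ⁴` for some constant `σ > 0`. -/
def AssumptionA2 (P : Measure Ω) (W : Ω → F) (U : Ω → ℝ) : Prop :=
  ∃ σ : ℝ, 0 < σ ∧ Integrable (fun ω => U ω ^ 4) P ∧
    ∀ᵐ ω ∂P, (P[fun ω => U ω ^ 4 | MeasurableSpace.comap W inferInstance]) ω ≤ σ ^ 4

/-- The conditional expectation operator `T φ = E[φ(Z) | W]` on `L²_Z` is nonsingular. -/
def AssumptionA3 (P : Measure Ω) (Z : Ω → E) (W : Ω → F) : Prop :=
  ∀ ψ : E → ℝ, Measurable ψ → MemLp (fun ω => ψ (Z ω)) 2 P →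
    P[fun ω => ψ (Z ω) | MeasurableSpace.comap W inferInstance] =ᵐ[P] 0 →
    (fun ω => ψ (Z ω)) =ᵐ[P] 0

/-- The weights `τ` are positive, nonincreasing, and the first one is `1`. -/
def AssumptionA4 (τ : ℕ → ℝ) : Prop :=
  (∀ j, 0 < τ j) ∧ Antitone τ ∧ τ 0 = 1

/-- `φ₀` belongs to the class `F_w`: along the dimensions `k n` it is approximated by linear
combinations of the first `k n` functions, with squared sup-norm error on the support of `Z` of
order `1 / w (k n)`. -/
def InApproximationClass [TopologicalSpace E] (P : Measure Ω) (Z : Ω → E) (e : ℕ → E → ℝ)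
    (w : ℕ → ℝ) (k : ℕ → ℕ) (φ₀ : E → ℝ) : Prop :=
  MemLp (fun ω => φ₀ (Z ω)) 2 P ∧
    ∃ β : ∀ n, Fin (k n) → ℝ, ∃ C : ℝ, ∀ᶠ n in atTop, ∀ z ∈ (P.map Z).support,
      |φ₀ z - ∑ l : Fin (k n), e l z * β n l| ^ 2 ≤ C * (w (k n))⁻¹

/-- The second moment matrix `E[e_k(Z) e_k(Z)ᵗ]` of the first `k` functions. -/
def secondMomentMatrix (P : Measure Ω) (Z : Ω → E) (e : ℕ → E → ℝ) (k : ℕ) :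
    Matrix (Fin k) (Fin k) ℝ :=
  Matrix.of fun i j => ∫ ω, e i (Z ω) * e j (Z ω) ∂P

/-- The assumptions on the functions `e_l`, the sequence `w`, the function `φ₀` and `E[U² | Z]`. -/
structure AssumptionA6 [TopologicalSpace E] (P : Measure Ω) (Z : Ω → E) (e : ℕ → E → ℝ)
    (w : ℕ → ℝ) (k : ℕ → ℕ) (φ₀ : E → ℝ) (U : Ω → ℝ) : Prop where
  w_one : w 1 = 1
  w_mono : ∀ i j, 1 ≤ i → i ≤ j → w i ≤ w j
  w_growth : (fun j : ℕ => (j : ℝ) ^ 2) =o[atTop] w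
  approx : InApproximationClass P Z e w k φ₀
  sup_bound : ∃ ηe : ℝ, 1 ≤ ηe ∧ ∀ n, 1 ≤ n → ∀ z ∈ (P.map Z).support,
    ∑ l : Fin (k n), e l z ^ 2 ≤ ηe * k n
  eigenvalue_bound : ∃ c : ℝ, 0 < c ∧ ∀ (κ : ℕ) (μ : ℝ),
    Module.End.HasEigenvalue (Matrix.toLin' (secondMomentMatrix P Z e κ)) μ → c ≤ μ
  condVar_bound : ∃ C : ℝ, ∀ᵐ ω ∂P,
    (P[fun ω => U ω ^ 2 | MeasurableSpace.comap Z inferInstance]) ω ≤ C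

/-! ### The estimator and the test statistic -/

/-- `G` is a generalized inverse of `A`. -/
def IsGeneralizedInverse {k : ℕ} (A G : Matrix (Fin k) (Fin k) ℝ) : Prop := A * G * A = A

/-- The `n × k` matrix with entries `e_l(z_i)`. -/
def designMatrix (e : ℕ → E → ℝ) (n k : ℕ) (z : ℕ → E) : Matrix (Fin n) (Fin k) ℝ :=
  Matrix.of fun i l => e l (z i)

/-- The Gram matrix `𝐙ᵗ 𝐙` of the design matrix `𝐙`. -/
def designGram (e : ℕ → E → ℝ) (n k : ℕ) (z : ℕ → E) : Matrix (Fin k) (Fin k) ℝ :=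
  (designMatrix e n k z).transpose * designMatrix e n k z

/-- The least squares coefficient `G 𝐙ᵗ 𝐘`, where `G` is a generalized inverse of `𝐙ᵗ 𝐙`. -/
def seriesCoef (e : ℕ → E → ℝ) (n k : ℕ) (G : Matrix (Fin k) (Fin k) ℝ) (y : ℕ → ℝ) (z : ℕ → E) :
    Fin k → ℝ :=
  (G * (designMatrix e n k z).transpose).mulVec fun i : Fin n => y i

/-- The series least squares estimator `e_k(·)ᵗ β̂_k`. -/
def seriesEstimator (e : ℕ → E → ℝ) (n k : ℕ) (G : Matrix (Fin k) (Fin k) ℝ) (y : ℕ → ℝ)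
    (z : ℕ → E) : E → ℝ :=
  fun x => ∑ l : Fin k, e l x * seriesCoef e n k G y z l

/-- The statistic `S_n^e = ∑_{j ≤ m} τ_j |n⁻¹ ∑_{i ≤ n} (y_i - φ̄_k(z_i)) f_j(w_i)|²`. -/
def testStatistic (τ : ℕ → ℝ) (f : ℕ → F → ℝ) (e : ℕ → E → ℝ) (n m k : ℕ)
    (G : Matrix (Fin k) (Fin k) ℝ) (y : ℕ → ℝ) (z : ℕ → E) (x : ℕ → F) : ℝ :=
  ∑ j ∈ Finset.range m, τ j *
    |(n : ℝ)⁻¹ * ∑ i ∈ Finset.range n, (y i - seriesEstimator e n k G y z (z i)) * f j (x i)| ^ 2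

/-! ### The limiting covariance and its eigenvalues -/

/-- The random variables `e_l(Z)`, orthonormalized in `L²(P)` by the Gram–Schmidt procedure (they are
unchanged if they are orthonormal already). -/
def orthonormalized (P : Measure Ω) (Z : Ω → E) (e : ℕ → E → ℝ)
    (he : ∀ l, MemLp (fun ω => e l (Z ω)) 2 P) : ℕ → Lp ℝ 2 P :=
  InnerProductSpace.gramSchmidtNormed ℝ fun l => (he l).toLp (fun ω => e l (Z ω))

theorem orthonormalized_eq {E' : Type*} (P : Measure Ω) (Z : Ω → E') (e : ℕ → E' → ℝ)
    (he : ∀ l, MemLp (fun ω => e l (Z ω)) 2 P)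
    (h : Orthonormal ℝ fun l => (he l).toLp (fun ω => e l (Z ω))) (l : ℕ) :
    orthonormalized P Z e he l = (he l).toLp (fun ω => e l (Z ω)) := by
  have h1 := InnerProductSpace.gramSchmidt_of_orthogonal ℝ
    (f := fun l => (he l).toLp (fun ω => e l (Z ω))) (fun i j hij => h.2 hij)
  have h2 := h.1 l
  simp only [orthonormalized, InnerProductSpace.gramSchmidtNormed, h1]
  simp only at h2
  simp [h2]

/-- The series `∑_l E[g ẽ_l(Z)] ẽ_l(Z)` in `L²(P)`, where `ẽ_l(Z)` are the orthonormalized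
`e_l(Z)`. -/
def seriesProjection (P : Measure Ω) (Z : Ω → E) (e : ℕ → E → ℝ)
    (he : ∀ l, MemLp (fun ω => e l (Z ω)) 2 P) (g : Ω → ℝ) : Lp ℝ 2 P :=
  ∑' l, (∫ ω, g ω * orthonormalized P Z e he l ω ∂P) • orthonormalized P Z e he l

/-- The random variable `U (f_j^τ(W) - ∑_l E[f_j^τ(W) ẽ_l(Z)] ẽ_l(Z))` with `f_j^τ = √τ_j f_j`. -/
def scoreVariable (P : Measure Ω) (Z : Ω → E) (W : Ω → F) (U : Ω → ℝ) (τ : ℕ → ℝ)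
    (f : ℕ → F → ℝ) (e : ℕ → E → ℝ) (he : ∀ l, MemLp (fun ω => e l (Z ω)) 2 P) (j : ℕ) : Ω → ℝ :=
  fun ω => U ω * (Real.sqrt (τ j) * f j (W ω) -
    seriesProjection P Z e he (fun ω' => Real.sqrt (τ j) * f j (W ω')) ω)

/-- The infinite covariance matrix `Σ^e` of the vector of all score variables. -/
def scoreCovariance (P : Measure Ω) (Z : Ω → E) (W : Ω → F) (U : Ω → ℝ) (τ : ℕ → ℝ)
    (f : ℕ → F → ℝ) (e : ℕ → E → ℝ) (he : ∀ l, MemLp (fun ω => e l (Z ω)) 2 P) :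
    ℕ → ℕ → ℝ :=
  fun j l => covariance (scoreVariable P Z W U τ f e he j) (scoreVariable P Z W U τ f e he l) P

/-- `ev` is the sequence of ordered eigenvalues, with multiplicities, of the infinite positive
semidefinite matrix `s` acting on `ℓ²`: there are orthonormal eigenvectors `v i` with eigenvalues
`ev i`, and `s` vanishes on their orthogonal complement.  Hence every nonzero eigenvalue is listed as
often as its multiplicity, and the sequence ends with zeros if `s` has finite rank. -/
def IsOrderedEigenvalues (s : ℕ → ℕ → ℝ) (ev : ℕ → ℝ) : Prop :=
  Antitone ev ∧ (∀ i, 0 ≤ ev i) ∧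
    ∃ v : ℕ → lp (fun _ : ℕ => ℝ) 2, Orthonormal ℝ v ∧
      (∀ i j, HasSum (fun l => s j l * v i l) (ev i * v i j)) ∧
      ∀ x : lp (fun _ : ℕ => ℝ) 2, (∀ i, inner ℝ (v i) x = 0) →
        ∀ j, HasSum (fun l => s j l * x l) 0

/-- The chi-square distribution with one degree of freedom. -/
def chiSquareOne : Measure ℝ := (gaussianReal 0 1).map fun x => x ^ 2

end ExogeneityTest

end

/-! Write `F_j = √τ_j f_j`, let `q_l` be the orthonormalized `e_l`, and let `h_j(Z)` be the
projection of `F_j(W)` on the closed span of the `q_l(Z)`. Then `n S_n` is the sum over `j < m_n` of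
the squares of `n^{-1/2} ∑_i r_i F_j(W_i)`, where `r_i` are the least squares residuals. Two facts
give the theorem, and Slutsky's lemma joins them.

Replacing residuals by scores. Under exogeneity the residual is `U + ρ_n(Z) - ∑_{l<k_n} θ_l q_l(Z)`,
where `ρ_n` is the part of the approximation error of `φ₀` orthogonal to the first `k_n` functions.
By the normal equations the residuals are orthogonal to each such `q_l` on the sample, so the
projection `p_{n,j}` of `F_j` on these functions may be subtracted from `F_j` at no cost. Compared
with the normalized sum of `U (F_j - h_j)`, three terms remain. The sum of `(F_j - p_{n,j}) ρ_n` has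
variance of order `k_n/n`. Its mean equals that of `(h_j - p_{n,j}) ρ_n`, because `φ₀(Z)` lies in
the closed span, and is negligible because `E ρ_n² = O(1/n)`. The sum of `(h_j - p_{n,j}) U` is
centered since `E[U | Z] = 0`, and small since `p_{n,j}` tends to `h_j` and `E[U² | Z]` is bounded.
The coefficients `θ_l` times the centered sums of `(F_j - p_{n,j}) q_l` contribute a square of order
`k_n²/n`. Here `√n θ` solves a perturbation of a trivial linear system, the perturbation being the
error of the sample Gram matrix, so that matrix is never inverted and the choice of the generalized
inverse is immaterial. All bounds can be summed over `j`, since `∑ τ_j < ∞` and the fourth moments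
of `f_j(W)` are bounded. This is `IsIID.tendstoInMeasure_residual_sub`, specialized to series
regression in `IsIID.tendstoInMeasure_series_residual_sub`.

The limit of the scores. The variables `g_j = U (F_j - h_j)` are centered and square summable in
`L²`, so `A x = ∑ x_j g_j` is a Hilbert–Schmidt operator on `ℓ²` and `Σ^e = A* A` is compact and
positive with trace `∑ E g_j²` (`exists_isOrderedEigenvalues_gram`). Its eigenvectors `v_i` yield
uncorrelated variables `A v_i` with variances `λ_i`. The central limit theorem handles finitely many
of them. By Bessel's inequality and the trace formula, the mean error of keeping `N` of them is
asymptotically at most `∑_{i ≥ N} λ_i` (`IsIID.tendstoInDistribution_sum_range_normSum_sq`). -/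

noncomputable section
namespace ExogeneityTest

/-! ### Gram matrices of square summable sequences -/

section Gram

variable {H : Type*} [NormedAddCommGroup H] [InnerProductSpace ℝ H]

/-- The Hilbert space `ℓ²`. -/
abbrev EllTwo : Type := lp (fun _ : ℕ => ℝ) 2

theorem EllTwo.hasSum_sq (x : EllTwo) : HasSum (fun j => x j ^ 2) (‖x‖ ^ 2) := by
  have h := lp.hasSum_inner (𝕜 := ℝ) x x
  rw [real_inner_self_eq_norm_sq] at h
  simpa [pow_two] using h

theorem EllTwo.hasSum_mul (x y : EllTwo) : HasSum (fun j => x j * y j) (inner ℝ x y) := by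
  have h := lp.hasSum_inner (𝕜 := ℝ) x y
  simpa [mul_comm] using h

theorem summable_norm_smul_of_sq {a : ℕ → H} (ha : Summable fun j => ‖a j‖ ^ 2) (x : EllTwo) :
    Summable fun j => ‖x j • a j‖ := by
  refine Summable.of_nonneg_of_le (fun j => norm_nonneg _) (fun j => ?_)
    ((EllTwo.hasSum_sq x).summable.add ha)
  rw [norm_smul, Real.norm_eq_abs, ← sq_abs (x j)]
  nlinarith [sq_nonneg (|x j| - ‖a j‖), sq_nonneg (|x j|), sq_nonneg ‖a j‖]

/-- Cauchy–Schwarz for series. Applied to a shifted sequence, it also controls the truncation error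
of the synthesis operator. -/
theorem norm_tsum_smul_le {a : ℕ → H} (ha : Summable fun j => ‖a j‖ ^ 2) (x : EllTwo) :
    ‖∑' j, x j • a j‖ ≤ √(∑' j, ‖a j‖ ^ 2) * ‖x‖ := by
  have hx := EllTwo.hasSum_sq x
  have hs := summable_norm_smul_of_sq ha x
  refine (norm_tsum_le_tsum_norm hs).trans ?_
  have h := Real.inner_le_Lp_mul_Lq_tsum_of_nonneg (p := 2) (q := 2)
    (f := fun j => |x j|) (g := fun j => ‖a j‖) Real.HolderConjugate.two_two
    (fun j => abs_nonneg _) (fun j => norm_nonneg _)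
    (by simpa using hx.summable) (by simpa using ha)
  simp only [norm_smul, Real.norm_eq_abs]
  refine h.trans (le_of_eq ?_)
  simp only [Real.rpow_ofNat, sq_abs, hx.tsum_eq, ← Real.sqrt_eq_rpow, Real.sqrt_sq (norm_nonneg x)]
  ring

variable [CompleteSpace H]

/-- The operator `x ↦ ∑ x_j a_j` on `ℓ²`. -/
def synthesis (a : ℕ → H) (ha : Summable fun j => ‖a j‖ ^ 2) : EllTwo →L[ℝ] H :=
  LinearMap.mkContinuous
    { toFun := fun x => ∑' j, x j • a j
      map_add' := fun x y => by
        rw [← (summable_norm_smul_of_sq ha x).of_norm.tsum_add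
          (summable_norm_smul_of_sq ha y).of_norm]
        simp [add_smul]
      map_smul' := fun c x => by
        rw [RingHom.id_apply, ← (summable_norm_smul_of_sq ha x).of_norm.tsum_const_smul]
        simp [mul_smul] }
    (√(∑' j, ‖a j‖ ^ 2)) (norm_tsum_smul_le ha)

theorem hasSum_synthesis (a : ℕ → H) (ha : Summable fun j => ‖a j‖ ^ 2) (x : EllTwo) :
    HasSum (fun j => x j • a j) (synthesis a ha x) :=
  (summable_norm_smul_of_sq ha x).of_norm.hasSum

theorem hasSum_inner_synthesis (a : ℕ → H) (ha : Summable fun j => ‖a j‖ ^ 2) (x : EllTwo) (y : H) :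
    HasSum (fun j => inner ℝ y (a j) * x j) (inner ℝ y (synthesis a ha x)) := by
  have h := (innerSL ℝ y).hasSum (hasSum_synthesis a ha x)
  simpa [inner_smul_right, mul_comm] using h

/-- Truncation to the first `N` coordinates gives finite rank operators, and by Cauchy–Schwarz the
operator norm of the remainder is at most the root of the tail of `∑ ‖a j‖ ^ 2`. -/
theorem isCompactOperator_synthesis (a : ℕ → H) (ha : Summable fun j => ‖a j‖ ^ 2) :
    IsCompactOperator (synthesis a ha) := by
  let B : ℕ → EllTwo →L[ℝ] H := fun N =>
    ∑ j ∈ Finset.range N, (ContinuousLinearMap.toSpanSingleton ℝ (a j)).comp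
      (lp.evalCLM ℝ (fun _ : ℕ => ℝ) 2 j)
  have hB : ∀ N, IsCompactOperator (B N) := by
    intro N
    have : B N ∈ compactOperator (RingHom.id ℝ) EllTwo H := by
      refine Submodule.sum_mem _ fun j _ => ?_
      have h := isCompactOperator_of_locallyCompactSpace_rng
        (ContinuousLinearMap.toSpanSingleton ℝ (a j))
      exact IsCompactOperator.comp_clm h _
    exact this
  have htail : ∀ N, Summable fun j => ‖a (j + N)‖ ^ 2 := fun N =>
    (summable_nat_add_iff (f := fun j => ‖a j‖ ^ 2) N).2 ha
  refine isCompactOperator_of_tendsto (l := atTop) (F := B) ?_ (.of_forall hB)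
  rw [tendsto_iff_norm_sub_tendsto_zero]
  have hlim : Tendsto (fun N => √(∑' j, ‖a (j + N)‖ ^ 2)) atTop (𝓝 0) := by
    have := (tendsto_sum_nat_add fun j => ‖a j‖ ^ 2)
    simpa [Function.comp_def] using (Real.continuous_sqrt.tendsto 0).comp this
  refine squeeze_zero (fun N => norm_nonneg _) (fun N => ?_) hlim
  rw [norm_sub_rev]
  refine ContinuousLinearMap.opNorm_le_bound _ (Real.sqrt_nonneg _) fun x => ?_
  have hs := (summable_norm_smul_of_sq ha x).of_norm
  have h1 : (synthesis a ha - B N) x = ∑' j, x (j + N) • a (j + N) := by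
    have h2 := hs.sum_add_tsum_nat_add N
    have h3 : synthesis a ha x = ∑' j, x j • a j := (hasSum_synthesis a ha x).tsum_eq.symm
    rw [sub_apply, h3, ← h2]
    simp [B, lp.evalCLM]
  have hx := EllTwo.hasSum_sq x
  have hmem : Memℓp (fun j => x (j + N)) 2 := by
    refine memℓp_gen ?_
    simpa using (summable_nat_add_iff (f := fun j => x j ^ 2) N).2 hx.summable
  let y : EllTwo := ⟨fun j => x (j + N), hmem⟩
  have hy : ‖y‖ ≤ ‖x‖ := by
    refine le_of_sq_le_sq ?_ (norm_nonneg x)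
    rw [← (EllTwo.hasSum_sq y).tsum_eq, ← hx.tsum_eq, ← hx.summable.sum_add_tsum_nat_add N]
    exact le_add_of_nonneg_left (Finset.sum_nonneg fun _ _ => sq_nonneg _)
  rw [h1]
  exact (norm_tsum_smul_le (htail N) y).trans
    (mul_le_mul_of_nonneg_left hy (Real.sqrt_nonneg _))

end Gram

/-! ### Compact positive operators -/

section Spectral

variable {K : Type*} [NormedAddCommGroup K] [InnerProductSpace ℝ K] [CompleteSpace K]

/-- For a positive symmetric operator the norm is the supremum of the Rayleigh quotients. Were it in
the resolvent set, the quotients would stay below it by a fixed amount. So it is a spectral value,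
and a nonzero spectral value of a compact operator is an eigenvalue. -/
theorem exists_unit_eigenvector_norm [Nontrivial K] (T : K →L[ℝ] K) (hc : IsCompactOperator T)
    (hs : T.IsSymmetric) (hpos : ∀ x, 0 ≤ inner ℝ (T x) x) :
    ∃ v : K, ‖v‖ = 1 ∧ T v = ‖T‖ • v := by
  rcases eq_or_ne T 0 with h0 | h0
  · obtain ⟨v, hv⟩ := exists_norm_eq K (zero_le_one' ℝ)
    exact ⟨v, hv, by simp [h0]⟩
  have hT : ‖T‖ ≠ 0 := by simpa using h0
  have hspec : ‖T‖ ∈ spectrum ℝ T := by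
    by_contra hcon
    have hres : algebraMap ℝ ℝ ‖T‖ ∈ resolventSet ℝ T := by
      simpa [spectrum] using hcon
    obtain ⟨ε, hε, hle⟩ := T.rayleighQuotient_le_of_norm_mem_resolventSet hres
    have h1 := T.norm_eq_iSup_rayleighQuotient hs
    have h2 : ⨆ x, |T.rayleighQuotient x| ≤ ‖T‖ - ε := by
      refine ciSup_le fun x => ?_
      rw [abs_of_nonneg]
      · exact hle x
      · exact div_nonneg (by simpa [ContinuousLinearMap.reApplyInnerSelf_apply] using hpos x)
          (sq_nonneg _)
    linarith
  rw [← hc.hasEigenvalue_iff_mem_spectrum hT] at hspec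
  obtain ⟨x, hx⟩ := hspec.exists_hasEigenvector
  have hx0 : ‖x‖ ≠ 0 := by simpa using hx.2
  refine ⟨‖x‖⁻¹ • x, by simp [norm_smul, hx0], ?_⟩
  rw [map_smul, smul_comm]
  congr 1
  exact hx.apply_eq_smul

/-- The restriction to `V` inherits compactness, symmetry and positivity, so its norm is an
eigenvalue and bounds the quadratic form on `V`. This is one step of the deflation that produces the
whole sequence. -/
theorem exists_maximal_eigenvector (T : K →L[ℝ] K) (hc : IsCompactOperator T)
    (hs : T.IsSymmetric) (hpos : ∀ x, 0 ≤ inner ℝ (T x) x) (V : Submodule ℝ K)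
    (hcl : IsClosed (V : Set K)) (hinv : ∀ x ∈ V, T x ∈ V) (hne : V ≠ ⊥) :
    ∃ v ∈ V, ‖v‖ = 1 ∧ ∃ r : ℝ, 0 ≤ r ∧ T v = r • v ∧ ∀ x ∈ V, inner ℝ (T x) x ≤ r * ‖x‖ ^ 2 := by
  have : CompleteSpace V := hcl.completeSpace_coe
  have : Nontrivial V := (Submodule.nontrivial_iff_ne_bot).2 hne
  let S : V →L[ℝ] V := T.restrict hinv
  have hSc : IsCompactOperator S := hc.restrict' hinv
  have hSs : S.IsSymmetric := hs.restrict_invariant hinv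
  obtain ⟨v, hv1, hv2⟩ := exists_unit_eigenvector_norm S hSc hSs fun x => hpos x
  refine ⟨v, v.2, by simpa using hv1, ‖S‖, S.opNorm_nonneg, congrArg Subtype.val hv2, fun x hx => ?_⟩
  have h1 : inner ℝ (S ⟨x, hx⟩) ⟨x, hx⟩ ≤ ‖S ⟨x, hx⟩‖ * ‖(⟨x, hx⟩ : V)‖ := real_inner_le_norm _ _
  have h2 := S.le_opNorm ⟨x, hx⟩
  have h3 : inner ℝ (S ⟨x, hx⟩) ⟨x, hx⟩ = inner ℝ (T x) x := rfl
  have h4 : ‖(⟨x, hx⟩ : V)‖ = ‖x‖ := rfl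
  rw [h3] at h1
  rw [h4] at h1 h2
  nlinarith [norm_nonneg x]

/-- A compact positive operator on an infinite dimensional Hilbert space has an orthonormal sequence
of eigenvectors with nonincreasing eigenvalues that dominate the operator on the orthogonal
complement. -/
theorem exists_orthonormal_eigenvectors (hK : ¬ FiniteDimensional ℝ K) (T : K →L[ℝ] K)
    (hc : IsCompactOperator T) (hs : T.IsSymmetric) (hpos : ∀ x, 0 ≤ inner ℝ (T x) x) :
    ∃ (v : ℕ → K) (r : ℕ → ℝ), Orthonormal ℝ v ∧ Antitone r ∧ (∀ i, 0 ≤ r i) ∧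
      (∀ i, T (v i) = r i • v i) ∧
      ∀ x, (∀ i, inner ℝ (v i) x = 0) → ∀ i, inner ℝ (T x) x ≤ r i * ‖x‖ ^ 2 := by
  -- States of the deflation. Infinite dimension is part of the invariant, so the recursion never
  -- stops: an operator of finite rank simply yields zeros from some index on.
  let α := {V : Submodule ℝ K // IsClosed (V : Set K) ∧ (∀ x ∈ V, T x ∈ V) ∧
    ¬ FiniteDimensional ℝ V}
  have hex : ∀ V : α, ∃ v ∈ V.1, ‖v‖ = 1 ∧ ∃ r : ℝ, 0 ≤ r ∧ T v = r • v ∧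
      ∀ x ∈ V.1, inner ℝ (T x) x ≤ r * ‖x‖ ^ 2 := by
    intro V
    refine exists_maximal_eigenvector T hc hs hpos V.1 V.2.1 V.2.2.1 ?_
    intro h
    exact V.2.2.2 (h ▸ inferInstance)
  choose e he1 he2 r hr0 he3 hmax using hex
  have hstep : ∀ V : α, IsClosed ((V.1 ⊓ (ℝ ∙ e V)ᗮ : Submodule ℝ K) : Set K) ∧
      (∀ x ∈ V.1 ⊓ (ℝ ∙ e V)ᗮ, T x ∈ V.1 ⊓ (ℝ ∙ e V)ᗮ) ∧
      ¬ FiniteDimensional ℝ (V.1 ⊓ (ℝ ∙ e V)ᗮ : Submodule ℝ K) := by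
    intro V
    refine ⟨V.2.1.inter (Submodule.isClosed_orthogonal _), ?_, ?_⟩
    · intro x hx
      refine ⟨V.2.2.1 x hx.1, ?_⟩
      have h1 := (Submodule.mem_orthogonal_singleton_iff_inner_right).1 hx.2
      refine (Submodule.mem_orthogonal_singleton_iff_inner_right).2 ?_
      have h2 : inner ℝ (T (e V)) x = inner ℝ (e V) (T x) := hs (e V) x
      rw [← h2, he3, inner_smul_left, h1, mul_zero]
    · intro hfin
      apply V.2.2.2
      have := hfin
      have hle : V.1 ≤ (V.1 ⊓ (ℝ ∙ e V)ᗮ) ⊔ (ℝ ∙ e V) := by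
        intro x hx
        have h1 : x = (x - inner ℝ (e V) x • e V) + inner ℝ (e V) x • e V := by simp
        rw [h1]
        refine Submodule.add_mem_sup ⟨V.1.sub_mem hx (V.1.smul_mem _ (he1 V)), ?_⟩
          (Submodule.smul_mem _ _ (Submodule.mem_span_singleton_self _))
        refine (Submodule.mem_orthogonal_singleton_iff_inner_right).2 ?_
        rw [inner_sub_right, inner_smul_right, real_inner_self_eq_norm_sq, he2]
        ring
      exact Submodule.finiteDimensional_of_le hle
  let next : α → α := fun V => ⟨_, hstep V⟩
  let V0 : α := ⟨⊤, isClosed_univ, fun _ _ => trivial, fun h => hK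
    (LinearEquiv.finiteDimensional (Submodule.topEquiv (R := ℝ) (M := K)))⟩
  let V : ℕ → α := fun n => next^[n] V0
  have hVs : ∀ n, (V (n + 1)).1 = (V n).1 ⊓ (ℝ ∙ e (V n))ᗮ := by
    intro n
    simp only [V, Function.iterate_succ_apply']
    rfl
  have hanti : Antitone fun n => (V n).1 :=
    antitone_nat_of_succ_le fun n => by rw [hVs]; exact inf_le_left
  have horth : ∀ i j, i < j → inner ℝ (e (V i)) (e (V j)) = 0 := by
    intro i j hij
    have h1 : e (V j) ∈ (V (i + 1)).1 := hanti (Nat.succ_le_of_lt hij) (he1 (V j))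
    rw [hVs] at h1
    exact (Submodule.mem_orthogonal_singleton_iff_inner_right).1 h1.2
  refine ⟨fun n => e (V n), fun n => r (V n), ⟨fun n => he2 _, fun i j hij => ?_⟩, ?_,
    fun i => hr0 _, fun i => he3 _, fun x hx i => hmax (V i) x ?_⟩
  · rcases lt_or_gt_of_ne hij with h | h
    · exact horth i j h
    · rw [real_inner_comm]; exact horth j i h
  · refine antitone_nat_of_succ_le fun n => ?_
    have h1 := hmax (V n) (e (V (n + 1))) (hanti (Nat.le_succ n) (he1 _))
    rw [he3, inner_smul_left, real_inner_self_eq_norm_sq, he2] at h1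
    simpa using h1
  · induction i with
    | zero => trivial
    | succ n ih =>
      rw [hVs]
      exact ⟨ih, (Submodule.mem_orthogonal_singleton_iff_inner_right).2 (hx n)⟩

end Spectral

/-! ### Pythagoras and Bessel expansions for orthogonal families -/

section Orthonormal

variable {ι H : Type*} [NormedAddCommGroup H] [InnerProductSpace ℝ H]

/-- The coefficients are given by `inner ℝ x (b i) = r i * c i` instead of a division by `r i`, so
that vectors `b i` of norm zero are allowed. It is used with `r = 1` for orthonormal families and
with eigenvalues for images of eigenvectors. -/
theorem norm_sub_sum_smul_sq {s : Finset ι} {b : ι → H} {r c : ι → ℝ} {x : H}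
    (hb : ∀ i ∈ s, ∀ k ∈ s, i ≠ k → inner ℝ (b i) (b k) = 0) (hr : ∀ i ∈ s, ‖b i‖ ^ 2 = r i)
    (hc : ∀ i ∈ s, inner ℝ x (b i) = r i * c i) :
    ‖x - ∑ i ∈ s, c i • b i‖ ^ 2 = ‖x‖ ^ 2 - ∑ i ∈ s, r i * c i ^ 2 := by
  have h1 : inner ℝ x (∑ i ∈ s, c i • b i) = ∑ i ∈ s, r i * c i ^ 2 := by
    rw [inner_sum]
    refine Finset.sum_congr rfl fun i hi => ?_
    rw [inner_smul_right, hc i hi]; ring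
  have h2 : ‖∑ i ∈ s, c i • b i‖ ^ 2 = ∑ i ∈ s, r i * c i ^ 2 := by
    rw [← real_inner_self_eq_norm_sq, sum_inner]
    refine Finset.sum_congr rfl fun i hi => ?_
    rw [inner_sum, Finset.sum_eq_single i]
    · rw [inner_smul_left, inner_smul_right, real_inner_self_eq_norm_sq, hr i hi]
      simp; ring
    · intro k hk hki
      rw [inner_smul_left, inner_smul_right, hb i hi k hk hki.symm]; simp
    · exact fun h => absurd hi h
  rw [norm_sub_sq_real, h1, h2]; ring

variable [CompleteSpace H]

theorem summable_inner_smul_of_orthonormal {v : ι → H} (hv : Orthonormal ℝ v) (x : H) :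
    Summable fun i => inner ℝ (v i) x • v i := by
  have h := (hv.orthogonalFamily.summable_iff_norm_sq_summable fun i => inner ℝ (v i) x).2 (by
    simpa using hv.inner_products_summable x)
  simpa using h

theorem inner_tsum_inner_smul_of_orthonormal {v : ι → H} (hv : Orthonormal ℝ v) (x : H) (i : ι) :
    inner ℝ (v i) (∑' k, inner ℝ (v k) x • v k) = inner ℝ (v i) x := by
  classical
  have h := (innerSL ℝ (v i)).hasSum (summable_inner_smul_of_orthonormal hv x).hasSum
  refine h.unique ?_
  have h2 := hasSum_ite_eq i (inner ℝ (v i) x)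
  refine h2.congr_fun ?_
  intro k
  simp only [innerSL_apply_apply, inner_smul_right, orthonormal_iff_ite.1 hv]
  by_cases hk : k = i
  · simp [hk]
  · simp [hk, Ne.symm hk]

end Orthonormal

/-! ### Eigenvalues and trace of an infinite Gram matrix -/

section GramEigen

variable {H : Type*} [NormedAddCommGroup H] [InnerProductSpace ℝ H] [CompleteSpace H]

theorem synthesis_single (a : ℕ → H) (ha : Summable fun j => ‖a j‖ ^ 2) (j : ℕ) :
    synthesis a ha (lp.single 2 j (1 : ℝ)) = a j := by
  refine (hasSum_synthesis a ha _).unique ?_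
  have h := hasSum_single (f := fun l => (lp.single 2 j (1 : ℝ) : EllTwo) l • a l) j
    (fun l hl => by simp [hl])
  simpa using h

theorem not_finiteDimensional_ellTwo : ¬ FiniteDimensional ℝ EllTwo := by
  intro h
  have hli : LinearIndependent ℝ fun j : ℕ => (lp.single 2 j (1 : ℝ) : EllTwo) := by
    refine Orthonormal.linearIndependent ⟨fun j => by simp, fun i j hij => ?_⟩
    beta_reduce
    rw [lp.inner_single_left]
    simp [hij]
  have := hli.finite
  exact not_finite ℕ

/-- The Gram matrix of a square summable sequence in a Hilbert space has a sequence of ordered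
eigenvalues. -/
theorem exists_isOrderedEigenvalues_gram (a : ℕ → H) (ha : Summable fun j => ‖a j‖ ^ 2) :
    ∃ ev, IsOrderedEigenvalues (fun j l => inner ℝ (a j) (a l)) ev := by
  let A := synthesis a ha
  let T : EllTwo →L[ℝ] EllTwo := A.adjoint ∘L A
  have hc : IsCompactOperator T := (isCompactOperator_synthesis a ha).clm_comp A.adjoint
  have hT : ∀ x y, inner ℝ (T x) y = inner ℝ (A x) (A y) := fun x y =>
    A.adjoint_inner_left y (A x)
  have hs : T.IsSymmetric := by
    intro x y
    change inner ℝ (T x) y = inner ℝ x (T y)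
    rw [hT, real_inner_comm (T y) x, hT, real_inner_comm]
  have hpos : ∀ x, 0 ≤ inner ℝ (T x) x := fun x => by
    rw [hT]; exact real_inner_self_nonneg
  obtain ⟨v, r, hv, hr, hr0, hev, hmax⟩ :=
    exists_orthonormal_eigenvectors not_finiteDimensional_ellTwo T hc hs hpos
  have hTj : ∀ x j, T x j = inner ℝ (a j) (A x) := by
    intro x j
    have h1 := hT x (lp.single 2 j (1 : ℝ))
    rw [synthesis_single, lp.inner_single_right] at h1
    rw [real_inner_comm (A x), ← h1]
    simp
  have hAk : ∀ i k, inner ℝ (A (v i)) (A (v k)) = r i * inner ℝ (v i) (v k) := fun i k => by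
    rw [← hT, hev, inner_smul_left]; simp
  have hri : ∀ i, ‖A (v i)‖ ^ 2 = r i := fun i => by
    rw [← real_inner_self_eq_norm_sq, hAk, real_inner_self_eq_norm_sq, hv.1 i]; simp
  -- Bessel's inequality for `a j` against the orthogonal vectors `A (v i)`, the coefficients being
  -- `v i j`; summing over `j` bounds the partial sums of the eigenvalues by the trace.
  have hfin : ∀ N, ∑ i ∈ Finset.range N, r i ≤ ∑' j, ‖a j‖ ^ 2 := by
    intro N
    have h1 : HasSum (fun j => ∑ i ∈ Finset.range N, r i * v i j ^ 2)
        (∑ i ∈ Finset.range N, r i) := by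
      refine hasSum_sum fun i _ => ?_
      simpa [hv.1 i] using (EllTwo.hasSum_sq (v i)).mul_left (r i)
    refine hasSum_le (fun j => ?_) h1 ha.hasSum
    have h2 := norm_sub_sum_smul_sq (s := Finset.range N) (b := fun i => A (v i)) (r := r)
      (c := fun i => v i j) (x := a j)
      (fun i _ k _ hik => by rw [hAk, hv.2 hik, mul_zero]) (fun i _ => hri i)
      (fun i _ => by rw [← hTj, hev]; simp)
    have h3 := sq_nonneg ‖a j - ∑ i ∈ Finset.range N, v i j • A (v i)‖
    rw [h2] at h3
    linarith
  have hsum : Summable r := summable_of_sum_range_le hr0 hfin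
  refine ⟨r, hr, hr0, v, hv, fun i j => ?_, fun x hx j => ?_⟩
  · have h1 := hasSum_inner_synthesis a ha (v i) (a j)
    have h2 : inner ℝ (a j) (synthesis a ha (v i)) = r i * v i j := by
      rw [← hTj, hev]; simp
    rwa [h2] at h1
  · have h1 := hasSum_inner_synthesis a ha x (a j)
    -- On the complement the form is below every `r i * ‖x‖ ^ 2`, and a summable sequence tends to
    -- zero. Hence `A x = 0`: the eigenvectors exhaust `T` up to its kernel.
    have h2 : inner ℝ (T x) x ≤ 0 := by
      have hlim := hsum.tendsto_atTop_zero.mul_const (‖x‖ ^ 2)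
      rw [zero_mul] at hlim
      exact ge_of_tendsto' hlim fun i => hmax x hx i
    rw [hT, real_inner_self_eq_norm_sq] at h2
    have h3 : A x = 0 := by
      have : ‖A x‖ ^ 2 = 0 := le_antisymm h2 (sq_nonneg _)
      simpa using this
    change HasSum _ (inner ℝ (a j) (A x)) at h1
    rwa [h3, inner_zero_right] at h1

/-- The vectors `∑ v_i(j) a_j` built from the eigenvectors of a Gram matrix are orthogonal, with the
eigenvalues as squared norms, and the eigenvalues sum up to the trace. -/
theorem IsOrderedEigenvalues.exists_orthonormal {a : ℕ → H} (ha : Summable fun j => ‖a j‖ ^ 2)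
    {ev : ℕ → ℝ} (hev : IsOrderedEigenvalues (fun j l => inner ℝ (a j) (a l)) ev) :
    ∃ v : ℕ → EllTwo, Orthonormal ℝ v ∧
      (∀ i k, inner ℝ (synthesis a ha (v i)) (synthesis a ha (v k)) = if i = k then ev i else 0) ∧
      HasSum ev (∑' j, ‖a j‖ ^ 2) := by
  obtain ⟨-, hev0, v, hv, h1, h2⟩ := hev
  have hA : ∀ i j, inner ℝ (a j) (synthesis a ha (v i)) = ev i * v i j := fun i j =>
    (hasSum_inner_synthesis a ha (v i) (a j)).unique (h1 i j)
  refine ⟨v, hv, fun i k => ?_, ?_⟩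
  · have h3 := hasSum_inner_synthesis a ha (v k) (synthesis a ha (v i))
    have h4 : HasSum (fun j => inner ℝ (synthesis a ha (v i)) (a j) * v k j)
        (ev i * inner ℝ (v i) (v k)) := by
      refine ((EllTwo.hasSum_mul (v i) (v k)).mul_left (ev i)).congr_fun fun j => ?_
      rw [real_inner_comm, hA]; ring
    rw [h3.unique h4, orthonormal_iff_ite.1 hv]
    simp
  -- The `j`-th coordinate vector minus its expansion in the `v i` is annihilated by the Gram
  -- matrix, so only the expansion contributes to `‖a j‖ ^ 2`. Summing over `j` and exchanging the
  -- order of nonnegative sums gives the trace formula.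
  · have hdiag : ∀ j, HasSum (fun i => ev i * v i j ^ 2) (‖a j‖ ^ 2) := by
      intro j
      let x : EllTwo := lp.single 2 j (1 : ℝ)
      have hvx : ∀ i, inner ℝ (v i) x = v i j := fun i => by
        simp [x, lp.inner_single_right]
      let p : EllTwo := ∑' i, inner ℝ (v i) x • v i
      have hp : HasSum (fun i => inner ℝ (v i) x • v i) p :=
        (summable_inner_smul_of_orthonormal hv x).hasSum
      have h3 := h2 (x - p) (fun i => by
        rw [inner_sub_right, inner_tsum_inner_smul_of_orthonormal hv, sub_self]) j
      have h4 := (hasSum_inner_synthesis a ha (x - p) (a j)).unique h3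
      rw [map_sub, inner_sub_right, synthesis_single, real_inner_self_eq_norm_sq, sub_eq_zero] at h4
      rw [h4]
      have h5 := (innerSL ℝ (a j)).hasSum ((synthesis a ha).hasSum hp)
      refine h5.congr_fun fun i => ?_
      simp [hA, hvx]
      ring
    have hnn : 0 ≤ fun q : ℕ × ℕ => ev q.2 * v q.2 q.1 ^ 2 := fun q =>
      mul_nonneg (hev0 _) (sq_nonneg _)
    have hprod : Summable fun q : ℕ × ℕ => ev q.2 * v q.2 q.1 ^ 2 :=
      (summable_prod_of_nonneg hnn).2 ⟨fun j => (hdiag j).summable, by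
        simpa only [fun j => (hdiag j).tsum_eq] using ha⟩
    have hcol : ∀ i, HasSum (fun j => ev i * v i j ^ 2) (ev i) := fun i => by
      simpa [hv.1 i] using (EllTwo.hasSum_sq (v i)).mul_left (ev i)
    have h3 := hprod.hasSum.prod_fiberwise hdiag
    rw [h3.tsum_eq]
    have h4 := hprod.prod_symm.hasSum.prod_fiberwise hcol
    have h5 := (Equiv.prodComm ℕ ℕ).tsum_eq fun q : ℕ × ℕ => ev q.2 * v q.2 q.1 ^ 2
    rwa [← h5]

end GramEigen

end ExogeneityTest
end

noncomputable section
namespace ExogeneityTest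

/-! ### Normalized sums of i.i.d. random elements -/

section IID

variable {Ω S : Type*}

/-- The normalized sum `n^{-1/2} ∑_{i < n} g(X_i)`. -/
def normSum (X : ℕ → Ω → S) (n : ℕ) (g : S → ℝ) (ω : Ω) : ℝ :=
  (√(n : ℝ))⁻¹ * ∑ i ∈ Finset.range n, g (X i ω)

theorem normSum_sum {ι : Type*} (X : ℕ → Ω → S) (n : ℕ) (s : Finset ι) (c : ι → ℝ)
    (g : ι → S → ℝ) (ω : Ω) :
    normSum X n (fun x => ∑ l ∈ s, c l * g l x) ω = ∑ l ∈ s, c l * normSum X n (g l) ω := by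
  simp only [normSum, Finset.mul_sum]
  rw [Finset.sum_comm]
  refine Finset.sum_congr rfl fun l _ => Finset.sum_congr rfl fun i _ => by ring

theorem normSum_sub (X : ℕ → Ω → S) (n : ℕ) (g h : S → ℝ) (ω : Ω) :
    normSum X n (fun x => g x - h x) ω = normSum X n g ω - normSum X n h ω := by
  simp only [normSum, Finset.sum_sub_distrib, mul_sub]

variable [MeasurableSpace Ω] [MeasurableSpace S]

/-- The random elements `X i` are i.i.d. with law `μ`. -/
structure IsIID (P : Measure Ω) (X : ℕ → Ω → S) (μ : Measure S) : Prop where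
  measurable : ∀ i, Measurable (X i)
  indep : iIndepFun X P
  law : ∀ i, P.map (X i) = μ

variable {P : Measure Ω} {X : ℕ → Ω → S} {μ : Measure S}

theorem IsIID.measurePreserving (h : IsIID P X μ) (i : ℕ) : MeasurePreserving (X i) P μ :=
  ⟨h.measurable i, h.law i⟩

theorem IsIID.ae (h : IsIID P X μ) {p : S → Prop} (hp : ∀ᵐ x ∂μ, p x) :
    ∀ᵐ ω ∂P, ∀ i, p (X i ω) :=
  ae_all_iff.2 fun i => (h.measurePreserving i).quasiMeasurePreserving.ae hp

theorem IsIID.measurable_normSum (h : IsIID P X μ) {g : S → ℝ} (hg : Measurable g) (n : ℕ) :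
    Measurable (normSum X n g) := by
  unfold normSum
  exact (Finset.measurable_sum _ fun i _ => hg.comp (h.measurable i)).const_mul _

theorem IsIID.memLp_normSum (h : IsIID P X μ) {g : S → ℝ} (hg : MemLp g 2 μ) (n : ℕ) :
    MemLp (normSum X n g) 2 P := by
  unfold normSum
  exact (memLp_finsetSum _ fun i _ => hg.comp_measurePreserving (h.measurePreserving i)).const_mul _

theorem IsIID.integrable_normSum_sq (h : IsIID P X μ) {g : S → ℝ} (hg : MemLp g 2 μ) (n : ℕ) :
    Integrable (fun ω => normSum X n g ω ^ 2) P :=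
  (h.memLp_normSum hg n).integrable_sq

variable [IsProbabilityMeasure P]

theorem IsIID.isProbabilityMeasure (h : IsIID P X μ) : IsProbabilityMeasure μ := by
  rw [← h.law 0]
  exact Measure.isProbabilityMeasure_map (h.measurable 0).aemeasurable

/-- Independence makes variances add up. The mean enters with a factor `n`, so an uncentered summand
is harmless only if its mean is of smaller order than `n^{-1/2}`. -/
theorem IsIID.integral_normSum_sq (h : IsIID P X μ) {g : S → ℝ} (hgm : Measurable g)
    (hg : MemLp g 2 μ) {n : ℕ} (hn : n ≠ 0) :
    ∫ ω, normSum X n g ω ^ 2 ∂P = ∫ x, g x ^ 2 ∂μ - (∫ x, g x ∂μ) ^ 2 + n * (∫ x, g x ∂μ) ^ 2 := by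
  have := h.isProbabilityMeasure
  have hL : ∀ i, MemLp (fun ω => g (X i ω)) 2 P := fun i =>
    hg.comp_measurePreserving (h.measurePreserving i)
  have hmean : ∀ i, ∫ ω, g (X i ω) ∂P = ∫ x, g x ∂μ := fun i => by
    rw [← h.law i, integral_map (h.measurable i).aemeasurable hgm.aestronglyMeasurable]
  have hsq : ∀ i, ∫ ω, g (X i ω) ^ 2 ∂P = ∫ x, g x ^ 2 ∂μ := fun i => by
    rw [← h.law i, integral_map (h.measurable i).aemeasurable (hgm.pow_const 2).aestronglyMeasurable]
  have hvar : ∀ i, Var[fun ω => g (X i ω); P] = ∫ x, g x ^ 2 ∂μ - (∫ x, g x ∂μ) ^ 2 := fun i => by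
    rw [variance_eq_sub (hL i)]
    simp only [Pi.pow_apply, hsq, hmean]
  have hsum : Var[∑ i ∈ Finset.range n, fun ω => g (X i ω); P] =
      n * (∫ x, g x ^ 2 ∂μ - (∫ x, g x ∂μ) ^ 2) := by
    rw [IndepFun.variance_sum (fun i _ => hL i)
      (fun i _ j _ hij => (h.indep.indepFun hij).comp hgm hgm)]
    simp [hvar]; ring
  have hS : MemLp (∑ i ∈ Finset.range n, fun ω => g (X i ω)) 2 P :=
    memLp_finsetSum' _ fun i _ => hL i
  rw [variance_eq_sub hS] at hsum
  have hmeanS : ∫ ω, (∑ i ∈ Finset.range n, fun ω => g (X i ω)) ω ∂P = n * ∫ x, g x ∂μ := by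
    simp only [Finset.sum_apply]
    rw [integral_finsetSum _ fun i _ => (hL i).integrable (by norm_num)]
    simp [hmean]
  rw [hmeanS] at hsum
  have hn0 : (n : ℝ) ≠ 0 := by exact_mod_cast hn
  simp only [normSum, mul_pow, inv_pow, Real.sq_sqrt (Nat.cast_nonneg n)]
  rw [integral_const_mul]
  simp only [Pi.pow_apply, Finset.sum_apply] at hsum
  field_simp
  linarith

theorem IsIID.integral_normSum_sq_le (h : IsIID P X μ) {g : S → ℝ} (hgm : Measurable g)
    (hg : MemLp g 2 μ) (n : ℕ) :
    ∫ ω, normSum X n g ω ^ 2 ∂P ≤ ∫ x, g x ^ 2 ∂μ + n * (∫ x, g x ∂μ) ^ 2 := by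
  rcases eq_or_ne n 0 with rfl | hn
  · simp [normSum]
    positivity
  · rw [h.integral_normSum_sq hgm hg hn]
    nlinarith [sq_nonneg (∫ x, g x ∂μ)]

theorem IsIID.integral_normSum_sq_of_centered (h : IsIID P X μ) {g : S → ℝ} (hgm : Measurable g)
    (hg : MemLp g 2 μ) (h0 : ∫ x, g x ∂μ = 0) {n : ℕ} (hn : n ≠ 0) :
    ∫ ω, normSum X n g ω ^ 2 ∂P = ∫ x, g x ^ 2 ∂μ := by
  rw [h.integral_normSum_sq hgm hg hn, h0]; simp

/-- The characteristic function of a normalized sum of centered i.i.d. variables converges. -/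
theorem IsIID.tendsto_charFun_normSum (h : IsIID P X μ) {g : S → ℝ} (hgm : Measurable g)
    (hg : MemLp g 2 μ) (h0 : ∫ x, g x ∂μ = 0) (t : ℝ) :
    Tendsto (fun n => charFun (P.map (normSum X n g)) t) atTop
      (𝓝 (Complex.exp (-(((∫ x, g x ^ 2 ∂μ) * t ^ 2 / 2 : ℝ) : ℂ)))) := by
  have := h.isProbabilityMeasure
  have hL : MemLp (fun ω => g (X 0 ω)) 2 P := hg.comp_measurePreserving (h.measurePreserving 0)
  have hmean : ∫ ω, g (X 0 ω) ∂P = 0 := by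
    rw [← h0, ← h.law 0, integral_map (h.measurable 0).aemeasurable hgm.aestronglyMeasurable]
  have hvar : Var[fun ω => g (X 0 ω); P] = ∫ x, g x ^ 2 ∂μ := by
    rw [variance_eq_sub hL, hmean, ← h.law 0,
      integral_map (h.measurable 0).aemeasurable (hgm.pow_const 2).aestronglyMeasurable]
    simp
  have hY : HasLaw (id : ℝ → ℝ) (gaussianReal 0 Var[fun ω => g (X 0 ω); P].toNNReal)
      (gaussianReal 0 Var[fun ω => g (X 0 ω); P].toNNReal) := ⟨by fun_prop, by simp⟩
  have hclt := tendstoInDistribution_inv_sqrt_mul_sum_sub (X := fun i ω => g (X i ω)) hY hL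
    (h.indep.comp (fun _ => g) fun _ => hgm)
    (fun i => ⟨(hgm.comp (h.measurable i)).aemeasurable, (hgm.comp (h.measurable 0)).aemeasurable, by
      change P.map (g ∘ X i) = P.map (g ∘ X 0)
      rw [← Measure.map_map hgm (h.measurable i), ← Measure.map_map hgm (h.measurable 0), h.law,
        h.law]⟩)
  have h1 := ProbabilityMeasure.tendsto_iff_tendsto_charFun.1 hclt.tendsto t
  simp only [ProbabilityMeasure.coe_mk, hmean, mul_zero, sub_zero, Measure.map_id,
    charFun_gaussianReal, hvar] at h1
  have h2 : 0 ≤ ∫ x, g x ^ 2 ∂μ := integral_nonneg fun x => sq_nonneg _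
  rw [Real.coe_toNNReal _ h2] at h1
  convert! h1 using 2
  push_cast
  ring_nf

end IID

/-! ### Convergence in distribution -/

section Approximation

variable {Ω Ω' : Type*} [MeasurableSpace Ω] [MeasurableSpace Ω'] {P : Measure Ω} {P' : Measure Ω'}
  [IsProbabilityMeasure P] [IsProbabilityMeasure P']

/-- Since `|exp(ia) - exp(ib)| ≤ |a - b|`, closeness in `L¹` is enough to control characteristic
functions at a fixed point. -/
theorem norm_charFun_map_sub_le {A B : Ω → ℝ} (hA : AEMeasurable A P) (hB : AEMeasurable B P)
    (hint : Integrable (fun ω => A ω - B ω) P) (t : ℝ) :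
    ‖charFun (P.map A) t - charFun (P.map B) t‖ ≤ |t| * ∫ ω, |A ω - B ω| ∂P := by
  simp only [charFun_apply_real]
  have hc : Continuous fun x : ℝ => Complex.exp (t * x * Complex.I) := by fun_prop
  rw [integral_map hA hc.aestronglyMeasurable, integral_map hB hc.aestronglyMeasurable]
  have hn : ∀ y : ℝ, ‖Complex.exp (t * y * Complex.I)‖ = 1 := fun y => by
    rw [← Complex.ofReal_mul, Complex.norm_exp_ofReal_mul_I]
  have hi : ∀ {D : Ω → ℝ}, AEMeasurable D P →
      Integrable (fun ω => Complex.exp (t * D ω * Complex.I)) P := fun {D} hD =>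
    Integrable.of_bound (hc.comp_aestronglyMeasurable hD.aestronglyMeasurable) 1
      (.of_forall fun ω => (hn _).le)
  rw [← integral_sub (hi hA) (hi hB), ← integral_const_mul]
  refine norm_integral_le_of_norm_le (hint.abs.const_mul _) (.of_forall fun ω => ?_)
  have h1 : Complex.exp (t * A ω * Complex.I) - Complex.exp (t * B ω * Complex.I) =
      Complex.exp (t * B ω * Complex.I) *
        (Complex.exp (Complex.I * ((t * (A ω - B ω) : ℝ) : ℂ)) - 1) := by
    rw [mul_sub, ← Complex.exp_add, mul_one]
    congr 2
    push_cast; ring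
  rw [h1, norm_mul, hn, one_mul]
  refine (Real.norm_exp_I_mul_ofReal_sub_one_le).trans ?_
  rw [Real.norm_eq_abs, abs_mul]

/-- Convergence in distribution follows from convergence in distribution of arbitrarily good
approximations in `L¹`. -/
theorem tendstoInDistribution_of_approx {Q : ℕ → Ω → ℝ} {R : Ω' → ℝ}
    (hQ : ∀ n, AEMeasurable (Q n) P) (hR : AEMeasurable R P')
    (happrox : ∀ ε > 0, ∃ (A : ℕ → Ω → ℝ) (B : Ω' → ℝ),
      TendstoInDistribution A atTop B (fun _ => P) P' ∧
      (∀ᶠ n in atTop, Integrable (fun ω => Q n ω - A n ω) P ∧ ∫ ω, |Q n ω - A n ω| ∂P ≤ ε) ∧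
      Integrable (fun ω => R ω - B ω) P' ∧ ∫ ω, |R ω - B ω| ∂P' ≤ ε) :
    TendstoInDistribution Q atTop R (fun _ => P) P' := by
  refine ⟨hQ, hR, ProbabilityMeasure.tendsto_iff_tendsto_charFun.2 fun t => ?_⟩
  simp only [ProbabilityMeasure.coe_mk]
  rw [Metric.tendsto_atTop']
  intro δ hδ
  -- With this accuracy each of the two approximation errors costs less than `δ / 3`; the `+ 1`
  -- covers `t = 0`.
  obtain ⟨A, B, hAB, h1, h2, h3⟩ := happrox (δ / (3 * (|t| + 1))) (by positivity)
  have h4 := ProbabilityMeasure.tendsto_iff_tendsto_charFun.1 hAB.tendsto t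
  simp only [ProbabilityMeasure.coe_mk] at h4
  have h5 := (Metric.tendsto_nhds.1 h4) (δ / 3) (by positivity)
  obtain ⟨N, hN⟩ := eventually_atTop.1 (h1.and h5)
  refine ⟨N, fun n hn => ?_⟩
  obtain ⟨⟨h6, h7⟩, h8⟩ := hN n hn.le
  have h9 := norm_charFun_map_sub_le (hQ n) (hAB.forall_aemeasurable n) h6 t
  have h10 := norm_charFun_map_sub_le hR hAB.aemeasurable_limit h2 t
  have h11 : |t| * (δ / (3 * (|t| + 1))) < δ / 3 := by
    rw [← mul_div_assoc, div_lt_div_iff₀ (by positivity) (by norm_num)]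
    nlinarith [abs_nonneg t]
  have h12 : ‖charFun (P.map (Q n)) t - charFun (P.map (A n)) t‖ < δ / 3 :=
    (h9.trans (mul_le_mul_of_nonneg_left h7 (abs_nonneg t))).trans_lt h11
  have h13 : ‖charFun (P'.map R) t - charFun (P'.map B) t‖ < δ / 3 :=
    (h10.trans (mul_le_mul_of_nonneg_left h3 (abs_nonneg t))).trans_lt h11
  rw [← dist_eq_norm] at h12 h13
  rw [dist_comm] at h13
  have := dist_triangle4 (charFun (P.map (Q n)) t) (charFun (P.map (A n)) t)
    (charFun (P'.map B) t) (charFun (P'.map R) t)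
  linarith

end Approximation

/-! ### Central limit theorem for finitely many uncorrelated functions -/

section VectorCLT

variable {Ω Ω' S : Type*} [MeasurableSpace Ω] [MeasurableSpace Ω'] [MeasurableSpace S]
  {P : Measure Ω} {P' : Measure Ω'} [IsProbabilityMeasure P] [IsProbabilityMeasure P']
  {X : ℕ → Ω → S} {μ : Measure S}

theorem integral_sum_mul_sq {ι : Type*} {s : Finset ι} {g : ι → S → ℝ} {c : ι → ℝ}
    (hg : ∀ i ∈ s, MemLp (g i) 2 μ) :
    ∫ x, (∑ i ∈ s, c i * g i x) ^ 2 ∂μ = ∑ i ∈ s, ∑ j ∈ s, c i * c j * ∫ x, g i x * g j x ∂μ := by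
  have h1 : ∀ x, (∑ i ∈ s, c i * g i x) ^ 2 =
      ∑ i ∈ s, ∑ j ∈ s, c i * c j * (g i x * g j x) := fun x => by
    rw [pow_two, Finset.sum_mul_sum]
    exact Finset.sum_congr rfl fun i _ => Finset.sum_congr rfl fun j _ => by ring
  have h2 : ∀ i ∈ s, ∀ j ∈ s, Integrable (fun x => c i * c j * (g i x * g j x)) μ :=
    fun i hi j hj => ((hg i hi).integrable_mul (hg j hj)).const_mul _
  simp only [h1]
  rw [integral_finsetSum _ fun i hi => integrable_finsetSum _ (h2 i hi)]
  refine Finset.sum_congr rfl fun i hi => ?_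
  rw [integral_finsetSum _ (h2 i hi)]
  exact Finset.sum_congr rfl fun j _ => integral_const_mul _ _

theorem map_sq_gaussianReal {v : ℝ} (hv : 0 ≤ v) :
    (gaussianReal 0 v.toNNReal).map (fun x => x ^ 2) = chiSquareOne.map (fun x => v * x) := by
  have h1 : gaussianReal 0 v.toNNReal = (gaussianReal 0 1).map (fun x => √v * x) := by
    rw [gaussianReal_map_const_mul]
    congr 1
    · simp
    · ext; simp [Real.sq_sqrt hv, hv]
  rw [h1, chiSquareOne, Measure.map_map (by fun_prop) (by fun_prop),
    Measure.map_map (by fun_prop) (by fun_prop)]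
  congr 1
  ext x
  simp [mul_pow, Real.sq_sqrt hv]

/-- The law of a weighted sum of squares of independent centered normal variables. -/
theorem map_sum_sq_pi_gaussianReal {N : ℕ} {ev : Fin N → ℝ} (hev : ∀ i, 0 ≤ ev i)
    {χ : Fin N → Ω' → ℝ} (hχ : ∀ j, HasLaw (χ j) chiSquareOne P') (hχindep : iIndepFun χ P') :
    (Measure.pi fun i => gaussianReal 0 (ev i).toNNReal).map (fun x => ∑ i, x i ^ 2) =
      P'.map fun ω => ∑ i, ev i * χ i ω := by
  have : IsProbabilityMeasure chiSquareOne := by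
    unfold chiSquareOne
    exact Measure.isProbabilityMeasure_map (by fun_prop)
  have h1 : P'.map (fun ω i => χ i ω) = Measure.pi fun _ => chiSquareOne := by
    rw [(iIndepFun_iff_map_fun_eq_pi_map fun i => (hχ i).aemeasurable).1 hχindep]
    simp only [(hχ _).map_eq]
  have hm : AEMeasurable (fun ω i => χ i ω) P' := aemeasurable_pi_lambda _ fun i => (hχ i).aemeasurable
  have h2 : (fun ω => ∑ i, ev i * χ i ω) =
      (fun x : Fin N → ℝ => ∑ i, x i) ∘ (fun x i => ev i * x i) ∘ fun ω i => χ i ω := rfl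
  have h3 : (fun x : Fin N → ℝ => ∑ i, x i ^ 2) =
      (fun x : Fin N → ℝ => ∑ i, x i) ∘ fun x i => x i ^ 2 := rfl
  have hmul : Measurable fun (x : Fin N → ℝ) i => ev i * x i :=
    measurable_pi_lambda _ fun i =>
      Measurable.const_mul (f := fun x : Fin N → ℝ => x i) (by fun_prop) (ev i)
  rw [h2, ← AEMeasurable.map_map_of_aemeasurable (by fun_prop) (hmul.comp_aemeasurable hm),
    ← AEMeasurable.map_map_of_aemeasurable hmul.aemeasurable hm, h1, h3,
    ← Measure.map_map (by fun_prop) (by fun_prop)]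
  have hp : ∀ i, IsProbabilityMeasure ((gaussianReal 0 (ev i).toNNReal).map fun x => x ^ 2) :=
    fun i => Measure.isProbabilityMeasure_map (by fun_prop)
  have hp' : ∀ i, IsProbabilityMeasure (chiSquareOne.map fun x => ev i * x) :=
    fun i => Measure.isProbabilityMeasure_map (by fun_prop)
  rw [Measure.pi_map_pi (f := fun _ x => x ^ 2) (fun i => by fun_prop),
    Measure.pi_map_pi (f := fun i x => ev i * x) (fun i => by fun_prop)]
  simp only [map_sq_gaussianReal (hev _)]

/-- The sum of the squares of uncorrelated normalized sums converges to a weighted sum of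
independent chi-square variables. -/
theorem IsIID.tendstoInDistribution_sum_normSum_sq (h : IsIID P X μ) {N : ℕ} {ξ : Fin N → S → ℝ}
    (hm : ∀ i, Measurable (ξ i)) (hL : ∀ i, MemLp (ξ i) 2 μ) (h0 : ∀ i, ∫ x, ξ i x ∂μ = 0)
    {ev : Fin N → ℝ} (hev : ∀ i, 0 ≤ ev i)
    (hcov : ∀ i j, ∫ x, ξ i x * ξ j x ∂μ = if i = j then ev i else 0)
    {χ : Fin N → Ω' → ℝ} (hχ : ∀ j, HasLaw (χ j) chiSquareOne P') (hχindep : iIndepFun χ P') :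
    TendstoInDistribution (fun n ω => ∑ i, normSum X n (ξ i) ω ^ 2) atTop
      (fun ω => ∑ i, ev i * χ i ω) (fun _ => P) P' := by
  have := h.isProbabilityMeasure
  let ρ : Measure (Fin N → ℝ) := Measure.pi fun i => gaussianReal 0 (ev i).toNNReal
  let V : ℕ → Ω → EuclideanSpace ℝ (Fin N) := fun n ω => WithLp.toLp 2 fun i => normSum X n (ξ i) ω
  have hVm : ∀ n, Measurable (V n) := fun n =>
    (PiLp.continuous_toLp 2 _).measurable.comp
      (measurable_pi_lambda _ fun i => h.measurable_normSum (hm i) n)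
  have hYm : Measurable (WithLp.toLp 2 : (Fin N → ℝ) → EuclideanSpace ℝ (Fin N)) :=
    (PiLp.continuous_toLp 2 _).measurable
  have hV : TendstoInDistribution V atTop (WithLp.toLp 2 : (Fin N → ℝ) → EuclideanSpace ℝ (Fin N))
      (fun _ => P) ρ := by
    refine ⟨fun n => (hVm n).aemeasurable, hYm.aemeasurable,
      ProbabilityMeasure.tendsto_iff_tendsto_charFun.2 fun t => ?_⟩
    simp only [ProbabilityMeasure.coe_mk]
    -- Cramér–Wold: at `t`, the characteristic function of the vector is that of the normalized sum
    -- of `∑ i, t i * ξ i` at `1`. Uncorrelatedness makes its limit variance `∑ i, t i ^ 2 * ev i`,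
    -- which is also what the product of normal laws gives.
    have h1 : charFun (ρ.map (WithLp.toLp 2)) t =
        Complex.exp (-(((∫ x, (∑ i, t i * ξ i x) ^ 2 ∂μ) * 1 ^ 2 / 2 : ℝ) : ℂ)) := by
      rw [charFun_pi, integral_sum_mul_sq fun i _ => hL i]
      simp only [charFun_gaussianReal, hcov, ← Complex.exp_sum]
      congr 1
      simp only [mul_ite, mul_zero, Finset.sum_ite_eq, Finset.mem_univ, if_true]
      push_cast
      rw [Finset.sum_mul, Finset.sum_div, ← Finset.sum_neg_distrib]
      refine Finset.sum_congr rfl fun i _ => ?_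
      simp [Real.coe_toNNReal _ (hev i)]
      ring
    rw [h1]
    refine (h.tendsto_charFun_normSum (g := fun x => ∑ i, t i * ξ i x)
      (Finset.measurable_sum _ fun i _ => (hm i).const_mul _)
      (memLp_finsetSum _ fun i _ => (hL i).const_mul _) ?_ 1).congr fun n => ?_
    · rw [integral_finsetSum _ fun i _ => ((hL i).const_mul _).integrable (by norm_num)]
      simp [integral_const_mul, h0]
    · rw [charFun_apply, charFun_apply, integral_map (hVm n).aemeasurable (by fun_prop),
        integral_map (h.measurable_normSum (Finset.measurable_sum _ fun i _ => (hm i).const_mul _)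
          n).aemeasurable (by fun_prop)]
      congr 1
      ext ω
      rw [normSum_sum]
      simp [V, PiLp.inner_apply]
  have hsq := hV.continuous_comp (g := fun x : EuclideanSpace ℝ (Fin N) => ∑ i, x i ^ 2)
    (by fun_prop)
  have hχm : ∀ i, AEMeasurable (χ i) P' := fun i => (hχ i).aemeasurable
  refine ⟨fun n => hsq.forall_aemeasurable n, by fun_prop, ?_⟩
  have h2 := hsq.tendsto
  convert! h2 using 3
  exact congrArg 𝓝 (Subtype.ext (map_sum_sq_pi_gaussianReal hev hχ hχindep).symm)

end VectorCLT

end ExogeneityTest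
end

noncomputable section
namespace ExogeneityTest

/-! ### Square integrable functions -/

section LTwo

variable {S : Type*} [MeasurableSpace S] {μ : Measure S}

theorem inner_eq_integral_of_ae_eq {F G : Lp ℝ 2 μ} {f g : S → ℝ} (hF : F =ᵐ[μ] f)
    (hG : G =ᵐ[μ] g) : inner ℝ F G = ∫ x, f x * g x ∂μ := by
  rw [L2.inner_def]
  refine integral_congr_ae ?_
  filter_upwards [hF, hG] with x h1 h2
  simp [h1, h2, mul_comm]

theorem norm_sq_eq_integral_of_ae_eq {F : Lp ℝ 2 μ} {f : S → ℝ} (hF : F =ᵐ[μ] f) :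
    ‖F‖ ^ 2 = ∫ x, f x ^ 2 ∂μ := by
  rw [← real_inner_self_eq_norm_sq, inner_eq_integral_of_ae_eq hF hF]
  simp only [pow_two]

theorem inner_toLp {f g : S → ℝ} (hf : MemLp f 2 μ) (hg : MemLp g 2 μ) :
    inner ℝ (hf.toLp f) (hg.toLp g) = ∫ x, f x * g x ∂μ :=
  inner_eq_integral_of_ae_eq hf.coeFn_toLp hg.coeFn_toLp

theorem norm_toLp_sq {f : S → ℝ} (hf : MemLp f 2 μ) : ‖hf.toLp f‖ ^ 2 = ∫ x, f x ^ 2 ∂μ :=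
  norm_sq_eq_integral_of_ae_eq hf.coeFn_toLp

theorem integral_abs_mul_le {f g : S → ℝ} (hf : MemLp f 2 μ) (hg : MemLp g 2 μ) :
    ∫ x, |f x * g x| ∂μ ≤ √(∫ x, f x ^ 2 ∂μ) * √(∫ x, g x ^ 2 ∂μ) := by
  have h := integral_mul_norm_le_Lp_mul_Lq (f := f) (g := g) (p := 2) (q := 2) (μ := μ)
    Real.HolderConjugate.two_two (by simpa using hf) (by simpa using hg)
  simpa [Real.sqrt_eq_rpow, abs_mul] using h

theorem sq_integral_mul_le {f g : S → ℝ} (hf : MemLp f 2 μ) (hg : MemLp g 2 μ) :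
    (∫ x, f x * g x ∂μ) ^ 2 ≤ (∫ x, f x ^ 2 ∂μ) * ∫ x, g x ^ 2 ∂μ := by
  have h1 := (abs_integral_le_integral_abs (f := fun x => f x * g x) (μ := μ)).trans
    (integral_abs_mul_le hf hg)
  have h2 : 0 ≤ ∫ x, f x ^ 2 ∂μ := integral_nonneg fun _ => sq_nonneg _
  have h3 : 0 ≤ ∫ x, g x ^ 2 ∂μ := integral_nonneg fun _ => sq_nonneg _
  rw [← Real.sqrt_mul h2] at h1
  have h4 := pow_le_pow_left₀ (abs_nonneg _) h1 2
  rwa [sq_abs, Real.sq_sqrt (mul_nonneg h2 h3)] at h4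

theorem coeFn_sum_smul {ι : Type*} (s : Finset ι) (c : ι → ℝ) {F : ι → Lp ℝ 2 μ} {f : ι → S → ℝ}
    (hF : ∀ i ∈ s, F i =ᵐ[μ] f i) :
    (∑ i ∈ s, c i • F i : Lp ℝ 2 μ) =ᵐ[μ] fun x => ∑ i ∈ s, c i * f i x := by
  classical
  induction s using Finset.induction_on with
  | empty =>
    simp only [Finset.sum_empty]
    exact Lp.coeFn_zero _ _ _
  | insert a s ha ih =>
    simp only [Finset.sum_insert ha]
    filter_upwards [Lp.coeFn_add (c a • F a) (∑ i ∈ s, c i • F i), Lp.coeFn_smul (c a) (F a),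
      hF a (Finset.mem_insert_self a s), ih fun i hi => hF i (Finset.mem_insert_of_mem hi)]
      with x h1 h2 h3 h4
    rw [h1, Pi.add_apply, h2, Pi.smul_apply, h3, h4, smul_eq_mul]

/-- By Tonelli the sum of the norms has finite integral, hence is finite almost everywhere and
dominates the series. -/
theorem ae_summable_and_integrable_tsum {F : ℕ → S → ℝ} (hF : ∀ i, Integrable (F i) μ)
    (hs : Summable fun i => ∫ x, ‖F i x‖ ∂μ) :
    (∀ᵐ x ∂μ, Summable fun i => F i x) ∧ Integrable (fun x => ∑' i, F i x) μ := by
  have h1 : ∫⁻ x, ∑' i, ‖F i x‖ₑ ∂μ ≠ ⊤ := by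
    rw [lintegral_tsum fun i => (hF i).aestronglyMeasurable.enorm]
    have : ∀ i, ∫⁻ x, ‖F i x‖ₑ ∂μ = ENNReal.ofReal (∫ x, ‖F i x‖ ∂μ) := fun i =>
      (ofReal_integral_norm_eq_lintegral_enorm (hF i)).symm
    simp only [this]
    exact hs.tsum_ofReal_ne_top
  have h2 : ∀ᵐ x ∂μ, Summable fun i => F i x := by
    filter_upwards [ae_lt_top' (AEMeasurable.tsum fun i =>
      (hF i).aestronglyMeasurable.enorm) h1] with x hx
    refine Summable.of_norm ?_
    have := ENNReal.summable_toReal hx.ne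
    simpa using this
  refine ⟨h2, ?_, ?_⟩
  · refine (aemeasurable_of_tendsto_metrizable_ae atTop
      (f := fun n x => ∑ i ∈ Finset.range n, F i x)
      (fun n => Finset.aemeasurable_fun_sum _ fun i _ => (hF i).aemeasurable) ?_).aestronglyMeasurable
    filter_upwards [h2] with x hx
    exact hx.hasSum.tendsto_sum_nat
  · refine lt_of_le_of_lt (lintegral_mono_ae (g := fun x => ∑' i, ‖F i x‖ₑ) ?_) h1.lt_top
    filter_upwards [h2] with x hx
    exact enorm_tsum_le_tsum_enorm 

end LTwo

/-! ### Weighted sums of chi-square variables -/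

section ChiSquare

variable {Ω' : Type*} [MeasurableSpace Ω'] {P' : Measure Ω'} {χ : Ω' → ℝ}

theorem integrable_of_hasLaw_chiSquareOne (hχ : HasLaw χ chiSquareOne P') :
    Integrable χ P' ∧ ∫ ω, χ ω ∂P' = 1 ∧ ∀ᵐ ω ∂P', 0 ≤ χ ω := by
  have h1 : Integrable (fun x : ℝ => x ^ 2) (gaussianReal 0 1) :=
    (memLp_id_gaussianReal (μ := 0) (v := 1) 2).integrable_sq
  have h2 : Integrable (fun x : ℝ => x) chiSquareOne := by
    rw [chiSquareOne, integrable_map_measure (by fun_prop) (by fun_prop)]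
    exact h1
  have h3 : ∫ x, x ∂chiSquareOne = 1 := by
    rw [chiSquareOne, integral_map (by fun_prop) (by fun_prop)]
    have := variance_of_integral_eq_zero (X := fun x : ℝ => x) (μ := gaussianReal 0 1)
      (by fun_prop) integral_id_gaussianReal
    rw [← this]
    simp
  have h4 : ∀ᵐ x ∂chiSquareOne, 0 ≤ x := by
    rw [chiSquareOne, ae_map_iff (by fun_prop) measurableSet_Ici]
    exact .of_forall fun x => sq_nonneg x
  have hm := hχ.aemeasurable
  refine ⟨?_, ?_, ?_⟩
  · rw [← hχ.map_eq] at h2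
    exact (integrable_map_measure (by fun_prop) hm).1 h2
  · rw [← h3, ← hχ.map_eq, integral_map hm (by fun_prop)]
  · rw [← hχ.map_eq] at h4
    exact ae_of_ae_map hm h4

/-- The terms are nonnegative with means `ev j`, so summability of the weights suffices, without
independence, and the mean error of a truncation is exactly the tail of the weights. -/
theorem ae_summable_mul_chiSquare {χ : ℕ → Ω' → ℝ} (hχ : ∀ j, HasLaw (χ j) chiSquareOne P')
    {ev : ℕ → ℝ} (hev : ∀ i, 0 ≤ ev i) (hs : Summable ev) :
    (∀ᵐ ω ∂P', Summable fun j => ev j * χ j ω) ∧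
    Integrable (fun ω => ∑' j, ev j * χ j ω) P' ∧
    ∀ N, Integrable (fun ω => ∑' j, ev j * χ j ω - ∑ j : Fin N, ev j * χ j ω) P' ∧
      ∫ ω, |∑' j, ev j * χ j ω - ∑ j : Fin N, ev j * χ j ω| ∂P' = ∑' j, ev (j + N) := by
  have hi : ∀ j, Integrable (fun ω => ev j * χ j ω) P' := fun j =>
    (integrable_of_hasLaw_chiSquareOne (hχ j)).1.const_mul _
  have hnn : ∀ᵐ ω ∂P', ∀ j, 0 ≤ χ j ω := ae_all_iff.2 fun j =>
    (integrable_of_hasLaw_chiSquareOne (hχ j)).2.2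
  have hint : ∀ j, ∫ ω, ‖ev j * χ j ω‖ ∂P' = ev j := fun j => by
    rw [integral_congr_ae (g := fun ω => ev j * χ j ω), integral_const_mul,
      (integrable_of_hasLaw_chiSquareOne (hχ j)).2.1, mul_one]
    filter_upwards [hnn] with ω hω
    exact Real.norm_of_nonneg (mul_nonneg (hev j) (hω j))
  obtain ⟨h1, h2⟩ := ae_summable_and_integrable_tsum hi (by simpa only [hint] using hs)
  refine ⟨h1, h2, fun N => ⟨h2.sub (integrable_finsetSum _ fun j _ => hi j), ?_⟩⟩
  have hsN : Summable fun j => ev (j + N) := (summable_nat_add_iff N).2 hs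
  have h3 := integral_tsum_of_summable_integral_norm (fun j => hi (j + N))
    (by simpa only [hint] using hsN)
  have h4 : ∀ j, ∫ ω, ev j * χ j ω ∂P' = ev j := fun j => by
    rw [integral_const_mul, (integrable_of_hasLaw_chiSquareOne (hχ j)).2.1, mul_one]
  simp only [h4] at h3
  rw [h3]
  refine integral_congr_ae ?_
  filter_upwards [h1, hnn] with ω hω hω'
  rw [← hω.sum_add_tsum_nat_add N, Fin.sum_univ_eq_sum_range (fun j => ev j * χ j ω),
    add_sub_cancel_left, abs_of_nonneg]
  exact tsum_nonneg fun j => mul_nonneg (hev _) (hω' _)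

end ChiSquare

end ExogeneityTest
end

noncomputable section
namespace ExogeneityTest

/-! ### The limit of a sum of squared normalized sums -/

section Quadratic

variable {Ω Ω' S : Type*} [MeasurableSpace Ω] [MeasurableSpace Ω'] [MeasurableSpace S]
  {P : Measure Ω} {P' : Measure Ω'} [IsProbabilityMeasure P] [IsProbabilityMeasure P']
  {X : ℕ → Ω → S} {μ : Measure S}

/-- Bessel's inequality in `ℓ²` for the finitely supported vector with coordinates `x j`, `j < m`.
-/
theorem sum_sq_coeff_le {v : ℕ → EllTwo} (hv : Orthonormal ℝ v) (N m : ℕ) (x : ℕ → ℝ) :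
    ∑ i : Fin N, (∑ j ∈ Finset.range m, v i j * x j) ^ 2 ≤ ∑ j ∈ Finset.range m, x j ^ 2 := by
  let y : EllTwo := ∑ j ∈ Finset.range m, x j • lp.single 2 j (1 : ℝ)
  have h1 : ∀ u : EllTwo, inner ℝ u y = ∑ j ∈ Finset.range m, u j * x j := fun u => by
    simp only [y, inner_sum, inner_smul_right, lp.inner_single_right]
    refine Finset.sum_congr rfl fun j _ => ?_
    simp [mul_comm]
  have h2 : ‖y‖ ^ 2 = ∑ j ∈ Finset.range m, x j ^ 2 := by
    rw [← real_inner_self_eq_norm_sq, h1]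
    refine Finset.sum_congr rfl fun j hj => ?_
    have : y j = x j := by
      have h3 := h1 (lp.single 2 j (1 : ℝ))
      rw [lp.inner_single_left] at h3
      simpa [Pi.single_apply, Finset.mem_range.1 hj] using h3
    rw [this, pow_two]
  have h3 := hv.sum_inner_products_le (s := Finset.range N) (x := y)
  rw [h2] at h3
  rw [Fin.sum_univ_eq_sum_range (fun i => (∑ j ∈ Finset.range m, v i j * x j) ^ 2)]
  simpa [h1] using h3

/-- Factor `a² - b² = (a - b)(a + b)` and apply Cauchy–Schwarz. Both factors are centered normalized
sums, whose second moments do not depend on `n`; hence the bound is uniform in `n`. -/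
theorem IsIID.integral_abs_normSum_sq_sub_le (h : IsIID P X μ) {f g : S → ℝ} (hf : Measurable f)
    (hg : Measurable g) (hfL : MemLp f 2 μ) (hgL : MemLp g 2 μ) (hf0 : ∫ x, f x ∂μ = 0)
    (hg0 : ∫ x, g x ∂μ = 0) {n : ℕ} (hn : n ≠ 0) :
    ∫ ω, |normSum X n f ω ^ 2 - normSum X n g ω ^ 2| ∂P ≤
      √(∫ x, (f x - g x) ^ 2 ∂μ) * √(∫ x, (f x + g x) ^ 2 ∂μ) := by
  have := h.isProbabilityMeasure
  have h1 := integral_abs_mul_le ((h.memLp_normSum hfL n).sub (h.memLp_normSum hgL n))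
    ((h.memLp_normSum hfL n).add (h.memLp_normSum hgL n))
  have hfi := hfL.integrable (by norm_num : (1 : ENNReal) ≤ 2)
  have hgi := hgL.integrable (by norm_num : (1 : ENNReal) ≤ 2)
  have h2 := h.integral_normSum_sq_of_centered (hf.sub hg) (hfL.sub hgL)
    (by simp [integral_sub hfi hgi, hf0, hg0]) hn
  have h3 := h.integral_normSum_sq_of_centered (hf.add hg) (hfL.add hgL)
    (by simp [integral_add hfi hgi, hf0, hg0]) hn
  have h4 : ∀ ω, normSum X n (f - g) ω = normSum X n f ω - normSum X n g ω := fun ω =>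
    normSum_sub X n f g ω
  have h5 : ∀ ω, normSum X n (f + g) ω = normSum X n f ω + normSum X n g ω := fun ω => by
    simp [normSum, Finset.sum_add_distrib, mul_add]
  simp only [h4, h5, Pi.sub_apply, Pi.add_apply] at h1 h2 h3
  rw [h2, h3] at h1
  refine le_trans (le_of_eq ?_) h1
  congr 1
  ext ω
  congr 1
  ring

/-- The sum of the squares of the normalized sums of `g_0, …, g_{m_n - 1}` converges in distribution
to a weighted sum of independent chi-square variables, the weights being the eigenvalues of the
covariance matrix of all `g_j`. -/
theorem IsIID.tendstoInDistribution_sum_range_normSum_sq (h : IsIID P X μ) {g : ℕ → S → ℝ}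
    (hgm : ∀ j, Measurable (g j)) (hg : ∀ j, MemLp (g j) 2 μ) (h0 : ∀ j, ∫ x, g j x ∂μ = 0)
    (hsum : Summable fun j => ∫ x, g j x ^ 2 ∂μ) {ev : ℕ → ℝ}
    (hev : IsOrderedEigenvalues (fun j l => ∫ x, g j x * g l x ∂μ) ev)
    {m : ℕ → ℕ} (hm : Tendsto m atTop atTop) {χ : ℕ → Ω' → ℝ}
    (hχ : ∀ j, HasLaw (χ j) chiSquareOne P') (hχindep : iIndepFun χ P') :
    (∀ᵐ ω ∂P', Summable fun j => ev j * χ j ω) ∧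
    TendstoInDistribution (fun n ω => ∑ j ∈ Finset.range (m n), normSum X n (g j) ω ^ 2) atTop
      (fun ω => ∑' j, ev j * χ j ω) (fun _ => P) P' := by
  have := h.isProbabilityMeasure
  let a : ℕ → Lp ℝ 2 μ := fun j => (hg j).toLp (g j)
  have ha_sq : ∀ j, ‖a j‖ ^ 2 = ∫ x, g j x ^ 2 ∂μ := fun j => norm_toLp_sq (hg j)
  have ha : Summable fun j => ‖a j‖ ^ 2 := by simpa only [ha_sq] using hsum
  have hev0 := hev.2.1
  have hev' : IsOrderedEigenvalues (fun j l => inner ℝ (a j) (a l)) ev := by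
    simpa only [a, inner_toLp] using hev
  obtain ⟨v, hv, hAA, htr⟩ := hev'.exists_orthonormal ha
  let A := synthesis a ha
  obtain ⟨hχ1, hχ2, hχ3⟩ := ae_summable_mul_chiSquare hχ hev0 htr.summable
  refine ⟨hχ1, tendstoInDistribution_of_approx (fun n => (Finset.measurable_sum _ fun j _ =>
    (h.measurable_normSum (hgm j) n).pow_const 2).aemeasurable) hχ2.aemeasurable fun ε hε => ?_⟩
  -- the limiting variables
  let ξ : ℕ → S → ℝ := fun i => A (v i)
  have hξm : ∀ i, Measurable (ξ i) := fun i => (Lp.stronglyMeasurable _).measurable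
  have hξL : ∀ i, MemLp (ξ i) 2 μ := fun i => Lp.memLp _
  have hξ0 : ∀ i, ∫ x, ξ i x ∂μ = 0 := by
    intro i
    have h1 := hasSum_inner_synthesis a ha (v i) ((memLp_const (1 : ℝ)).toLp _)
    have h2 : ∀ j, inner ℝ ((memLp_const (1 : ℝ)).toLp fun _ : S => (1 : ℝ)) (a j) = 0 := fun j => by
      rw [inner_toLp]; simp [h0]
    simp only [h2, zero_mul] at h1
    have h3 := h1.unique hasSum_zero
    rw [inner_eq_integral_of_ae_eq (memLp_const (1 : ℝ)).coeFn_toLp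
      (ae_eq_refl (A (v i)))] at h3
    simpa using h3
  have hξcov : ∀ i k, ∫ x, ξ i x * ξ k x ∂μ = if i = k then ev i else 0 := fun i k => by
    rw [← hAA i k, inner_eq_integral_of_ae_eq (ae_eq_refl _) (ae_eq_refl _)]
  -- their finite dimensional approximations
  let ζ : ℕ → ℕ → S → ℝ := fun r i x => ∑ j ∈ Finset.range r, v i j * g j x
  let b : ℕ → ℕ → Lp ℝ 2 μ := fun r i => ∑ j ∈ Finset.range r, v i j • a j
  have hζm : ∀ r i, Measurable (ζ r i) := fun r i =>
    Finset.measurable_sum _ fun j _ => (hgm j).const_mul _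
  have hζL : ∀ r i, MemLp (ζ r i) 2 μ := fun r i => memLp_finsetSum _ fun j _ => (hg j).const_mul _
  have hζ0 : ∀ r i, ∫ x, ζ r i x ∂μ = 0 := fun r i => by
    rw [integral_finsetSum _ fun j _ => ((hg j).const_mul _).integrable (by norm_num)]
    simp [integral_const_mul, h0]
  have hbζ : ∀ r i, b r i =ᵐ[μ] ζ r i := fun r i =>
    coeFn_sum_smul _ _ fun j _ => (hg j).coeFn_toLp
  have hblim : ∀ i, Tendsto (fun r => b r i) atTop (𝓝 (A (v i))) := fun i =>
    (hasSum_synthesis a ha (v i)).tendsto_sum_nat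
  have hAn : ∀ i, ‖A (v i)‖ ^ 2 = ev i := fun i => by
    rw [← real_inner_self_eq_norm_sq]; simpa using hAA i i
  -- the truncation level
  have htail := (tendsto_sum_nat_add ev).eventually (gt_mem_nhds (half_pos hε))
  obtain ⟨N, hN⟩ := htail.exists
  refine ⟨fun n ω => ∑ i : Fin N, normSum X n (ξ i) ω ^ 2, fun ω => ∑ i : Fin N, ev i * χ i ω,
    h.tendstoInDistribution_sum_normSum_sq (fun i => hξm i) (fun i => hξL i) (fun i => hξ0 i)
      (fun i => hev0 i) (fun i k => by simpa [Fin.ext_iff] using hξcov i k) (fun i => hχ i)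
      (hχindep.precomp Fin.val_injective), ?_, (hχ3 N).1, (hχ3 N).2.le.trans (by linarith)⟩
  -- At `r = m n` this bounds the mean distance to the `N`-term approximation: the defect in
  -- Bessel's inequality, plus the cost of replacing `b r i` by its limit `A (v i)`. The defect
  -- tends to the trace minus the first `N` eigenvalues, that is, to the tail.
  let D : ℕ → ℝ := fun r => ∑ j ∈ Finset.range r, ‖a j‖ ^ 2 - ∑ i : Fin N, ‖b r i‖ ^ 2 +
    ∑ i : Fin N, ‖b r i - A (v i)‖ * ‖b r i + A (v i)‖
  have hD : Tendsto D atTop (𝓝 (∑' j, ev (j + N))) := by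
    have h1 : Tendsto (fun r => ∑ j ∈ Finset.range r, ‖a j‖ ^ 2) atTop (𝓝 (∑' j, ‖a j‖ ^ 2)) :=
      ha.hasSum.tendsto_sum_nat
    have h2 : Tendsto (fun r => ∑ i : Fin N, ‖b r i‖ ^ 2) atTop (𝓝 (∑ i : Fin N, ev i)) := by
      refine tendsto_finsetSum _ fun i _ => ?_
      rw [← hAn]
      exact ((hblim i).norm).pow 2
    have h3 : Tendsto (fun r => ∑ i : Fin N, ‖b r i - A (v i)‖ * ‖b r i + A (v i)‖) atTop
        (𝓝 (∑ i : Fin N, ‖A (v i) - A (v i)‖ * ‖A (v i) + A (v i)‖)) :=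
      tendsto_finsetSum _ fun i _ =>
        ((hblim i).sub_const _).norm.mul ((hblim i).add_const _).norm
    have h4 := (h1.sub h2).add h3
    rw [← htr.tsum_eq, ← htr.summable.sum_add_tsum_nat_add N,
      Fin.sum_univ_eq_sum_range (fun i => ev i)] at h4
    simpa using h4
  have hDm := (hD.comp hm).eventually (gt_mem_nhds (hN.trans (half_lt_self hε)))
  filter_upwards [hDm, eventually_ne_atTop 0] with n hn hn0
  have hiQ : Integrable (fun ω => ∑ j ∈ Finset.range (m n), normSum X n (g j) ω ^ 2) P :=
    integrable_finsetSum _ fun j _ => h.integrable_normSum_sq (hg j) n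
  have hiξ : ∀ i, Integrable (fun ω => normSum X n (ξ i) ω ^ 2) P := fun i =>
    h.integrable_normSum_sq (hξL i) n
  have hiζ : ∀ i, Integrable (fun ω => normSum X n (ζ (m n) i) ω ^ 2) P := fun i =>
    h.integrable_normSum_sq (hζL _ i) n
  have hiξs : Integrable (fun ω => ∑ i : Fin N, normSum X n (ξ i) ω ^ 2) P :=
    integrable_finsetSum _ fun i _ => hiξ i
  have hiζs : Integrable (fun ω => ∑ i : Fin N, normSum X n (ζ (m n) i) ω ^ 2) P :=
    integrable_finsetSum _ fun i _ => hiζ i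
  refine ⟨hiQ.sub hiξs, le_trans ?_ hn.le⟩
  -- This gives the difference a sign, so its `L¹` norm is a difference of second moments that are
  -- known exactly.
  have hbessel : ∀ ω, ∑ i : Fin N, normSum X n (ζ (m n) i) ω ^ 2 ≤
      ∑ j ∈ Finset.range (m n), normSum X n (g j) ω ^ 2 := fun ω => by
    simp only [ζ, normSum_sum]
    exact sum_sq_coeff_le hv N (m n) fun j => normSum X n (g j) ω
  have hpt : ∀ ω, |∑ j ∈ Finset.range (m n), normSum X n (g j) ω ^ 2 -
      ∑ i : Fin N, normSum X n (ξ i) ω ^ 2| ≤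
      (∑ j ∈ Finset.range (m n), normSum X n (g j) ω ^ 2 -
        ∑ i : Fin N, normSum X n (ζ (m n) i) ω ^ 2) +
      ∑ i : Fin N, |normSum X n (ζ (m n) i) ω ^ 2 - normSum X n (ξ i) ω ^ 2| := fun ω => by
    have h1 := Finset.abs_sum_le_sum_abs
      (fun i : Fin N => normSum X n (ζ (m n) i) ω ^ 2 - normSum X n (ξ i) ω ^ 2) Finset.univ
    rw [Finset.sum_sub_distrib] at h1
    have h2 := hbessel ω
    rw [abs_le] at h1 ⊢
    constructor <;> linarith [h1.1, h1.2]
  have hiabs : ∀ i, Integrable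
      (fun ω => |normSum X n (ζ (m n) i) ω ^ 2 - normSum X n (ξ i) ω ^ 2|) P := fun i =>
    ((hiζ i).sub (hiξ i)).abs
  have hiabss : Integrable (fun ω => ∑ i : Fin N,
      |normSum X n (ζ (m n) i) ω ^ 2 - normSum X n (ξ i) ω ^ 2|) P :=
    integrable_finsetSum _ fun i _ => hiabs i
  refine (integral_mono (hiQ.sub hiξs).abs ((hiQ.sub hiζs).add hiabss) hpt).trans ?_
  simp only [Pi.add_apply, Pi.sub_apply, Function.comp_apply, D]
  rw [integral_add (by exact hiQ.sub hiζs) hiabss,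
    integral_sub hiQ hiζs, integral_finsetSum _ fun (i : Fin N) _ => hiabs i,
    integral_finsetSum _ fun (i : Fin N) _ => hiζ i,
    integral_finsetSum _ fun j _ => h.integrable_normSum_sq (hg j) n]
  refine add_le_add (sub_le_sub (Finset.sum_le_sum fun j _ => ?_) (Finset.sum_le_sum fun i _ => ?_))
    (Finset.sum_le_sum fun i _ => ?_)
  · rw [h.integral_normSum_sq_of_centered (hgm j) (hg j) (h0 j) hn0, ha_sq]
  · rw [h.integral_normSum_sq_of_centered (hζm _ i) (hζL _ i) (hζ0 _ i) hn0,
      norm_sq_eq_integral_of_ae_eq (hbζ _ i)]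
  · refine (h.integral_abs_normSum_sq_sub_le (hζm _ i) (hξm i) (hζL _ i) (hξL i) (hζ0 _ i) (hξ0 i)
      hn0).trans (le_of_eq ?_)
    have h1 : (b (m n) i - A (v i) : Lp ℝ 2 μ) =ᵐ[μ] fun x => ζ (m n) i x - ξ i x := by
      filter_upwards [Lp.coeFn_sub (b (m n) i) (A (v i)), hbζ (m n) i] with x h1 h2
      rw [h1, Pi.sub_apply, h2]
    have h2 : (b (m n) i + A (v i) : Lp ℝ 2 μ) =ᵐ[μ] fun x => ζ (m n) i x + ξ i x := by
      filter_upwards [Lp.coeFn_add (b (m n) i) (A (v i)), hbζ (m n) i] with x h1 h2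
      rw [h1, Pi.add_apply, h2]
    rw [← norm_sq_eq_integral_of_ae_eq h1, ← norm_sq_eq_integral_of_ae_eq h2,
      Real.sqrt_sq (norm_nonneg _), Real.sqrt_sq (norm_nonneg _)]

end Quadratic

end ExogeneityTest
end

noncomputable section
namespace ExogeneityTest

/-! ### Algebra of least squares residuals -/

section Algebra

/-- If `t = s - E t` and the Frobenius norm of `E` is at most `1 / 2`, then `‖t‖² ≤ 2 ‖s‖² + ‖t‖² /
2`. The bound is obtained without inverting `1 + E`. -/
theorem sum_sq_le_four_mul_of_perturbation {κ : ℕ} {t s : ℕ → ℝ} {E : ℕ → ℕ → ℝ}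
    (ht : ∀ l ∈ Finset.range κ, t l = s l - ∑ l' ∈ Finset.range κ, E l l' * t l')
    (hE : ∑ l ∈ Finset.range κ, ∑ l' ∈ Finset.range κ, E l l' ^ 2 ≤ 1 / 4) :
    ∑ l ∈ Finset.range κ, t l ^ 2 ≤ 4 * ∑ l ∈ Finset.range κ, s l ^ 2 := by
  set T := ∑ l ∈ Finset.range κ, t l ^ 2 with hT
  have hT0 : 0 ≤ T := Finset.sum_nonneg fun _ _ => sq_nonneg _
  have h1 : ∀ l ∈ Finset.range κ, t l ^ 2 ≤
      2 * s l ^ 2 + 2 * ((∑ l' ∈ Finset.range κ, E l l' ^ 2) * T) := fun l hl => by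
    have h2 := Finset.sum_mul_sq_le_sq_mul_sq (Finset.range κ) (E l) t
    have h3 : t l ^ 2 ≤ 2 * s l ^ 2 + 2 * (∑ l' ∈ Finset.range κ, E l l' * t l') ^ 2 := by
      rw [ht l hl]
      nlinarith [sq_nonneg (s l + ∑ l' ∈ Finset.range κ, E l l' * t l')]
    rw [← hT] at h2
    linarith
  have h2 := Finset.sum_le_sum h1
  rw [Finset.sum_add_distrib, ← Finset.mul_sum, ← Finset.mul_sum, ← Finset.sum_mul] at h2
  nlinarith [mul_le_mul_of_nonneg_right hE hT0]

theorem abs_sum_sq_sub_sum_sq_le (m : ℕ) (x y : ℕ → ℝ) {d : ℝ}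
    (hd : ∑ j ∈ Finset.range m, (x j - y j) ^ 2 ≤ d) :
    |∑ j ∈ Finset.range m, x j ^ 2 - ∑ j ∈ Finset.range m, y j ^ 2| ≤
      d + 2 * √(d * ∑ j ∈ Finset.range m, y j ^ 2) := by
  have h1 : ∑ j ∈ Finset.range m, x j ^ 2 - ∑ j ∈ Finset.range m, y j ^ 2 =
      ∑ j ∈ Finset.range m, (x j - y j) ^ 2 + 2 * ∑ j ∈ Finset.range m, (x j - y j) * y j := by
    rw [Finset.mul_sum, ← Finset.sum_add_distrib, ← Finset.sum_sub_distrib]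
    exact Finset.sum_congr rfl fun j _ => by ring
  have h2 : |∑ j ∈ Finset.range m, (x j - y j) * y j| ≤ √(d * ∑ j ∈ Finset.range m, y j ^ 2) := by
    refine Real.abs_le_sqrt ((Finset.sum_mul_sq_le_sq_mul_sq _ _ _).trans ?_)
    exact mul_le_mul_of_nonneg_right hd (Finset.sum_nonneg fun _ _ => sq_nonneg _)
  have h3 : 0 ≤ ∑ j ∈ Finset.range m, (x j - y j) ^ 2 := Finset.sum_nonneg fun _ _ => sq_nonneg _
  rw [h1]
  refine (abs_add_le _ _).trans ?_
  rw [abs_of_nonneg h3, abs_mul, abs_two]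
  linarith

variable {Ω S : Type*} {X : ℕ → Ω → S} {n κ : ℕ} {ω : Ω} {r θ : ℕ → ℝ} {u ρ : S → ℝ} {q : ℕ → S → ℝ}

/-- The residuals annihilate every `q l` on the sample, so `F` may be replaced by `F - ∑ γ l * q l`
for arbitrary `γ`. Inserting the form of the residual leaves three terms; later `γ` consists of the
Fourier coefficients of `F`, which centers the summands of the third one. -/
theorem normSum_residual_sub (γ : ℕ → ℝ) (F h : S → ℝ)
    (hr : ∀ i ∈ Finset.range n,
      r i = u (X i ω) + ρ (X i ω) - ∑ l ∈ Finset.range κ, θ l * q l (X i ω))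
    (hN : ∀ l ∈ Finset.range κ, ∑ i ∈ Finset.range n, r i * q l (X i ω) = 0) :
    (√(n : ℝ))⁻¹ * (∑ i ∈ Finset.range n, r i * F (X i ω)) -
        normSum X n (fun x => u x * (F x - h x)) ω =
      normSum X n (fun x => (F x - ∑ l ∈ Finset.range κ, γ l * q l x) * ρ x) ω +
      normSum X n (fun x => (h x - ∑ l ∈ Finset.range κ, γ l * q l x) * u x) ω -
      ∑ l ∈ Finset.range κ, θ l *
        normSum X n (fun x => (F x - ∑ l ∈ Finset.range κ, γ l * q l x) * q l x) ω := by
  rw [← normSum_sum]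
  simp only [normSum, ← mul_sub, ← mul_add]
  congr 1
  have h1 : ∑ i ∈ Finset.range n, r i * ∑ l ∈ Finset.range κ, γ l * q l (X i ω) = 0 := by
    simp only [Finset.mul_sum]
    rw [Finset.sum_comm]
    refine Finset.sum_eq_zero fun l hl => ?_
    rw [← mul_zero (γ l), ← hN l hl, Finset.mul_sum]
    exact Finset.sum_congr rfl fun i _ => by ring
  rw [← sub_zero (∑ i ∈ Finset.range n, r i * F (X i ω)), ← h1, ← Finset.sum_sub_distrib,
    ← Finset.sum_sub_distrib, ← Finset.sum_add_distrib, ← Finset.sum_sub_distrib]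
  refine Finset.sum_congr rfl fun i hi => ?_
  have h2 : ∑ l ∈ Finset.range κ,
      θ l * ((F (X i ω) - ∑ l ∈ Finset.range κ, γ l * q l (X i ω)) * q l (X i ω)) =
      (F (X i ω) - ∑ l ∈ Finset.range κ, γ l * q l (X i ω)) *
        ∑ l ∈ Finset.range κ, θ l * q l (X i ω) := by
    rw [Finset.mul_sum]
    exact Finset.sum_congr rfl fun l _ => by ring
  rw [h2, hr i hi]
  ring

/-- The normal equations say that the sample Gram matrix sends `√n θ` to the vector of normalized
sums of `q l * (u + ρ)`. That matrix is the identity plus `n^{-1/2}` times normalized sums, and the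
perturbation bound applies once this error is small. -/
theorem sum_sq_coef_le (hn : n ≠ 0)
    (hr : ∀ i ∈ Finset.range n,
      r i = u (X i ω) + ρ (X i ω) - ∑ l ∈ Finset.range κ, θ l * q l (X i ω))
    (hN : ∀ l ∈ Finset.range κ, ∑ i ∈ Finset.range n, r i * q l (X i ω) = 0)
    (hE : (n : ℝ)⁻¹ * ∑ l ∈ Finset.range κ, ∑ l' ∈ Finset.range κ,
      normSum X n (fun x => q l x * q l' x - if l = l' then 1 else 0) ω ^ 2 ≤ 1 / 4) :
    n * ∑ l ∈ Finset.range κ, θ l ^ 2 ≤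
      4 * ∑ l ∈ Finset.range κ, normSum X n (fun x => q l x * (u x + ρ x)) ω ^ 2 := by
  have hn0 : (0 : ℝ) < n := by exact_mod_cast Nat.pos_of_ne_zero hn
  have hs0 : √(n : ℝ) ≠ 0 := (Real.sqrt_pos.2 hn0).ne'
  have hss : √(n : ℝ) * √(n : ℝ) = n := Real.mul_self_sqrt hn0.le
  have h1 := sum_sq_le_four_mul_of_perturbation (κ := κ) (t := fun l => √(n : ℝ) * θ l)
    (s := fun l => normSum X n (fun x => q l x * (u x + ρ x)) ω)
    (E := fun l l' => (√(n : ℝ))⁻¹ *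
      normSum X n (fun x => q l x * q l' x - if l = l' then 1 else 0) ω) ?_ ?_
  · simpa only [mul_pow, Real.sq_sqrt hn0.le, ← Finset.mul_sum] using h1
  · intro l hl
    have h2 := hN l hl
    rw [Finset.sum_congr rfl fun i hi => by rw [hr i hi]] at h2
    have h3 : ∑ i ∈ Finset.range n, q l (X i ω) * (u (X i ω) + ρ (X i ω)) =
        ∑ l' ∈ Finset.range κ, θ l' * ∑ i ∈ Finset.range n, q l (X i ω) * q l' (X i ω) := by
      rw [← sub_eq_zero, ← h2]
      simp only [Finset.mul_sum]
      rw [Finset.sum_comm, ← Finset.sum_sub_distrib]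
      refine Finset.sum_congr rfl fun i _ => ?_
      rw [sub_mul, Finset.sum_mul]
      congr 1
      · ring
      · exact Finset.sum_congr rfl fun l' _ => by ring
    have h4 : ∀ l' ∈ Finset.range κ, (√(n : ℝ))⁻¹ *
        normSum X n (fun x => q l x * q l' x - if l = l' then 1 else 0) ω * (√(n : ℝ) * θ l') =
        (√(n : ℝ))⁻¹ * (θ l' * ∑ i ∈ Finset.range n, q l (X i ω) * q l' (X i ω)) -
          if l = l' then √(n : ℝ) * θ l' else 0 := fun l' _ => by
      simp only [normSum, Finset.sum_sub_distrib, Finset.sum_const, Finset.card_range, nsmul_eq_mul]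
      split_ifs with hll
      · generalize √(n : ℝ) = s at hs0 hss
        rw [← hss]
        field_simp
      · field_simp
        ring
    rw [Finset.sum_congr rfl h4, Finset.sum_sub_distrib, ← Finset.mul_sum, ← h3,
      Finset.sum_ite_eq, if_pos hl]
    simp only [normSum]
    ring
  · simpa only [mul_pow, inv_pow, Real.sq_sqrt hn0.le, ← Finset.mul_sum] using hE

/-- Cauchy–Schwarz over `l` separates the coefficients `θ` from the sums they multiply. The constant
is `12 = 3 * 4`: the square of three terms, times the bound on the coefficients. -/
theorem sum_sq_residual_sub_le (m : ℕ) (hn : n ≠ 0) (γ : ℕ → ℕ → ℝ) (F h : ℕ → S → ℝ)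
    (hr : ∀ i ∈ Finset.range n,
      r i = u (X i ω) + ρ (X i ω) - ∑ l ∈ Finset.range κ, θ l * q l (X i ω))
    (hN : ∀ l ∈ Finset.range κ, ∑ i ∈ Finset.range n, r i * q l (X i ω) = 0)
    (hE : (n : ℝ)⁻¹ * ∑ l ∈ Finset.range κ, ∑ l' ∈ Finset.range κ,
      normSum X n (fun x => q l x * q l' x - if l = l' then 1 else 0) ω ^ 2 ≤ 1 / 4) :
    ∑ j ∈ Finset.range m, ((√(n : ℝ))⁻¹ * (∑ i ∈ Finset.range n, r i * F j (X i ω)) -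
        normSum X n (fun x => u x * (F j x - h j x)) ω) ^ 2 ≤
      3 * ∑ j ∈ Finset.range m,
        (normSum X n (fun x => (F j x - ∑ l ∈ Finset.range κ, γ j l * q l x) * ρ x) ω ^ 2 +
         normSum X n (fun x => (h j x - ∑ l ∈ Finset.range κ, γ j l * q l x) * u x) ω ^ 2) +
      (12 * ((n : ℝ)⁻¹ * ∑ j ∈ Finset.range m, ∑ l ∈ Finset.range κ,
        normSum X n (fun x => (F j x - ∑ l ∈ Finset.range κ, γ j l * q l x) * q l x) ω ^ 2)) *
      ∑ l ∈ Finset.range κ, normSum X n (fun x => q l x * (u x + ρ x)) ω ^ 2 := by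
  have hn0 : (0 : ℝ) < n := by exact_mod_cast Nat.pos_of_ne_zero hn
  have hθ := sum_sq_coef_le hn hr hN hE
  set σ := ∑ l ∈ Finset.range κ, normSum X n (fun x => q l x * (u x + ρ x)) ω ^ 2
  have hθ' : ∑ l ∈ Finset.range κ, θ l ^ 2 ≤ (n : ℝ)⁻¹ * (4 * σ) := by
    rw [← div_eq_inv_mul, le_div_iff₀' hn0]; exact hθ
  refine le_trans (b := ∑ j ∈ Finset.range m, (3 *
        (normSum X n (fun x => (F j x - ∑ l ∈ Finset.range κ, γ j l * q l x) * ρ x) ω ^ 2 +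
         normSum X n (fun x => (h j x - ∑ l ∈ Finset.range κ, γ j l * q l x) * u x) ω ^ 2) +
      (12 * ((n : ℝ)⁻¹ * ∑ l ∈ Finset.range κ,
        normSum X n (fun x => (F j x - ∑ l ∈ Finset.range κ, γ j l * q l x) * q l x) ω ^ 2)) * σ))
    (Finset.sum_le_sum fun j _ => ?_) (le_of_eq ?_)
  swap
  · rw [Finset.sum_add_distrib, ← Finset.mul_sum, ← Finset.sum_mul, ← Finset.mul_sum,
      ← Finset.mul_sum]
  rw [normSum_residual_sub (γ j) (F j) (h j) hr hN]
  set a := normSum X n (fun x => (F j x - ∑ l ∈ Finset.range κ, γ j l * q l x) * ρ x) ω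
  set b := normSum X n (fun x => (h j x - ∑ l ∈ Finset.range κ, γ j l * q l x) * u x) ω
  have hc := Finset.sum_mul_sq_le_sq_mul_sq (Finset.range κ) θ fun l =>
    normSum X n (fun x => (F j x - ∑ l ∈ Finset.range κ, γ j l * q l x) * q l x) ω
  set c := ∑ l ∈ Finset.range κ, θ l *
    normSum X n (fun x => (F j x - ∑ l ∈ Finset.range κ, γ j l * q l x) * q l x) ω
  set δ := ∑ l ∈ Finset.range κ,
    normSum X n (fun x => (F j x - ∑ l ∈ Finset.range κ, γ j l * q l x) * q l x) ω ^ 2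
  have hδ : 0 ≤ δ := Finset.sum_nonneg fun _ _ => sq_nonneg _
  have h1 := mul_le_mul_of_nonneg_right hθ' hδ
  have h2 : c ^ 2 ≤ (n : ℝ)⁻¹ * (4 * σ) * δ := hc.trans h1
  have h3 : (a + b - c) ^ 2 ≤ 3 * (a ^ 2 + b ^ 2) + 3 * c ^ 2 := by
    nlinarith [sq_nonneg (a - b), sq_nonneg (a + c), sq_nonneg (b + c)]
  linarith

end Algebra

/-! ### Convergence in probability -/

section InMeasure

variable {Ω : Type*} [MeasurableSpace Ω] {P : Measure Ω}

theorem measureReal_ge_le_integral_div {f : Ω → ℝ} (hf0 : ∀ ω, 0 ≤ f ω) (hf : Integrable f P)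
    {c : ℝ} (hc : 0 < c) : P.real {ω | c ≤ f ω} ≤ (∫ ω, f ω ∂P) / c := by
  rw [le_div_iff₀' hc]
  exact mul_meas_ge_le_integral_of_nonneg (.of_forall hf0) hf c

/-- Only first moments of the factors are at hand, so the product need not be integrable. Markov's
inequality is applied to its square root, whose mean is controlled by Cauchy–Schwarz. -/
theorem measureReal_mul_ge_le [IsFiniteMeasure P] {f g : Ω → ℝ} (hf0 : ∀ ω, 0 ≤ f ω) (hf : Integrable f P)
    (hg0 : ∀ ω, 0 ≤ g ω) (hg : Integrable g P) {c : ℝ} (hc : 0 < c) :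
    P.real {ω | c ≤ f ω * g ω} ≤ √((∫ ω, f ω ∂P) * ∫ ω, g ω ∂P) / √c := by
  have hsq : ∀ {k : Ω → ℝ}, (∀ ω, 0 ≤ k ω) → Integrable k P → MemLp (fun ω => √(k ω)) 2 P :=
    fun {k} h0 hk => (memLp_two_iff_integrable_sq
      (Real.continuous_sqrt.comp_aestronglyMeasurable hk.aestronglyMeasurable)).2 (by
        simpa only [Real.sq_sqrt (h0 _)] using hk)
  have h1 := integral_abs_mul_le (hsq hf0 hf) (hsq hg0 hg)
  have h2 : ∀ ω, |√(f ω) * √(g ω)| = √(f ω * g ω) := fun ω => by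
    rw [Real.sqrt_mul (hf0 ω), abs_of_nonneg (by positivity)]
  simp only [Real.sq_sqrt (hf0 _), Real.sq_sqrt (hg0 _), h2] at h1
  rw [← Real.sqrt_mul (integral_nonneg hf0)] at h1
  have h3 : Integrable (fun ω => √(f ω * g ω)) P := by
    simpa only [h2, Pi.mul_apply] using ((hsq hf0 hf).integrable_mul (hsq hg0 hg)).abs
  have h4 := measureReal_ge_le_integral_div (fun ω => Real.sqrt_nonneg (f ω * g ω)) h3
    (Real.sqrt_pos.2 hc)
  refine le_trans (measureReal_mono fun ω hω => ?_) (h4.trans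
    (div_le_div_of_nonneg_right h1 (Real.sqrt_nonneg c)))
  exact Real.sqrt_le_sqrt hω

variable [IsProbabilityMeasure P]

/-- In the application `e` is the squared error of the Gram matrix, `α + δ * s` bounds the squared
distance of two vectors, and `b` is the squared length of the second one, merely bounded in mean.
The bound on `D` is needed only for `e ≤ 1 / 4`, an event of probability tending to one. -/
theorem tendstoInMeasure_zero_of_bound {D α δ s b e : ℕ → Ω → ℝ}
    (hα0 : ∀ n ω, 0 ≤ α n ω) (hδ0 : ∀ n ω, 0 ≤ δ n ω) (hs0 : ∀ n ω, 0 ≤ s n ω)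
    (hb0 : ∀ n ω, 0 ≤ b n ω) (he0 : ∀ n ω, 0 ≤ e n ω)
    (hint : ∀ᶠ n in atTop, Integrable (α n) P ∧ Integrable (δ n) P ∧ Integrable (s n) P ∧
      Integrable (b n) P ∧ Integrable (e n) P)
    (hα : Tendsto (fun n => ∫ ω, α n ω ∂P) atTop (𝓝 0))
    (hδs : Tendsto (fun n => (∫ ω, δ n ω ∂P) * ∫ ω, s n ω ∂P) atTop (𝓝 0))
    {C : ℝ} (hb : ∀ᶠ n in atTop, ∫ ω, b n ω ∂P ≤ C)
    (he : Tendsto (fun n => ∫ ω, e n ω ∂P) atTop (𝓝 0))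
    (hD : ∀ᶠ n in atTop, ∀ᵐ ω ∂P, e n ω ≤ 1 / 4 →
      |D n ω| ≤ (α n ω + δ n ω * s n ω) + 2 * √((α n ω + δ n ω * s n ω) * b n ω)) :
    TendstoInMeasure P D atTop 0 := by
  rw [tendstoInMeasure_iff_measureReal_norm]
  intro ε hε
  simp only [Pi.zero_apply, sub_zero, Real.norm_eq_abs]
  rw [Metric.tendsto_atTop']
  intro η hη
  -- `K` is a level that `b` reaches with probability below `η / 2`. The number `κ` chosen next is a
  -- squared distance that keeps `D` below `ε` while `b < K`; it is split evenly between `α` and `δ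
  -- * s`.
  obtain ⟨K, hK0, hK⟩ : ∃ K : ℝ, 0 < K ∧ C / K < η / 2 := by
    refine ⟨2 * (|C| + 1) / η * 2, by positivity, ?_⟩
    rw [div_lt_iff₀ (by positivity)]
    have : η / 2 * (2 * (|C| + 1) / η * 2) = 2 * (|C| + 1) := by field_simp
    rw [this]
    linarith [le_abs_self C, abs_nonneg C]
  obtain ⟨κ, hκ0, hκ⟩ : ∃ κ : ℝ, 0 < κ ∧ κ + 2 * √(κ * K) < ε := by
    have h1 : Tendsto (fun κ : ℝ => κ + 2 * √(κ * K)) (𝓝[>] 0) (𝓝 (0 + 2 * √(0 * K))) :=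
      Continuous.tendsto (by fun_prop) 0 |>.mono_left nhdsWithin_le_nhds
    have h2 := (h1.eventually (gt_mem_nhds (by simpa using hε))).and self_mem_nhdsWithin
    obtain ⟨κ, hκ1, hκ2⟩ := h2.exists
    exact ⟨κ, hκ2, hκ1⟩
  have hlim : Tendsto (fun n => (∫ ω, e n ω ∂P) / (1 / 4) + (∫ ω, α n ω ∂P) / (κ / 2) +
      √((∫ ω, δ n ω ∂P) * ∫ ω, s n ω ∂P) / √(κ / 2) + C / K) atTop (𝓝 (0 / (1 / 4) + 0 / (κ / 2) +
      √0 / √(κ / 2) + C / K)) :=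
    (((he.div_const _).add (hα.div_const _)).add (hδs.sqrt.div_const _)).add_const _
  have hev := hlim.eventually (gt_mem_nhds (by
    simp only [zero_div, Real.sqrt_zero, zero_add]
    exact hK.trans (half_lt_self hη)))
  obtain ⟨N, hN⟩ := eventually_atTop.1 (((hint.and hb).and hD).and hev)
  refine ⟨N, fun n hn => ?_⟩
  obtain ⟨⟨⟨⟨hα', hδ', hs', hb', he'⟩, hbC⟩, hD'⟩, hlt⟩ := hN n hn.le
  rw [Real.dist_eq, sub_zero, abs_of_nonneg measureReal_nonneg]
  refine lt_of_le_of_lt ?_ hlt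
  have hsub : P.real {ω | ε ≤ |D n ω|} ≤ P.real ((({ω | 1 / 4 ≤ e n ω} ∪ {ω | κ / 2 ≤ α n ω}) ∪
      {ω | κ / 2 ≤ δ n ω * s n ω}) ∪ {ω | K ≤ b n ω}) := by
    refine ENNReal.toReal_mono (measure_ne_top _ _) (measure_mono_ae ?_)
    filter_upwards [hD'] with ω hω (hωε : ε ≤ |D n ω|)
    by_contra hcon
    have hcon' : ¬ (((1 / 4 ≤ e n ω ∨ κ / 2 ≤ α n ω) ∨ κ / 2 ≤ δ n ω * s n ω) ∨ K ≤ b n ω) := hcon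
    push Not at hcon'
    obtain ⟨⟨⟨h1, h2⟩, h3⟩, h4⟩ := hcon'
    have h5 := hω h1.le
    have h6 : α n ω + δ n ω * s n ω ≤ κ := by linarith
    have h7 : √((α n ω + δ n ω * s n ω) * b n ω) ≤ √(κ * K) :=
      Real.sqrt_le_sqrt (mul_le_mul h6 h4.le (hb0 n ω) hκ0.le)
    linarith
  refine hsub.trans ?_
  refine (measureReal_union_le _ _).trans (add_le_add ?_
    ((measureReal_ge_le_integral_div (hb0 n) hb' hK0).trans
      (div_le_div_of_nonneg_right hbC hK0.le)))
  refine (measureReal_union_le _ _).trans (add_le_add ?_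
    (measureReal_mul_ge_le (hδ0 n) hδ' (hs0 n) hs' (half_pos hκ0)))
  exact (measureReal_union_le _ _).trans (add_le_add
    (measureReal_ge_le_integral_div (he0 n) he' (by norm_num))
    (measureReal_ge_le_integral_div (hα0 n) hα' (half_pos hκ0)))

end InMeasure

end ExogeneityTest
end

noncomputable section
namespace ExogeneityTest

/-! ### Moment bounds -/

section Moments

variable {S : Type*} [MeasurableSpace S] {μ : Measure S}

theorem memLp_mul_of_sq_le {f ρ : S → ℝ} (hf : MemLp f 2 μ) (hρ : AEStronglyMeasurable ρ μ) {c : ℝ}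
    (hc : ∀ᵐ x ∂μ, ρ x ^ 2 ≤ c) :
    MemLp (fun x => f x * ρ x) 2 μ ∧ ∫ x, (f x * ρ x) ^ 2 ∂μ ≤ c * ∫ x, f x ^ 2 ∂μ := by
  have h1 : MemLp (fun x => f x * ρ x) 2 μ := by
    refine hf.of_le_mul (c := √c) (hf.aestronglyMeasurable.mul hρ) ?_
    filter_upwards [hc] with x hx
    rw [norm_mul, mul_comm]
    exact mul_le_mul_of_nonneg_right (Real.abs_le_sqrt hx) (norm_nonneg _)
  refine ⟨h1, ?_⟩
  rw [← integral_const_mul]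
  refine integral_mono_ae h1.integrable_sq (hf.integrable_sq.const_mul _) ?_
  filter_upwards [hc] with x hx
  simp only [mul_pow]
  nlinarith [sq_nonneg (f x)]

/-- Bounding the sum over `l` pointwise, before integrating, costs one factor of the order of the
dimension and no moment of `f` beyond the second. -/
theorem sum_integral_mul_sq_le {f : S → ℝ} {q : ℕ → S → ℝ} {κ : ℕ} (hf : MemLp f 2 μ)
    (hq : ∀ l, AEStronglyMeasurable (q l) μ) {c : ℝ}
    (hc : ∀ᵐ x ∂μ, ∑ l ∈ Finset.range κ, q l x ^ 2 ≤ c) :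
    (∀ l ∈ Finset.range κ, MemLp (fun x => f x * q l x) 2 μ) ∧
      ∑ l ∈ Finset.range κ, ∫ x, (f x * q l x) ^ 2 ∂μ ≤ c * ∫ x, f x ^ 2 ∂μ := by
  have h1 : ∀ l ∈ Finset.range κ, MemLp (fun x => f x * q l x) 2 μ := fun l hl =>
    (memLp_mul_of_sq_le hf (hq l) (c := c) (by
      filter_upwards [hc] with x hx
      exact (Finset.single_le_sum (f := fun l => q l x ^ 2) (fun _ _ => sq_nonneg _) hl).trans hx)).1
  refine ⟨h1, ?_⟩
  rw [← integral_finsetSum _ fun l hl => (h1 l hl).integrable_sq, ← integral_const_mul]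
  refine integral_mono_ae (integrable_finsetSum _ fun l hl => (h1 l hl).integrable_sq)
    (hf.integrable_sq.const_mul _) ?_
  filter_upwards [hc] with x hx
  simp only [mul_pow, ← Finset.mul_sum]
  nlinarith [sq_nonneg (f x)]

/-- Centering only decreases second moments, so each row of the matrix costs at most `c`. With `c`
proportional to `κ`, the sample Gram matrix has mean squared Frobenius error of order `κ² / n`. -/
theorem sum_integral_gram_sub_sq_le [IsProbabilityMeasure μ] {q : ℕ → S → ℝ} {κ : ℕ}
    (hqL : ∀ l, MemLp (q l) 2 μ)
    (hqo : ∀ l l', ∫ x, q l x * q l' x ∂μ = if l = l' then 1 else 0) {c : ℝ}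
    (hc : ∀ᵐ x ∂μ, ∑ l ∈ Finset.range κ, q l x ^ 2 ≤ c) :
    (∀ l ∈ Finset.range κ, ∀ l' ∈ Finset.range κ,
      MemLp (fun x => q l x * q l' x - if l = l' then 1 else 0) 2 μ) ∧
    ∑ l ∈ Finset.range κ, ∑ l' ∈ Finset.range κ,
      ∫ x, (q l x * q l' x - if l = l' then 1 else 0) ^ 2 ∂μ ≤ κ * c := by
  have h1 : ∀ l, (∀ l' ∈ Finset.range κ, MemLp (fun x => q l x * q l' x) 2 μ) ∧
      ∑ l' ∈ Finset.range κ, ∫ x, (q l x * q l' x) ^ 2 ∂μ ≤ c * ∫ x, q l x ^ 2 ∂μ := fun l =>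
    sum_integral_mul_sq_le (hqL l) (fun l => (hqL l).aestronglyMeasurable) hc
  have h2 : ∀ l, ∫ x, q l x ^ 2 ∂μ = 1 := fun l => by
    simpa [pow_two] using hqo l l
  refine ⟨fun l _ l' hl' => ((h1 l).1 l' hl').sub (memLp_const _), ?_⟩
  have h3 : ∀ l ∈ Finset.range κ, ∑ l' ∈ Finset.range κ,
      ∫ x, (q l x * q l' x - if l = l' then 1 else 0) ^ 2 ∂μ ≤ c := fun l _ => by
    refine le_trans (Finset.sum_le_sum fun l' hl' => ?_) ((h1 l).2.trans (by rw [h2, mul_one]))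
    set d : ℝ := if l = l' then 1 else 0 with hd
    have hi1 := ((h1 l).1 l' hl').integrable_sq
    have hi2 : Integrable (fun x => 2 * d * (q l x * q l' x)) μ :=
      ((hqL l).integrable_mul (hqL l')).const_mul _
    have h4 : ∀ x, (q l x * q l' x - d) ^ 2 =
        (q l x * q l' x) ^ 2 - 2 * d * (q l x * q l' x) + d ^ 2 := fun x => by ring
    simp only [h4]
    rw [integral_add (by exact hi1.sub hi2) (integrable_const _), integral_sub hi1 hi2, integral_const_mul,
      hqo, ← hd]
    simp only [integral_const, probReal_univ, smul_eq_mul, one_mul]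
    nlinarith [sq_nonneg d]
  exact (Finset.sum_le_sum h3).trans (by simp)

theorem integral_sub_sum_sq_le {F : S → ℝ} {q : ℕ → S → ℝ} (hF : MemLp F 2 μ)
    (hqL : ∀ l, MemLp (q l) 2 μ)
    (hqo : ∀ l l', ∫ x, q l x * q l' x ∂μ = if l = l' then 1 else 0) (κ : ℕ) :
    ∫ x, (F x - ∑ l ∈ Finset.range κ, (∫ y, F y * q l y ∂μ) * q l x) ^ 2 ∂μ ≤ ∫ x, F x ^ 2 ∂μ := by
  have h1 := norm_sub_sum_smul_sq (s := Finset.range κ) (b := fun l => (hqL l).toLp (q l))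
    (r := fun _ => 1) (c := fun l => ∫ y, F y * q l y ∂μ) (x := hF.toLp F)
    (fun i _ k _ hik => by rw [inner_toLp, hqo, if_neg hik])
    (fun i _ => by rw [norm_toLp_sq]; simpa [pow_two] using hqo i i)
    (fun i _ => by rw [inner_toLp, one_mul])
  have h2 : (hF.toLp F - ∑ l ∈ Finset.range κ, (∫ y, F y * q l y ∂μ) • (hqL l).toLp (q l) :
      Lp ℝ 2 μ) =ᵐ[μ] fun x => F x - ∑ l ∈ Finset.range κ, (∫ y, F y * q l y ∂μ) * q l x := by
    filter_upwards [Lp.coeFn_sub (hF.toLp F) (∑ l ∈ Finset.range κ,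
      (∫ y, F y * q l y ∂μ) • (hqL l).toLp (q l)), hF.coeFn_toLp,
      coeFn_sum_smul (Finset.range κ) (fun l => ∫ y, F y * q l y ∂μ)
        fun l _ => (hqL l).coeFn_toLp] with x h3 h4 h5
    rw [h3, Pi.sub_apply, h4, h5]
  rw [norm_sq_eq_integral_of_ae_eq h2, norm_toLp_sq] at h1
  rw [h1]
  exact sub_le_self _ (Finset.sum_nonneg fun _ _ => by positivity)

theorem integral_sub_sum_mul_eq_zero {F : S → ℝ} {q : ℕ → S → ℝ} (hF : MemLp F 2 μ)
    (hqL : ∀ l, MemLp (q l) 2 μ)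
    (hqo : ∀ l l', ∫ x, q l x * q l' x ∂μ = if l = l' then 1 else 0) {κ l : ℕ}
    (hl : l ∈ Finset.range κ) :
    ∫ x, (F x - ∑ l ∈ Finset.range κ, (∫ y, F y * q l y ∂μ) * q l x) * q l x ∂μ = 0 := by
  have h1 : ∀ x, (F x - ∑ l ∈ Finset.range κ, (∫ y, F y * q l y ∂μ) * q l x) * q l x =
      F x * q l x - ∑ l' ∈ Finset.range κ, (∫ y, F y * q l' y ∂μ) * (q l' x * q l x) := fun x => by
    rw [sub_mul, Finset.sum_mul]
    congr 1
    exact Finset.sum_congr rfl fun _ _ => by ring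
  have h2 : ∀ l' ∈ Finset.range κ,
      Integrable (fun x => (∫ y, F y * q l' y ∂μ) * (q l' x * q l x)) μ := fun l' _ =>
    ((hqL l').integrable_mul (hqL l)).const_mul _
  simp only [h1]
  rw [integral_sub (by exact hF.integrable_mul (hqL l)) (integrable_finsetSum _ h2),
    integral_finsetSum _ h2]
  simp only [integral_const_mul, hqo, mul_ite, mul_one, mul_zero, Finset.sum_ite_eq', if_pos hl,
    sub_self]

end Moments

/-! ### The statistic and the quadratic form of the scores -/

section Remainder

variable {Ω S : Type*} [MeasurableSpace Ω] [MeasurableSpace S] {P : Measure Ω}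
  [IsProbabilityMeasure P] {X : ℕ → Ω → S} {μ : Measure S}

/-- The difference between a statistic built from least squares residuals and the sum of squared
normalized sums of the score functions `u (F_j - h_j)` converges to zero in probability. -/
theorem IsIID.tendstoInMeasure_residual_sub (hX : IsIID P X μ) {q F h : ℕ → S → ℝ} {u : S → ℝ}
    {ρ : ℕ → S → ℝ} {k m : ℕ → ℕ} {r : ℕ → ℕ → Ω → ℝ} {Cq Cu Cρ CF CQ : ℝ}
    (hCq : 0 ≤ Cq) (hCρ : 0 ≤ Cρ)
    (hqm : ∀ l, Measurable (q l)) (hqL : ∀ l, MemLp (q l) 2 μ)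
    (hqo : ∀ l l', ∫ x, q l x * q l' x ∂μ = if l = l' then 1 else 0)
    (hqb : ∀ᶠ n in atTop, ∀ᵐ x ∂μ, ∑ l ∈ Finset.range (k n), q l x ^ 2 ≤ Cq * k n)
    (hFm : ∀ j, Measurable (F j)) (hFL : ∀ j, MemLp (F j) 2 μ)
    (hFs : ∀ᶠ n in atTop, ∑ j ∈ Finset.range (m n), ∫ x, F j x ^ 2 ∂μ ≤ CF)
    (hhm : ∀ j, Measurable (h j)) (hum : Measurable u)
    (hρm : ∀ n, Measurable (ρ n))
    (huq : ∀ l, MemLp (fun x => q l x * u x) 2 μ ∧ ∫ x, (q l x * u x) ^ 2 ∂μ ≤ Cu ∧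
      ∫ x, q l x * u x ∂μ = 0)
    {π : ℕ → ℕ → S → ℝ}
    (hπ : ∀ n j x, π n j x = ∑ l ∈ Finset.range (k n), (∫ y, F j y * q l y ∂μ) * q l x)
    (huh : ∀ n j, MemLp (fun x => (h j x - π n j x) * u x) 2 μ ∧
      ∫ x, ((h j x - π n j x) * u x) ^ 2 ∂μ ≤ Cu * ∫ x, (h j x - π n j x) ^ 2 ∂μ ∧
      ∫ x, (h j x - π n j x) * u x ∂μ = 0)
    (hρ : ∀ᶠ n in atTop, (∀ᵐ x ∂μ, ρ n x ^ 2 ≤ Cρ * (k n / n)) ∧ MemLp (ρ n) 2 μ ∧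
      ∫ x, ρ n x ^ 2 ∂μ ≤ Cρ / n ∧ (∀ l ∈ Finset.range (k n), ∫ x, q l x * ρ n x ∂μ = 0) ∧
      ∀ j, n * (∫ x, (F j x - π n j x) * ρ n x ∂μ) ^ 2 ≤ Cρ * ∫ x, (h j x - π n j x) ^ 2 ∂μ)
    (hproj : Tendsto (fun n => ∑ j ∈ Finset.range (m n), ∫ x, (h j x - π n j x) ^ 2 ∂μ) atTop (𝓝 0))
    (hk : Tendsto (fun n => (k n : ℝ) ^ 2 / n) atTop (𝓝 0)) 
    (hgL : ∀ j, MemLp (fun x => u x * (F j x - h j x)) 2 μ)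
    (hg0 : ∀ j, ∫ x, u x * (F j x - h j x) ∂μ = 0)
    (hgs : ∀ᶠ n in atTop, ∑ j ∈ Finset.range (m n), ∫ x, (u x * (F j x - h j x)) ^ 2 ∂μ ≤ CQ)
    (hr : ∀ᶠ n in atTop, ∀ᵐ ω ∂P, ∃ θ : ℕ → ℝ, (∀ i ∈ Finset.range n, r n i ω =
        u (X i ω) + ρ n (X i ω) - ∑ l ∈ Finset.range (k n), θ l * q l (X i ω)) ∧
      ∀ l ∈ Finset.range (k n), ∑ i ∈ Finset.range n, r n i ω * q l (X i ω) = 0) :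
    TendstoInMeasure P (fun n ω =>
      ∑ j ∈ Finset.range (m n), ((√(n : ℝ))⁻¹ * ∑ i ∈ Finset.range n, r n i ω * F j (X i ω)) ^ 2 -
      ∑ j ∈ Finset.range (m n), normSum X n (fun x => u x * (F j x - h j x)) ω ^ 2) atTop 0 := by
  have := hX.isProbabilityMeasure
  have hπm : ∀ n j, Measurable (π n j) := fun n j => by
    rw [funext (hπ n j)]
    exact Finset.measurable_sum _ fun l _ => (hqm l).const_mul _
  have hπL : ∀ n j, MemLp (π n j) 2 μ := fun n j => by
    rw [funext (hπ n j)]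
    exact memLp_finsetSum _ fun l _ => (hqL l).const_mul _
  have hFπL : ∀ n j, MemLp (fun x => F j x - π n j x) 2 μ := fun n j => (hFL j).sub (hπL n j)
  have hFπ : ∀ n j, ∫ x, (F j x - π n j x) ^ 2 ∂μ ≤ ∫ x, F j x ^ 2 ∂μ := fun n j => by
    simp only [hπ]
    exact integral_sub_sum_sq_le (hFL j) hqL hqo (k n)
  have hFπ0 : ∀ n j, ∀ l ∈ Finset.range (k n), ∫ x, (F j x - π n j x) * q l x ∂μ = 0 :=
    fun n j l hl => by
      simp only [hπ]
      exact integral_sub_sum_mul_eq_zero (hFL j) hqL hqo hl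
  let A : ℕ → ℕ → S → ℝ := fun n j x => (F j x - π n j x) * ρ n x
  let B : ℕ → ℕ → S → ℝ := fun n j x => (h j x - π n j x) * u x
  let G : ℕ → ℕ → ℕ → S → ℝ := fun n j l x => (F j x - π n j x) * q l x
  let V : ℕ → ℕ → S → ℝ := fun n l x => q l x * (u x + ρ n x)
  let M : ℕ → ℕ → S → ℝ := fun l l' x => q l x * q l' x - if l = l' then 1 else 0
  have hAm : ∀ n j, Measurable (A n j) := fun n j => ((hFm j).sub (hπm n j)).mul (hρm n)
  have hBm : ∀ n j, Measurable (B n j) := fun n j => ((hhm j).sub (hπm n j)).mul hum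
  have hGm : ∀ n j l, Measurable (G n j l) := fun n j l => ((hFm j).sub (hπm n j)).mul (hqm l)
  have hVm : ∀ n l, Measurable (V n l) := fun n l => (hqm l).mul (hum.add (hρm n))
  have hMm : ∀ l l', Measurable (M l l') := fun l l' => ((hqm l).mul (hqm l')).sub_const _
  have hAL : ∀ᶠ n in atTop, ∀ j, MemLp (A n j) 2 μ ∧
      ∫ x, A n j x ^ 2 ∂μ ≤ Cρ * (k n / n) * ∫ x, F j x ^ 2 ∂μ := by
    filter_upwards [hρ] with n hn j
    have h1 := memLp_mul_of_sq_le (hFπL n j) (hρm n).aestronglyMeasurable hn.1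
    refine ⟨h1.1, h1.2.trans (mul_le_mul_of_nonneg_left (hFπ n j) (by positivity))⟩
  have hGL : ∀ᶠ n in atTop, ∀ j, (∀ l ∈ Finset.range (k n), MemLp (G n j l) 2 μ) ∧
      ∑ l ∈ Finset.range (k n), ∫ x, G n j l x ^ 2 ∂μ ≤ Cq * k n * ∫ x, F j x ^ 2 ∂μ := by
    filter_upwards [hqb] with n hn j
    have h1 := sum_integral_mul_sq_le (hFπL n j) (fun l => (hqm l).aestronglyMeasurable) hn
    exact ⟨h1.1, h1.2.trans (mul_le_mul_of_nonneg_left (hFπ n j) (by positivity))⟩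
  have hVL : ∀ᶠ n in atTop, (∀ l ∈ Finset.range (k n), MemLp (V n l) 2 μ ∧
      ∫ x, V n l x ∂μ = 0) ∧
      ∑ l ∈ Finset.range (k n), ∫ x, V n l x ^ 2 ∂μ ≤ (2 * Cu + 2 * Cq * Cρ) * k n := by
    filter_upwards [hqb, hρ, eventually_ge_atTop 1] with n hn hρn hn1
    have hn1' : (1 : ℝ) ≤ n := by exact_mod_cast hn1
    have h1 := sum_integral_mul_sq_le hρn.2.1 (fun l => (hqm l).aestronglyMeasurable) hn
    have h2 : ∀ l ∈ Finset.range (k n), MemLp (fun x => q l x * ρ n x) 2 μ := fun l hl => by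
      simpa only [mul_comm] using h1.1 l hl
    have h3 : ∀ l, V n l = fun x => q l x * u x + q l x * ρ n x := fun l => by
      ext x; simp only [V]; ring
    have h4 : ∀ l ∈ Finset.range (k n), MemLp (V n l) 2 μ := fun l hl => by
      rw [h3]; exact (huq l).1.add (h2 l hl)
    refine ⟨fun l hl => ⟨h4 l hl, ?_⟩, ?_⟩
    · rw [h3, integral_add ((huq l).1.integrable (by norm_num)) ((h2 l hl).integrable (by norm_num)),
        (huq l).2.2, hρn.2.2.2.1 l hl, add_zero]
    · have h5 : ∀ l ∈ Finset.range (k n), ∫ x, V n l x ^ 2 ∂μ ≤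
          2 * Cu + 2 * ∫ x, (ρ n x * q l x) ^ 2 ∂μ := fun l hl => by
        have h6 : ∫ x, V n l x ^ 2 ∂μ ≤
            ∫ x, (2 * (q l x * u x) ^ 2 + 2 * (ρ n x * q l x) ^ 2) ∂μ := by
          refine integral_mono (h4 l hl).integrable_sq (((huq l).1.integrable_sq.const_mul _).add
            ((h1.1 l hl).integrable_sq.const_mul _)) fun x => ?_
          simp only [V]
          nlinarith [sq_nonneg (q l x * u x - q l x * ρ n x)]
        rw [integral_add ((huq l).1.integrable_sq.const_mul _)
          ((h1.1 l hl).integrable_sq.const_mul _), integral_const_mul, integral_const_mul] at h6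
        linarith [(huq l).2.1]
      refine (Finset.sum_le_sum h5).trans ?_
      have h7 : ∫ x, ρ n x ^ 2 ∂μ ≤ Cρ :=
        hρn.2.2.1.trans (div_le_self hCρ hn1')
      have h8 := h1.2.trans (mul_le_mul_of_nonneg_left h7 (by positivity : 0 ≤ Cq * k n))
      have h9 : ∑ l ∈ Finset.range (k n), 2 * ∫ x, (ρ n x * q l x) ^ 2 ∂μ =
          2 * ∑ l ∈ Finset.range (k n), ∫ x, (ρ n x * q l x) ^ 2 ∂μ := (Finset.mul_sum _ _ _).symm
      rw [Finset.sum_add_distrib, h9, Finset.sum_const, Finset.card_range, nsmul_eq_mul]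
      linarith
  have hML : ∀ᶠ n in atTop, (∀ l ∈ Finset.range (k n), ∀ l' ∈ Finset.range (k n),
      MemLp (M l l') 2 μ) ∧ ∑ l ∈ Finset.range (k n), ∑ l' ∈ Finset.range (k n),
        ∫ x, M l l' x ^ 2 ∂μ ≤ k n * (Cq * k n) := by
    filter_upwards [hqb] with n hn
    exact sum_integral_gram_sub_sq_le hqL hqo hn
  have hM0 : ∀ l l', ∫ x, M l l' x ∂μ = 0 := fun l l' => by
    simp only [M]
    rw [integral_sub (by exact (hqL l).integrable_mul (hqL l')) (integrable_const _), hqo]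
    simp
  -- Orders of the means: `α` tends to zero, `δ` is `O(k / n)`, `s` is `O(k)`, `e` is `O(k² / n)`
  -- and `b` is bounded. So `k² = o(n)` is what this argument needs.
  let α : ℕ → Ω → ℝ := fun n ω => 3 * ∑ j ∈ Finset.range (m n),
    (normSum X n (A n j) ω ^ 2 + normSum X n (B n j) ω ^ 2)
  let δ : ℕ → Ω → ℝ := fun n ω => 12 * ((n : ℝ)⁻¹ * ∑ j ∈ Finset.range (m n),
    ∑ l ∈ Finset.range (k n), normSum X n (G n j l) ω ^ 2)
  let s : ℕ → Ω → ℝ := fun n ω => ∑ l ∈ Finset.range (k n), normSum X n (V n l) ω ^ 2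
  let b : ℕ → Ω → ℝ := fun n ω => ∑ j ∈ Finset.range (m n),
    normSum X n (fun x => u x * (F j x - h j x)) ω ^ 2
  let e : ℕ → Ω → ℝ := fun n ω => (n : ℝ)⁻¹ * ∑ l ∈ Finset.range (k n),
    ∑ l' ∈ Finset.range (k n), normSum X n (M l l') ω ^ 2
  have hα : ∀ᶠ n in atTop, Integrable (α n) P ∧ ∫ ω, α n ω ∂P ≤
      3 * (Cρ * (k n / n) * CF + (Cρ + Cu) *
        ∑ j ∈ Finset.range (m n), ∫ x, (h j x - π n j x) ^ 2 ∂μ) := by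
    filter_upwards [hAL, hρ, hFs] with n hA hρn hF
    have hi : ∀ j, Integrable (fun ω => normSum X n (A n j) ω ^ 2) P := fun j =>
      hX.integrable_normSum_sq (hA j).1 n
    have hi' : ∀ j, Integrable (fun ω => normSum X n (B n j) ω ^ 2) P := fun j =>
      hX.integrable_normSum_sq (huh n j).1 n
    have hij : ∀ j, Integrable (fun ω => normSum X n (A n j) ω ^ 2 + normSum X n (B n j) ω ^ 2) P :=
      fun j => (hi j).add (hi' j)
    refine ⟨(integrable_finsetSum _ fun j _ => hij j).const_mul _, ?_⟩
    simp only [α]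
    rw [integral_const_mul, integral_finsetSum _ fun j _ => hij j]
    refine mul_le_mul_of_nonneg_left ?_ (by norm_num)
    have h1 : ∀ j ∈ Finset.range (m n), ∫ ω, (normSum X n (A n j) ω ^ 2 +
        normSum X n (B n j) ω ^ 2) ∂P ≤ Cρ * (k n / n) * ∫ x, F j x ^ 2 ∂μ +
          (Cρ + Cu) * ∫ x, (h j x - π n j x) ^ 2 ∂μ := fun j _ => by
      rw [integral_add (hi j) (hi' j)]
      have h2 := hX.integral_normSum_sq_le (hAm n j) (hA j).1 n
      have h3 := hX.integral_normSum_sq_le (hBm n j) (huh n j).1 n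
      have h4 : ∫ x, B n j x ∂μ = 0 := (huh n j).2.2
      have h5 : ∫ x, B n j x ^ 2 ∂μ ≤ Cu * ∫ x, (h j x - π n j x) ^ 2 ∂μ := (huh n j).2.1
      -- The functions `A n j` are the only summands that are not centered; this is the bias coming
      -- from the approximation of the regression function.
      have h6 : n * (∫ x, A n j x ∂μ) ^ 2 ≤ Cρ * ∫ x, (h j x - π n j x) ^ 2 ∂μ :=
        hρn.2.2.2.2 j
      rw [h4] at h3
      linarith [(hA j).2]
    refine (Finset.sum_le_sum h1).trans ?_
    rw [Finset.sum_add_distrib, ← Finset.mul_sum, ← Finset.mul_sum]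
    exact add_le_add_left (mul_le_mul_of_nonneg_left hF (by positivity)) _
  have hδ : ∀ᶠ n in atTop, Integrable (δ n) P ∧ ∫ ω, δ n ω ∂P ≤
      12 * ((n : ℝ)⁻¹ * (Cq * k n * CF)) := by
    filter_upwards [hGL, hFs] with n hG hF
    have hi : ∀ j, ∀ l ∈ Finset.range (k n), Integrable (fun ω => normSum X n (G n j l) ω ^ 2) P :=
      fun j l hl => hX.integrable_normSum_sq ((hG j).1 l hl) n
    have hi' : ∀ j, Integrable (fun ω => ∑ l ∈ Finset.range (k n), normSum X n (G n j l) ω ^ 2) P :=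
      fun j => integrable_finsetSum _ (hi j)
    refine ⟨((integrable_finsetSum _ fun j _ => hi' j).const_mul _).const_mul _, ?_⟩
    simp only [δ]
    rw [integral_const_mul, integral_const_mul, integral_finsetSum _ fun j _ => hi' j]
    refine mul_le_mul_of_nonneg_left (mul_le_mul_of_nonneg_left ?_ (by positivity)) (by norm_num)
    have h1 : ∀ j ∈ Finset.range (m n), ∫ ω, ∑ l ∈ Finset.range (k n),
        normSum X n (G n j l) ω ^ 2 ∂P ≤ Cq * k n * ∫ x, F j x ^ 2 ∂μ := fun j _ => by
      rw [integral_finsetSum _ (hi j)]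
      refine le_trans (Finset.sum_le_sum fun l hl => ?_) (hG j).2
      have h2 := hX.integral_normSum_sq_le (hGm n j l) ((hG j).1 l hl) n
      have h3 : ∫ x, G n j l x ∂μ = 0 := hFπ0 n j l hl
      rw [h3] at h2
      simpa using h2
    refine (Finset.sum_le_sum h1).trans ?_
    rw [← Finset.mul_sum]
    exact mul_le_mul_of_nonneg_left hF (by positivity)
  have hs : ∀ᶠ n in atTop, Integrable (s n) P ∧ ∫ ω, s n ω ∂P ≤ (2 * Cu + 2 * Cq * Cρ) * k n := by
    filter_upwards [hVL] with n hV
    have hi : ∀ l ∈ Finset.range (k n), Integrable (fun ω => normSum X n (V n l) ω ^ 2) P :=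
      fun l hl => hX.integrable_normSum_sq (hV.1 l hl).1 n
    refine ⟨integrable_finsetSum _ hi, ?_⟩
    simp only [s]
    rw [integral_finsetSum _ hi]
    refine le_trans (Finset.sum_le_sum fun l hl => ?_) hV.2
    have h2 := hX.integral_normSum_sq_le (hVm n l) (hV.1 l hl).1 n
    rw [(hV.1 l hl).2] at h2
    simpa using h2
  have hb : ∀ᶠ n in atTop, Integrable (b n) P ∧ ∫ ω, b n ω ∂P ≤ CQ := by
    filter_upwards [hgs] with n hn
    have hi : ∀ j, Integrable (fun ω => normSum X n (fun x => u x * (F j x - h j x)) ω ^ 2) P :=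
      fun j => hX.integrable_normSum_sq (hgL j) n
    refine ⟨integrable_finsetSum _ fun j _ => hi j, ?_⟩
    simp only [b]
    rw [integral_finsetSum _ fun j _ => hi j]
    refine le_trans (Finset.sum_le_sum fun j _ => ?_) hn
    have h2 := hX.integral_normSum_sq_le (g := fun x => u x * (F j x - h j x))
      (hum.mul ((hFm j).sub (hhm j))) (hgL j) n
    rw [hg0 j] at h2
    simpa using h2
  have he : ∀ᶠ n in atTop, Integrable (e n) P ∧ ∫ ω, e n ω ∂P ≤ Cq * ((k n : ℝ) ^ 2 / n) := by
    filter_upwards [hML] with n hM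
    have hi : ∀ l ∈ Finset.range (k n), ∀ l' ∈ Finset.range (k n),
        Integrable (fun ω => normSum X n (M l l') ω ^ 2) P :=
      fun l hl l' hl' => hX.integrable_normSum_sq (hM.1 l hl l' hl') n
    have hi' : ∀ l ∈ Finset.range (k n),
        Integrable (fun ω => ∑ l' ∈ Finset.range (k n), normSum X n (M l l') ω ^ 2) P :=
      fun l hl => integrable_finsetSum _ (hi l hl)
    refine ⟨(integrable_finsetSum _ hi').const_mul _, ?_⟩
    simp only [e]
    rw [integral_const_mul, integral_finsetSum _ hi',
      show Cq * ((k n : ℝ) ^ 2 / n) = (n : ℝ)⁻¹ * (k n * (Cq * k n)) by ring]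
    refine mul_le_mul_of_nonneg_left ?_ (by positivity)
    refine le_trans (Finset.sum_le_sum fun l hl => ?_) hM.2
    rw [integral_finsetSum _ (hi l hl)]
    refine Finset.sum_le_sum fun l' hl' => ?_
    have h2 := hX.integral_normSum_sq_le (hMm l l') (hM.1 l hl l' hl') n
    rw [hM0] at h2
    simpa using h2
  have hα0 : ∀ n ω, 0 ≤ α n ω := fun n ω => by positivity
  have hδ0 : ∀ n ω, 0 ≤ δ n ω := fun n ω => by positivity
  have hs0 : ∀ n ω, 0 ≤ s n ω := fun n ω => by positivity
  have hb0 : ∀ n ω, 0 ≤ b n ω := fun n ω => by positivity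
  have he0 : ∀ n ω, 0 ≤ e n ω := fun n ω => by positivity
  have hk1 : Tendsto (fun n => (k n : ℝ) / n) atTop (𝓝 0) := by
    refine squeeze_zero (fun n => by positivity) (fun n => ?_) hk
    refine div_le_div_of_nonneg_right ?_ (Nat.cast_nonneg n)
    exact_mod_cast Nat.le_self_pow two_ne_zero (k n)
  refine tendstoInMeasure_zero_of_bound hα0 hδ0 hs0 hb0 he0 ?_ ?_ ?_ (hb.mono fun n h => h.2) ?_ ?_
  · filter_upwards [hα, hδ, hs, hb, he] with n h1 h2 h3 h4 h5
    exact ⟨h1.1, h2.1, h3.1, h4.1, h5.1⟩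
  · refine squeeze_zero' (.of_forall fun n => integral_nonneg (hα0 n)) (hα.mono fun n h => h.2) ?_
    have := (((hk1.const_mul Cρ).mul_const CF).add (hproj.const_mul (Cρ + Cu))).const_mul 3
    simpa using this
  · refine squeeze_zero' (.of_forall fun n => mul_nonneg (integral_nonneg (hδ0 n))
      (integral_nonneg (hs0 n))) (g := fun n => 12 * (Cq * CF * (2 * Cu + 2 * Cq * Cρ)) *
        ((k n : ℝ) ^ 2 / n)) ?_ (by simpa using hk.const_mul _)
    filter_upwards [hδ, hs] with n h1 h2
    refine (mul_le_mul h1.2 h2.2 (integral_nonneg (hs0 n))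
      ((integral_nonneg (hδ0 n)).trans h1.2)).trans (le_of_eq ?_)
    ring
  · refine squeeze_zero' (.of_forall fun n => integral_nonneg (he0 n)) (he.mono fun n h => h.2) ?_
    simpa using hk.const_mul Cq
  · filter_upwards [hr, eventually_ne_atTop 0] with n hn hn0
    filter_upwards [hn] with ω hω hle
    obtain ⟨θ, hθ1, hθ2⟩ := hω
    refine abs_sum_sq_sub_sum_sq_le (m n)
      (fun j => (√(n : ℝ))⁻¹ * ∑ i ∈ Finset.range n, r n i ω * F j (X i ω))
      (fun j => normSum X n (fun x => u x * (F j x - h j x)) ω) ?_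
    have h1 := sum_sq_residual_sub_le (m n) hn0 (fun j l => ∫ y, F j y * q l y ∂μ) F h hθ1 hθ2 hle
    simpa only [← hπ] using h1

end Remainder

end ExogeneityTest
end

noncomputable section
namespace ExogeneityTest

/-! ### Generalized inverses of Gram matrices and measurability of the statistic -/

section GeneralizedInverse

variable {n k : ℕ} {D : Matrix (Fin n) (Fin k) ℝ} {G : Matrix (Fin k) (Fin k) ℝ}

/-- Transposing the defining identity gives `DᵀD (Gᵀ DᵀD - 1) = 0`. A real matrix and its Gram
matrix have the same kernel, so `D (Gᵀ DᵀD - 1) = 0`; transpose again. Symmetry of `G` is not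
required. -/
theorem IsGeneralizedInverse.gram_mul_mul_transpose
    (h : IsGeneralizedInverse (D.transpose * D) G) :
    D.transpose * D * (G * D.transpose) = D.transpose := by
  have h0 : D.transpose * D * G * (D.transpose * D) = D.transpose * D := h
  have h1 : D.transpose * D * (G.transpose * (D.transpose * D) - 1) = 0 := by
    have h2 := congrArg Matrix.transpose h0
    simp only [Matrix.transpose_mul, Matrix.transpose_transpose] at h2
    rw [Matrix.mul_sub, Matrix.mul_one, sub_eq_zero, h2]
  have h3 : D * (G.transpose * (D.transpose * D) - 1) = 0 := by
    have h4 := Matrix.conjTranspose_mul_self_mul_eq_zero D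
      (G.transpose * (D.transpose * D) - 1)
    rw [Matrix.conjTranspose_eq_transpose_of_trivial] at h4
    exact h4.1 h1
  rw [Matrix.mul_sub, Matrix.mul_one, sub_eq_zero] at h3
  have h5 := congrArg Matrix.transpose h3
  simp only [Matrix.transpose_mul, Matrix.transpose_transpose] at h5
  simpa only [Matrix.mul_assoc] using h5

theorem isUnit_gram_add_smul_one (D : Matrix (Fin n) (Fin k) ℝ) {ε : ℝ} (hε : 0 < ε) :
    IsUnit (D.transpose * D + ε • (1 : Matrix (Fin k) (Fin k) ℝ)) := by
  have h1 : (D.transpose * D).PosSemidef := by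
    simpa using Matrix.posSemidef_conjTranspose_mul_self D
  exact (Matrix.PosDef.posSemidef_add h1 (Matrix.PosDef.one.smul hε)).isUnit

/-- The fitted values of the ridge regression converge to the least squares fit. -/
theorem abs_sub_ridge_fit_sq_le (h : IsGeneralizedInverse (D.transpose * D) G) {ε : ℝ} (hε : 0 < ε)
    (y : Fin n → ℝ) (i : Fin n) :
    (D.mulVec ((G * D.transpose).mulVec y) i -
      D.mulVec (((D.transpose * D + ε • (1 : Matrix (Fin k) (Fin k) ℝ))⁻¹ *
        D.transpose).mulVec y) i) ^ 2 ≤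
      ε * ∑ l, (G * D.transpose).mulVec y l ^ 2 := by
  set A := D.transpose * D with hA
  set b := (G * D.transpose).mulVec y with hb
  set c := ((A + ε • (1 : Matrix (Fin k) (Fin k) ℝ))⁻¹ * D.transpose).mulVec y with hc
  have hu := isUnit_gram_add_smul_one D hε
  rw [← hA, Matrix.isUnit_iff_isUnit_det] at hu
  have h1 : A.mulVec b = D.transpose.mulVec y := by
    rw [hb, Matrix.mulVec_mulVec, h.gram_mul_mul_transpose]
  have h2 : A.mulVec c + ε • c = D.transpose.mulVec y := by
    have h3 : (A + ε • (1 : Matrix (Fin k) (Fin k) ℝ)).mulVec c = D.transpose.mulVec y := by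
      rw [hc, Matrix.mulVec_mulVec, Matrix.mul_nonsing_inv_cancel_left _ _ hu]
    rw [← h3, Matrix.add_mulVec, Matrix.smul_mulVec, Matrix.one_mulVec]
  -- The difference of the two normal equations. Paired with `b - c` it gives `‖D (b - c)‖² = ε ⟨b -
  -- c, c⟩ ≤ ε ‖b‖²`.
  have h4 : A.mulVec (b - c) = ε • c := by
    rw [Matrix.mulVec_sub, h1, ← h2, add_sub_cancel_left]
  have h5 : D.mulVec (b - c) ⬝ᵥ D.mulVec (b - c) = ε * ((b - c) ⬝ᵥ c) := by
    rw [Matrix.dotProduct_mulVec, ← Matrix.mulVec_transpose, Matrix.mulVec_mulVec, ← hA, h4,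
      smul_dotProduct, smul_eq_mul, dotProduct_comm]
  have h6 : (D.mulVec b i - D.mulVec c i) ^ 2 ≤ D.mulVec (b - c) ⬝ᵥ D.mulVec (b - c) := by
    rw [← Pi.sub_apply, ← Matrix.mulVec_sub, pow_two]
    exact Finset.single_le_sum (f := fun i => D.mulVec (b - c) i * D.mulVec (b - c) i)
      (fun _ _ => mul_self_nonneg _) (Finset.mem_univ i)
  refine (h6.trans h5.le).trans (mul_le_mul_of_nonneg_left ?_ hε.le)
  refine Finset.sum_le_sum fun l _ => ?_
  simp only [Pi.sub_apply]
  nlinarith [sq_nonneg (b l - c l), sq_nonneg (b l), sq_nonneg (c l)]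

theorem tendsto_ridge_fit (h : IsGeneralizedInverse (D.transpose * D) G) (y : Fin n → ℝ)
    (i : Fin n) :
    Tendsto (fun N : ℕ => D.mulVec (((D.transpose * D +
      (1 / ((N : ℝ) + 1)) • (1 : Matrix (Fin k) (Fin k) ℝ))⁻¹ * D.transpose).mulVec y) i) atTop
      (𝓝 (D.mulVec ((G * D.transpose).mulVec y) i)) := by
  rw [tendsto_iff_dist_tendsto_zero]
  have h1 : Tendsto (fun N : ℕ => √(1 / ((N : ℝ) + 1) * ∑ l, (G * D.transpose).mulVec y l ^ 2)) atTop
      (𝓝 0) := by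
    have h2 := ((tendsto_one_div_add_atTop_nhds_zero_nat (𝕜 := ℝ)).mul_const
      (∑ l, (G * D.transpose).mulVec y l ^ 2)).sqrt
    simpa using h2
  refine squeeze_zero (fun _ => dist_nonneg) (fun N => ?_) h1
  rw [dist_comm, Real.dist_eq]
  exact Real.abs_le_sqrt (abs_sub_ridge_fit_sq_le h (by positivity) y i)

theorem measurable_inv_apply {Ω : Type*} [MeasurableSpace Ω] {A : Ω → Matrix (Fin k) (Fin k) ℝ}
    (hA : ∀ i j, Measurable fun ω => A ω i j) (i j : Fin k) :
    Measurable fun ω => (A ω)⁻¹ i j := by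
  have hA' : Measurable fun ω => (fun i j => A ω i j : Fin k → Fin k → ℝ) :=
    measurable_pi_lambda _ fun i => measurable_pi_lambda _ fun j => hA i j
  have h1 : Continuous fun M : Fin k → Fin k → ℝ => (Matrix.of M).det :=
    Continuous.matrix_det continuous_id
  have h2 : Continuous fun M : Fin k → Fin k → ℝ => (Matrix.of M).adjugate i j :=
    (Continuous.matrix_adjugate continuous_id).matrix_elem i j
  have h3 : ∀ ω, (A ω)⁻¹ i j = (A ω).det⁻¹ * (A ω).adjugate i j := fun ω => by
    rw [Matrix.inv_def, Ring.inverse_eq_inv', Matrix.smul_apply, smul_eq_mul]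
  simp only [h3]
  exact (h1.measurable.comp hA').inv.mul (h2.measurable.comp hA')

end GeneralizedInverse

section Statistic

variable {Ω E F : Type*}

theorem seriesEstimator_sample (e : ℕ → E → ℝ) (n k : ℕ) (G : Matrix (Fin k) (Fin k) ℝ) (y : ℕ → ℝ)
    (z : ℕ → E) (i : Fin n) :
    seriesEstimator e n k G y z (z i) = (designMatrix e n k z).mulVec
      ((G * (designMatrix e n k z).transpose).mulVec fun i : Fin n => y i) i :=
  rfl

/-- The normal equations of least squares. -/
theorem sum_residual_mul_eq_zero (e : ℕ → E → ℝ) {n k : ℕ} {G : Matrix (Fin k) (Fin k) ℝ}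
    {y : ℕ → ℝ} {z : ℕ → E} (h : IsGeneralizedInverse (designGram e n k z) G) (l : Fin k) :
    ∑ i ∈ Finset.range n, (y i - seriesEstimator e n k G y z (z i)) * e l (z i) = 0 := by
  rw [← Fin.sum_univ_eq_sum_range
    fun i => (y i - seriesEstimator e n k G y z (z i)) * e l (z i)]
  simp only [seriesEstimator_sample]
  set D := designMatrix e n k z with hD
  have h1 : (D.transpose * D).mulVec ((G * D.transpose).mulVec fun i : Fin n => y i) =
      D.transpose.mulVec fun i : Fin n => y i := by
    rw [Matrix.mulVec_mulVec, IsGeneralizedInverse.gram_mul_mul_transpose h]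
  have h2 := congrFun h1 l
  rw [← Matrix.mulVec_mulVec] at h2
  set b := (G * D.transpose).mulVec fun i : Fin n => y i
  have h3 : ∀ v : Fin n → ℝ, D.transpose.mulVec v l = ∑ i : Fin n, v i * e l (z i) := fun v => by
    simp [Matrix.mulVec, dotProduct, hD, designMatrix, mul_comm]
  rw [h3, h3] at h2
  simp only [sub_mul, Finset.sum_sub_distrib]
  rw [h2, sub_self]

/-- The generalized inverse may be chosen without any measurability in `ω`. The fitted values do not
depend on the choice: they are limits of ridge fits, which involve genuine inverses and are
measurable functions of the data. -/
theorem measurable_seriesEstimator_sample [MeasurableSpace Ω] [MeasurableSpace E] {e : ℕ → E → ℝ} (he : ∀ l, Measurable (e l)) {n k : ℕ}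
    {G : Ω → Matrix (Fin k) (Fin k) ℝ} {y : ℕ → Ω → ℝ} {z : ℕ → Ω → E}
    (hy : ∀ i, Measurable (y i)) (hz : ∀ i, Measurable (z i))
    (hG : ∀ ω, IsGeneralizedInverse (designGram e n k fun i => z i ω) (G ω)) {i : ℕ} (hi : i < n) :
    Measurable fun ω => seriesEstimator e n k (G ω) (fun i => y i ω) (fun i => z i ω) (z i ω) := by
  let D : Ω → Matrix (Fin n) (Fin k) ℝ := fun ω => designMatrix e n k fun i => z i ω
  have hD : ∀ i l, Measurable fun ω => D ω i l := fun i l => (he l).comp (hz i)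
  have hA : ∀ (N : ℕ) (l l' : Fin k), Measurable fun ω => ((D ω).transpose * D ω +
      (1 / ((N : ℝ) + 1)) • (1 : Matrix (Fin k) (Fin k) ℝ)) l l' := fun N l l' => by
    simp only [Matrix.add_apply, Matrix.mul_apply, Matrix.transpose_apply]
    exact (Finset.measurable_sum _ fun i _ => (hD i l).mul (hD i l')).add_const _
  refine measurable_of_tendsto_metrizable (f := fun (N : ℕ) ω => (D ω).mulVec
    ((((D ω).transpose * D ω + (1 / ((N : ℝ) + 1)) • (1 : Matrix (Fin k) (Fin k) ℝ))⁻¹ *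
      (D ω).transpose).mulVec fun i : Fin n => y i ω) ⟨i, hi⟩) (fun N => ?_) ?_
  · simp only [Matrix.mulVec, dotProduct, Matrix.mul_apply, Matrix.transpose_apply]
    exact Finset.measurable_sum _ fun l _ => (hD _ l).mul (Finset.measurable_sum _ fun i' _ =>
      (Finset.measurable_sum _ fun l' _ => (measurable_inv_apply (hA N) l l').mul (hD i' l')).mul
        (hy i'))
  · rw [tendsto_pi_nhds]
    exact fun ω => tendsto_ridge_fit (hG ω) (fun i : Fin n => y i ω) ⟨i, hi⟩

theorem mul_testStatistic_eq {τ : ℕ → ℝ} (hτ : ∀ j, 0 ≤ τ j) (f : ℕ → F → ℝ) (e : ℕ → E → ℝ)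
    {n : ℕ} (hn : n ≠ 0) (m k : ℕ) (G : Matrix (Fin k) (Fin k) ℝ) (y : ℕ → ℝ) (z : ℕ → E)
    (x : ℕ → F) :
    n * testStatistic τ f e n m k G y z x = ∑ j ∈ Finset.range m, ((√(n : ℝ))⁻¹ *
      ∑ i ∈ Finset.range n, (y i - seriesEstimator e n k G y z (z i)) *
        (√(τ j) * f j (x i))) ^ 2 := by
  rw [testStatistic, Finset.mul_sum]
  refine Finset.sum_congr rfl fun j _ => ?_
  have h1 : ∑ i ∈ Finset.range n, (y i - seriesEstimator e n k G y z (z i)) *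
      (√(τ j) * f j (x i)) = √(τ j) *
        ∑ i ∈ Finset.range n, (y i - seriesEstimator e n k G y z (z i)) * f j (x i) := by
    rw [Finset.mul_sum]
    exact Finset.sum_congr rfl fun i _ => by ring
  have hn' : (n : ℝ) ≠ 0 := Nat.cast_ne_zero.2 hn
  rw [h1, sq_abs, mul_pow, mul_pow, mul_pow, inv_pow, inv_pow, Real.sq_sqrt (Nat.cast_nonneg n),
    Real.sq_sqrt (hτ j)]
  field_simp

theorem measurable_mul_testStatistic [MeasurableSpace Ω] [MeasurableSpace E] [MeasurableSpace F] {τ : ℕ → ℝ} {f : ℕ → F → ℝ} (hf : ∀ j, Measurable (f j))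
    {e : ℕ → E → ℝ} (he : ∀ l, Measurable (e l)) {n m k : ℕ}
    {G : Ω → Matrix (Fin k) (Fin k) ℝ} {y : ℕ → Ω → ℝ} {z : ℕ → Ω → E} {x : ℕ → Ω → F}
    (hy : ∀ i, Measurable (y i)) (hz : ∀ i, Measurable (z i)) (hx : ∀ i, Measurable (x i))
    (hG : ∀ ω, IsGeneralizedInverse (designGram e n k fun i => z i ω) (G ω)) :
    Measurable fun ω => (n : ℝ) * testStatistic τ f e n m k (G ω) (fun i => y i ω)
      (fun i => z i ω) (fun i => x i ω) := by
  refine (Finset.measurable_sum _ fun j _ => ?_).const_mul _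
  refine Measurable.const_mul ?_ _
  simp only [sq_abs]
  refine ((Finset.measurable_sum _ fun i hi => ?_).const_mul _).pow_const 2
  exact ((hy i).sub (measurable_seriesEstimator_sample he hy hz hG (Finset.mem_range.1 hi))).mul
    ((hf j).comp (hx i))

end Statistic

end ExogeneityTest
end

noncomputable section
namespace ExogeneityTest

/-! ### Projection onto the closed span of an orthonormal sequence -/

section Projection

variable {H : Type*} [NormedAddCommGroup H] [InnerProductSpace ℝ H] [CompleteSpace H] {v : ℕ → H}

theorem norm_tsum_inner_smul_le (hv : Orthonormal ℝ v) (x : H) :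
    ‖∑' l, inner ℝ (v l) x • v l‖ ≤ ‖x‖ := by
  have h1 := (summable_inner_smul_of_orthonormal hv x).hasSum.tendsto_sum_nat.norm
  refine le_of_tendsto h1 (.of_forall fun N => ?_)
  have h2 := norm_sub_sum_smul_sq (s := Finset.range N) (b := v) (r := fun _ => 1)
    (c := fun l => inner ℝ (v l) x) (x := x) (fun i _ k _ hik => hv.2 hik)
    (fun i _ => by rw [hv.1 i, one_pow]) (fun i _ => by rw [one_mul, real_inner_comm])
  have h3 := norm_sub_sum_smul_sq (s := Finset.range N) (b := v) (r := fun _ => 1)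
    (c := fun l => inner ℝ (v l) x) (x := 0 + ∑ l ∈ Finset.range N, inner ℝ (v l) x • v l)
    (fun i _ k _ hik => hv.2 hik)
    (fun i _ => by rw [hv.1 i, one_pow]) (fun i hi => by
      rw [one_mul, zero_add, sum_inner, Finset.sum_eq_single i]
      · rw [real_inner_smul_left, real_inner_self_eq_norm_sq, hv.1 i]; ring
      · intro j _ hj
        rw [real_inner_smul_left, hv.2 hj, mul_zero]
      · exact fun h => absurd hi h)
  rw [add_sub_cancel_right, norm_zero, zero_add] at h3
  refine le_of_sq_le_sq ?_ (norm_nonneg x)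
  nlinarith [sq_nonneg ‖x - ∑ l ∈ Finset.range N, inner ℝ (v l) x • v l‖]

theorem norm_tsum_sub_sum_sq_le (hv : Orthonormal ℝ v) (x : H) (N : ℕ) :
    ‖∑' l, inner ℝ (v l) x • v l - ∑ l ∈ Finset.range N, inner ℝ (v l) x • v l‖ ^ 2 ≤
      ‖x‖ ^ 2 := by
  have h2 := norm_sub_sum_smul_sq (s := Finset.range N) (b := v) (r := fun _ => 1)
    (c := fun l => inner ℝ (v l) x) (x := ∑' l, inner ℝ (v l) x • v l)
    (fun i _ k _ hik => hv.2 hik) (fun i _ => by rw [hv.1 i, one_pow])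
    (fun i _ => by rw [one_mul, real_inner_comm, inner_tsum_inner_smul_of_orthonormal hv])
  have h3 : 0 ≤ ∑ l ∈ Finset.range N, 1 * inner ℝ (v l) x ^ 2 :=
    Finset.sum_nonneg fun _ _ => by positivity
  have h4 := pow_le_pow_left₀ (norm_nonneg _) (norm_tsum_inner_smul_le hv x) 2
  linarith

theorem tendsto_norm_tsum_sub_sum_sq (hv : Orthonormal ℝ v) (x : H) {k : ℕ → ℕ}
    (hk : Tendsto k atTop atTop) :
    Tendsto (fun n => ‖∑' l, inner ℝ (v l) x • v l -
      ∑ l ∈ Finset.range (k n), inner ℝ (v l) x • v l‖ ^ 2) atTop (𝓝 0) := by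
  have h1 := (summable_inner_smul_of_orthonormal hv x).hasSum.tendsto_sum_nat.comp hk
  have h2 := ((h1.const_sub (∑' l, inner ℝ (v l) x • v l)).norm).pow 2
  simpa using h2

/-- The residual of the projection is orthogonal to each `v l`, hence to their span and, by
continuity of the inner product, to its limits. -/
theorem inner_sub_tsum_eq_zero (hv : Orthonormal ℝ v) (x : H) {y : H} {s : ℕ → H}
    (hs : ∀ n, s n ∈ Submodule.span ℝ (Set.range v)) (hy : Tendsto s atTop (𝓝 y)) :
    inner ℝ (x - ∑' l, inner ℝ (v l) x • v l) y = 0 := by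
  have h1 : ∀ n, inner ℝ (x - ∑' l, inner ℝ (v l) x • v l) (s n) = 0 := fun n => by
    refine Submodule.span_induction (p := fun z _ =>
      inner ℝ (x - ∑' l, inner ℝ (v l) x • v l) z = 0) ?_ ?_ ?_ ?_ (hs n)
    · rintro _ ⟨l, rfl⟩
      rw [real_inner_comm, inner_sub_right, inner_tsum_inner_smul_of_orthonormal hv, sub_self]
    · exact inner_zero_right _
    · intro a b _ _ ha hb
      rw [inner_add_right, ha, hb, add_zero]
    · intro c a _ ha
      rw [inner_smul_right, ha, mul_zero]
  have h2 := (tendsto_const_nhds (x := x - ∑' l, inner ℝ (v l) x • v l)).inner hy (𝕜 := ℝ)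
  exact tendsto_nhds_unique h2 (by simp only [h1]; exact tendsto_const_nhds)

end Projection

/-! ### The orthonormalized functions -/

theorem exists_sum_smul_of_mem_span_image {ι M : Type*} [AddCommGroup M] [Module ℝ M] {v : ι → M}
    {s : Finset ι} {x : M} (hx : x ∈ Submodule.span ℝ (v '' s)) :
    ∃ C : ι → ℝ, x = ∑ i ∈ s, C i • v i := by
  classical
  rw [Submodule.mem_span_image_finset_iff_exists_fun] at hx
  obtain ⟨C, hC⟩ := hx
  refine ⟨fun i => if hi : i ∈ s then C ⟨i, hi⟩ else 0, ?_⟩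
  rw [← hC, ← Finset.sum_coe_sort s fun i => (if hi : i ∈ s then C ⟨i, hi⟩ else 0) • v i]
  exact Finset.sum_congr rfl fun i _ => by simp

/-- Adding `c` to an eigenvalue of `Q - c • 1` gives an eigenvalue of `Q`, so `Q - c • 1` is
positive semidefinite. -/
theorem mul_sum_sq_le_of_eigenvalue_ge {κ : ℕ} {Q : Matrix (Fin κ) (Fin κ) ℝ} {c : ℝ}
    (hQ : Q.IsHermitian) (h : ∀ μ, Module.End.HasEigenvalue (Matrix.toLin' Q) μ → c ≤ μ)
    (b : Fin κ → ℝ) : c * ∑ i, b i ^ 2 ≤ ∑ i, ∑ j, b i * b j * Q i j := by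
  have h1 : (Q - c • (1 : Matrix (Fin κ) (Fin κ) ℝ)).IsHermitian := by
    refine hQ.sub ?_
    rw [Matrix.IsHermitian, Matrix.conjTranspose_smul, Matrix.conjTranspose_one]
    simp
  have h2 : (Q - c • (1 : Matrix (Fin κ) (Fin κ) ℝ)).PosSemidef := by
    rw [h1.posSemidef_iff_eigenvalues_nonneg]
    intro i
    have h3 := h1.mulVec_eigenvectorBasis i
    rw [Matrix.sub_mulVec, Matrix.smul_mulVec, Matrix.one_mulVec, sub_eq_iff_eq_add,
      ← add_smul] at h3
    have h4 := h (h1.eigenvalues i + c) (Module.End.hasEigenvalue_of_hasEigenvector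
      (x := (h1.eigenvectorBasis i).ofLp) ⟨Module.End.mem_eigenspace_iff.2 (by
        rw [Matrix.toLin'_apply, h3]), fun h0 => h1.eigenvectorBasis.toBasis.ne_zero i (by
          ext j; simpa using congrFun h0 j)⟩)
    simpa using h4
  have h5 := h2.dotProduct_mulVec_nonneg b
  rw [Matrix.sub_mulVec, Matrix.smul_mulVec, Matrix.one_mulVec, dotProduct_sub, dotProduct_smul]
    at h5
  simp only [star_trivial, dotProduct, Matrix.mulVec, smul_eq_mul, Finset.mul_sum] at h5
  rw [Finset.mul_sum, ← sub_nonneg]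
  refine h5.trans (le_of_eq ?_)
  congr 1
  · exact Finset.sum_congr rfl fun i _ => Finset.sum_congr rfl fun j _ => by ring
  · exact Finset.sum_congr rfl fun i _ => by ring

section Orthonormalized

variable {Ω : Type*} [MeasurableSpace Ω] {E : Type*} {P : Measure Ω} {Z : Ω → E} {e : ℕ → E → ℝ}

theorem mul_sum_sq_le_integral (he : ∀ l, MemLp (fun ω => e l (Z ω)) 2 P) {c : ℝ}
    (h : ∀ (κ : ℕ) (μ : ℝ),
      Module.End.HasEigenvalue (Matrix.toLin' (secondMomentMatrix P Z e κ)) μ → c ≤ μ)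
    (κ : ℕ) (b : ℕ → ℝ) :
    c * ∑ i ∈ Finset.range κ, b i ^ 2 ≤ ∫ ω, (∑ i ∈ Finset.range κ, b i * e i (Z ω)) ^ 2 ∂P := by
  have h1 : (secondMomentMatrix P Z e κ).IsHermitian := by
    ext i j
    simp [secondMomentMatrix, mul_comm]
  have h2 := mul_sum_sq_le_of_eigenvalue_ge h1 (h κ) fun i => b i
  rw [Fin.sum_univ_eq_sum_range fun i => b i ^ 2] at h2
  refine h2.trans (le_of_eq ?_)
  have h3 : ∀ ω, (∑ i ∈ Finset.range κ, b i * e i (Z ω)) ^ 2 =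
      ∑ i : Fin κ, ∑ j : Fin κ, b i * b j * (e i (Z ω) * e j (Z ω)) := fun ω => by
    rw [← Fin.sum_univ_eq_sum_range fun i => b i * e i (Z ω), pow_two, Finset.sum_mul_sum]
    exact Finset.sum_congr rfl fun i _ => Finset.sum_congr rfl fun j _ => by ring
  have h4 : ∀ i j : ℕ, Integrable (fun ω => b i * b j * (e i (Z ω) * e j (Z ω))) P := fun i j =>
    ((he i).integrable_mul (he j)).const_mul _
  simp only [h3]
  rw [integral_finsetSum _ fun (i : Fin κ) _ => integrable_finsetSum _ fun (j : Fin κ) _ => h4 i j]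
  refine Finset.sum_congr rfl fun i _ => ?_
  rw [integral_finsetSum _ fun (j : Fin κ) _ => h4 i j]
  refine Finset.sum_congr rfl fun j _ => ?_
  rw [integral_const_mul]
  rfl

/-- A vanishing combination has zero second moment, which the lower bound turns into zero
coefficients. This is what makes the Gram–Schmidt vectors genuinely orthonormal, none of them being
zero. -/
theorem linearIndependent_toLp (he : ∀ l, MemLp (fun ω => e l (Z ω)) 2 P) {c : ℝ} (hc : 0 < c)
    (h : ∀ (κ : ℕ) (b : ℕ → ℝ), c * ∑ i ∈ Finset.range κ, b i ^ 2 ≤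
      ∫ ω, (∑ i ∈ Finset.range κ, b i * e i (Z ω)) ^ 2 ∂P) :
    LinearIndependent ℝ fun l => (he l).toLp (fun ω => e l (Z ω)) := by
  rw [linearIndependent_iff']
  intro s g hg i hi
  obtain ⟨κ, hκ⟩ : ∃ κ, s ⊆ Finset.range κ := s.exists_nat_subset_range
  let b : ℕ → ℝ := fun i => if i ∈ s then g i else 0
  have h1 : ∑ i ∈ Finset.range κ, b i • (he i).toLp (fun ω => e i (Z ω)) = 0 := by
    rw [← hg, ← Finset.sum_subset hκ fun i _ hi => by simp [b, hi]]
    exact Finset.sum_congr rfl fun i hi => by simp [b, hi]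
  have h2 := norm_sq_eq_integral_of_ae_eq (coeFn_sum_smul (Finset.range κ) b
    fun i _ => (he i).coeFn_toLp)
  rw [h1, norm_zero] at h2
  have h3 := h κ b
  rw [← h2] at h3
  have h4 : b i ^ 2 ≤ ∑ i ∈ Finset.range κ, b i ^ 2 :=
    Finset.single_le_sum (f := fun i => b i ^ 2) (fun _ _ => sq_nonneg _) (hκ hi)
  have h5 : b i = 0 := by
    by_contra h0
    have h6 : 0 < c * b i ^ 2 := by positivity
    nlinarith [mul_le_mul_of_nonneg_left h4 hc.le]
  simpa [b, hi] using h5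

/-- Measurable versions of the orthonormalized functions. -/
theorem exists_orthonormalized_eq [MeasurableSpace E] (hem : ∀ l, Measurable (e l))
    (he : ∀ l, MemLp (fun ω => e l (Z ω)) 2 P) {c : ℝ} (hc : 0 < c)
    (h : ∀ (κ : ℕ) (μ : ℝ),
      Module.End.HasEigenvalue (Matrix.toLin' (secondMomentMatrix P Z e κ)) μ → c ≤ μ) :
    Orthonormal ℝ (orthonormalized P Z e he) ∧ ∃ q : ℕ → E → ℝ, (∀ l, Measurable (q l)) ∧
      (∀ l, orthonormalized P Z e he l =ᵐ[P] fun ω => q l (Z ω)) ∧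
      (∀ l, ∃ C : ℕ → ℝ, ∀ z, q l z = ∑ i ∈ Finset.range (l + 1), C i * e i z) ∧
      (∀ l, ∃ C : ℕ → ℝ, (he l).toLp (fun ω => e l (Z ω)) =
        ∑ i ∈ Finset.range (l + 1), C i • orthonormalized P Z e he i) ∧
      ∀ κ z, ∑ l ∈ Finset.range κ, q l z ^ 2 ≤ c⁻¹ * ∑ l ∈ Finset.range κ, e l z ^ 2 := by
  have hb := mul_sum_sq_le_integral he h
  have hv : Orthonormal ℝ (orthonormalized P Z e he) :=
    InnerProductSpace.gramSchmidtNormed_orthonormal (linearIndependent_toLp he hc hb)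
  have hIic : ∀ l : ℕ, Set.Iic l = (Finset.range (l + 1) : Set ℕ) := fun l => by
    ext i; simp
  have h1 : ∀ l, ∃ C : ℕ → ℝ, orthonormalized P Z e he l =
      ∑ i ∈ Finset.range (l + 1), C i • (he i).toLp (fun ω => e i (Z ω)) := fun l => by
    have h2 := InnerProductSpace.gramSchmidt_mem_span ℝ
      (fun l => (he l).toLp (fun ω => e l (Z ω))) (le_refl l)
    have h3 : orthonormalized P Z e he l ∈
        Submodule.span ℝ ((fun l => (he l).toLp (fun ω => e l (Z ω))) '' Set.Iic l) :=
      Submodule.smul_mem _ _ h2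
    rw [hIic] at h3
    exact exists_sum_smul_of_mem_span_image h3
  choose C hC using h1
  let q : ℕ → E → ℝ := fun l z => ∑ i ∈ Finset.range (l + 1), C l i * e i z
  have hq : ∀ l, orthonormalized P Z e he l =ᵐ[P] fun ω => q l (Z ω) := fun l => by
    rw [hC]
    exact coeFn_sum_smul _ _ fun i _ => (he i).coeFn_toLp
  refine ⟨hv, q, fun l => Finset.measurable_sum _ fun i _ => (hem i).const_mul _, hq,
    fun l => ⟨C l, fun z => rfl⟩, fun l => ?_, fun κ z => ?_⟩
  · have h2 := InnerProductSpace.mem_span_gramSchmidt ℝ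
      (fun l => (he l).toLp (fun ω => e l (Z ω))) (le_refl l)
    rw [← InnerProductSpace.span_gramSchmidtNormed, hIic] at h2
    exact exists_sum_smul_of_mem_span_image h2
  -- The function `z' ↦ ∑ q l z * q l z'` has squared norm `s = ∑ q l z ^ 2` and takes the value `s`
  -- at `z`. With `b` its coefficients in the `e i`, `c * ∑ b i ^ 2 ≤ s`, while Cauchy–Schwarz at
  -- `z` gives `s ^ 2 ≤ (∑ b i ^ 2) * ∑ e i z ^ 2`; divide by `s` if it is not zero.
  · let a : ℕ → ℝ := fun l => q l z
    let b : ℕ → ℝ := fun i => ∑ l ∈ Finset.range κ, if i ≤ l then a l * C l i else 0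
    have h2 : ∀ z', ∑ l ∈ Finset.range κ, a l * q l z' = ∑ i ∈ Finset.range κ, b i * e i z' :=
        fun z' => by
      simp only [b, q, Finset.sum_mul, Finset.mul_sum]
      rw [Finset.sum_comm]
      refine Finset.sum_congr rfl fun l hl => ?_
      have h3 : Finset.range (l + 1) ⊆ Finset.range κ :=
        Finset.range_mono (Finset.mem_range.1 hl)
      rw [← Finset.sum_subset h3 fun i _ hi => by
        rw [if_neg (by simpa using hi), zero_mul]]
      exact Finset.sum_congr rfl fun i hi => by
        rw [if_pos (Nat.lt_succ_iff.1 (Finset.mem_range.1 hi))]; ring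
    have h3 := hb κ b
    simp only [← h2] at h3
    have h4 := norm_sq_eq_integral_of_ae_eq (coeFn_sum_smul (Finset.range κ) a fun i _ => hq i)
    have h5 := norm_sub_sum_smul_sq (s := Finset.range κ) (b := orthonormalized P Z e he)
      (r := fun _ => 1) (c := a) (x := ∑ l ∈ Finset.range κ, a l • orthonormalized P Z e he l)
      (fun i _ k _ hik => hv.2 hik) (fun i _ => by rw [hv.1 i, one_pow]) (fun i hi => by
        rw [one_mul, sum_inner, Finset.sum_eq_single i]
        · rw [real_inner_smul_left, real_inner_self_eq_norm_sq, hv.1 i]; ring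
        · intro j _ hj
          rw [real_inner_smul_left, hv.2 hj, mul_zero]
        · exact fun h => absurd hi h)
    rw [sub_self, norm_zero, h4] at h5
    simp only [one_mul] at h5
    set s := ∑ l ∈ Finset.range κ, a l ^ 2 with hs
    have h6 : s = ∑ i ∈ Finset.range κ, b i * e i z := by
      rw [← h2, hs]
      exact Finset.sum_congr rfl fun l _ => by simp only [a]; ring
    have h7 := Finset.sum_mul_sq_le_sq_mul_sq (Finset.range κ) b fun i => e i z
    rw [← h6] at h7
    have h8 : c * ∑ i ∈ Finset.range κ, b i ^ 2 ≤ s := by linarith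
    have h9 : 0 ≤ ∑ i ∈ Finset.range κ, e i z ^ 2 := Finset.sum_nonneg fun _ _ => sq_nonneg _
    have h10 : 0 ≤ s := Finset.sum_nonneg fun _ _ => sq_nonneg _
    change s ≤ _
    rw [← div_eq_inv_mul, le_div_iff₀ hc]
    rcases h10.eq_or_lt with h11 | h11
    · rw [← h11, zero_mul]; exact h9
    · nlinarith [mul_le_mul_of_nonneg_right h8 h9]

end Orthonormalized

end ExogeneityTest
end

noncomputable section
namespace ExogeneityTest

/-! ### Consequences of the assumptions -/

section Rates

theorem tendsto_sq_div_of_cube_isLittleO {k : ℕ → ℕ}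
    (hk : (fun n => (k n : ℝ) ^ 3) =o[atTop] fun n : ℕ => (n : ℝ)) :
    Tendsto (fun n => (k n : ℝ) ^ 2 / n) atTop (𝓝 0) := by
  refine squeeze_zero (fun n => by positivity) (fun n => ?_) hk.tendsto_div_nhds_zero
  refine div_le_div_of_nonneg_right ?_ (Nat.cast_nonneg n)
  rcases Nat.eq_zero_or_pos (k n) with h | h
  · simp [h]
  · exact_mod_cast Nat.pow_le_pow_right h (by norm_num : 2 ≤ 3)

/-- As long as `k n < b`, the value `w (k n)` is one of finitely many numbers and cannot keep up
with `n`. -/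
theorem tendsto_atTop_of_isBigO {w : ℕ → ℝ} {k : ℕ → ℕ}
    (hw : (fun n : ℕ => (n : ℝ)) =O[atTop] fun n => w (k n)) : Tendsto k atTop atTop := by
  obtain ⟨C, hC⟩ := hw.bound
  refine tendsto_atTop.2 fun b => ?_
  have h1 : ∀ᶠ n : ℕ in atTop, |C| * ∑ i ∈ Finset.range b, |w i| < n :=
    tendsto_natCast_atTop_atTop.eventually_gt_atTop _
  filter_upwards [hC, h1] with n hn hn1
  by_contra hlt
  have h2 : |w (k n)| ≤ ∑ i ∈ Finset.range b, |w i| :=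
    Finset.single_le_sum (f := fun i => |w i|) (fun _ _ => abs_nonneg _)
      (Finset.mem_range.2 (not_le.1 hlt))
  rw [Real.norm_natCast, Real.norm_eq_abs] at hn
  nlinarith [le_abs_self C, abs_nonneg C, abs_nonneg (w (k n)),
    mul_le_mul_of_nonneg_left h2 (abs_nonneg C),
    mul_le_mul_of_nonneg_right (le_abs_self C) (abs_nonneg (w (k n)))]

theorem summable_of_sum_range_isBigO {τ : ℕ → ℝ} (h0 : ∀ j, 0 ≤ τ j) {m : ℕ → ℕ}
    (hm : Tendsto m atTop atTop)
    (hτ : (fun n => ∑ j ∈ Finset.range (m n), τ j) =O[atTop] fun _ => (1 : ℝ)) : Summable τ := by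
  obtain ⟨C, hC⟩ := hτ.bound
  refine summable_of_sum_range_le (c := C) h0 fun N => ?_
  obtain ⟨n, hn, hN⟩ := (hC.and (hm.eventually_ge_atTop N)).exists
  rw [norm_one, mul_one] at hn
  exact (Finset.sum_le_sum_of_subset_of_nonneg (Finset.range_mono hN) fun j _ _ => h0 j).trans
    ((le_abs_self _).trans hn)

/-- Dominated convergence for series, with dominating sequence `‖x j‖ ^ 2`. The sum over all `j`
already tends to zero, so no relation between the growth of `m` and that of `k` is needed. -/
theorem tendsto_sum_norm_projection {H : Type*} [NormedAddCommGroup H] [InnerProductSpace ℝ H]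
    [CompleteSpace H] {v : ℕ → H} (hv : Orthonormal ℝ v) {x : ℕ → H}
    (hx : Summable fun j => ‖x j‖ ^ 2) {k : ℕ → ℕ} (hk : Tendsto k atTop atTop) (m : ℕ → ℕ) :
    Tendsto (fun n => ∑ j ∈ Finset.range (m n), ‖∑' l, inner ℝ (v l) (x j) • v l -
      ∑ l ∈ Finset.range (k n), inner ℝ (v l) (x j) • v l‖ ^ 2) atTop (𝓝 0) := by
  have h1 := tendsto_tsum_of_dominated_convergence (𝓕 := atTop)
    (f := fun n j => ‖∑' l, inner ℝ (v l) (x j) • v l -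
      ∑ l ∈ Finset.range (k n), inner ℝ (v l) (x j) • v l‖ ^ 2) (g := fun _ => (0 : ℝ)) hx
    (fun j => tendsto_norm_tsum_sub_sum_sq hv (x j) hk)
    (.of_forall fun n j => by
      rw [Real.norm_of_nonneg (by positivity)]
      exact norm_tsum_sub_sum_sq_le hv (x j) (k n))
  rw [tsum_zero] at h1
  refine squeeze_zero (fun n => Finset.sum_nonneg fun _ _ => by positivity) (fun n => ?_) h1
  refine Summable.sum_le_tsum _ (fun _ _ => by positivity) ?_
  exact Summable.of_nonneg_of_le (fun _ => by positivity)
    (fun j => norm_tsum_sub_sum_sq_le hv (x j) (k n)) hx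

end Rates

/-! ### Products of the error with functions of a conditioning variable -/

section ConditionalMoments

variable {Ω : Type*} [MeasurableSpace Ω] {P : Measure Ω} [IsProbabilityMeasure P]
  {B : Type*} [MeasurableSpace B] {V : Ω → B} {U : Ω → ℝ}

theorem integral_comp_mul_eq_zero (hV : Measurable V) (hU : Integrable U P)
    (h : P[U | MeasurableSpace.comap V inferInstance] =ᵐ[P] 0) {ψ : B → ℝ} (hψ : Measurable ψ)
    (hi : Integrable (fun ω => ψ (V ω) * U ω) P) : ∫ ω, ψ (V ω) * U ω ∂P = 0 := by
  have h1 : P[(fun ω => ψ (V ω)) * U | MeasurableSpace.comap V inferInstance] =ᵐ[P]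
      (fun ω => ψ (V ω)) * P[U | MeasurableSpace.comap V inferInstance] :=
    condExp_mul_of_stronglyMeasurable_left
      (hψ.comp (comap_measurable V)).stronglyMeasurable hi hU
  have h2 := integral_condExp (μ := P) hV.comap_le (f := (fun ω => ψ (V ω)) * U)
  have h3 : ∫ ω, ψ (V ω) * U ω ∂P = ∫ ω, ((fun ω => ψ (V ω)) * U) ω ∂P := rfl
  rw [h3, ← h2, ← integral_zero Ω ℝ (μ := P)]
  refine integral_congr_ae ?_
  filter_upwards [h1, h] with ω h4 h5
  rw [h4, Pi.mul_apply, h5, Pi.zero_apply, mul_zero]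

/-- The conditional bound is read as an inequality between measures. Integrating `ψ²` against both
sides then yields integrability of `(ψ(V) U)²` as a conclusion, where pulling `ψ` out of a
conditional expectation would presuppose it. -/
theorem map_withDensity_sq_le (hV : Measurable V) (hU : MemLp U 2 P) {C : ℝ} (hC : 0 ≤ C)
    (h : ∀ᵐ ω ∂P, (P[fun ω => U ω ^ 2 | MeasurableSpace.comap V inferInstance]) ω ≤ C) :
    (P.withDensity fun ω => ENNReal.ofReal (U ω ^ 2)).map V ≤ ENNReal.ofReal C • P.map V := by
  refine Measure.le_iff.2 fun s hs => ?_
  have hs' := hV hs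
  rw [Measure.smul_apply, Measure.map_apply hV hs, Measure.map_apply hV hs,
    withDensity_apply _ hs', smul_eq_mul,
    ← ofReal_integral_eq_lintegral_ofReal hU.integrable_sq.integrableOn
      (.of_forall fun _ => sq_nonneg _),
    ← setIntegral_condExp hV.comap_le hU.integrable_sq ⟨s, hs, rfl⟩,
    ← ENNReal.ofReal_toReal (measure_ne_top P (V ⁻¹' s)), ← ENNReal.ofReal_mul hC]
  refine ENNReal.ofReal_le_ofReal ?_
  refine (setIntegral_mono_ae integrable_condExp.integrableOn (integrable_const C).integrableOn
    h).trans ?_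
  rw [setIntegral_const, smul_eq_mul, mul_comm]
  rfl

theorem memLp_comp_mul_of_condExp_sq_le (hV : Measurable V) (hUm : Measurable U) (hU : MemLp U 2 P)
    {C : ℝ} (hC : 0 ≤ C)
    (h : ∀ᵐ ω ∂P, (P[fun ω => U ω ^ 2 | MeasurableSpace.comap V inferInstance]) ω ≤ C)
    {ψ : B → ℝ} (hψ : Measurable ψ) (hψ2 : MemLp (fun ω => ψ (V ω)) 2 P) :
    MemLp (fun ω => ψ (V ω) * U ω) 2 P ∧
      ∫ ω, (ψ (V ω) * U ω) ^ 2 ∂P ≤ C * ∫ ω, ψ (V ω) ^ 2 ∂P := by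
  have h1 : ∫⁻ ω, ENNReal.ofReal ((ψ (V ω) * U ω) ^ 2) ∂P ≤
      ENNReal.ofReal (C * ∫ ω, ψ (V ω) ^ 2 ∂P) := by
    have hm : Measurable fun x => ENNReal.ofReal (ψ x ^ 2) := (hψ.pow_const 2).ennreal_ofReal
    have hmV : Measurable fun ω => ENNReal.ofReal (ψ (V ω) ^ 2) := hm.comp hV
    have h2 := lintegral_mono' (map_withDensity_sq_le hV hU hC h)
      (le_refl fun x => ENNReal.ofReal (ψ x ^ 2))
    rw [lintegral_map hm hV, lintegral_withDensity_eq_lintegral_mul _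
      (hUm.pow_const 2).ennreal_ofReal hmV, lintegral_smul_measure,
      lintegral_map hm hV, smul_eq_mul, ← ofReal_integral_eq_lintegral_ofReal hψ2.integrable_sq
      (.of_forall fun _ => sq_nonneg _), ← ENNReal.ofReal_mul hC] at h2
    refine le_trans (le_of_eq ?_) h2
    refine lintegral_congr fun ω => ?_
    rw [Pi.mul_apply, ← ENNReal.ofReal_mul (sq_nonneg _), mul_pow, mul_comm]
  have h3 : AEStronglyMeasurable (fun ω => ψ (V ω) * U ω) P :=
    ((hψ.comp hV).mul hUm).aestronglyMeasurable
  have h4 : Integrable (fun ω => (ψ (V ω) * U ω) ^ 2) P := by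
    refine ⟨h3.pow 2, ?_⟩
    rw [hasFiniteIntegral_iff_ofReal (.of_forall fun _ => sq_nonneg _)]
    exact h1.trans_lt ENNReal.ofReal_lt_top
  refine ⟨(memLp_two_iff_integrable_sq h3).2 h4, ?_⟩
  rw [← ofReal_integral_eq_lintegral_ofReal h4 (.of_forall fun _ => sq_nonneg _)] at h1
  exact (ENNReal.ofReal_le_ofReal_iff
    (mul_nonneg hC (integral_nonneg fun _ => sq_nonneg _))).1 h1

end ConditionalMoments

/-! ### Consequences of the model for the laws of `Z` and `W` -/

section Model

variable {Ω : Type*} [MeasurableSpace Ω] {P : Measure Ω}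

/-- Under exogeneity the error term has conditional mean zero given `Z`. -/
theorem condExp_errorTerm_eq_zero [IsProbabilityMeasure P] {E F : Type*} [MeasurableSpace E] [MeasurableSpace F]
    {Y : Ω → ℝ} {Z : Ω → E} {W : Ω → F} {φ φ₀ : E → ℝ} (hmodel : IsIVModel P Y Z W φ)
    (hφ₀ : IsRegressionFunction P Y Z φ₀) (hexo : Exogenous P Z φ φ₀) :
    P[errorTerm Y Z φ | MeasurableSpace.comap Z inferInstance] =ᵐ[P] 0 := by
  have h1 : Integrable (fun ω => φ (Z ω)) P := hmodel.memLp_phi.integrable (by norm_num)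
  have h2 : Integrable Y P := by
    have h3 := (hmodel.memLp_error.integrable (by norm_num)).add h1
    refine h3.congr (.of_forall fun ω => ?_)
    simp [errorTerm]
  have h4 := condExp_sub h2 h1 (MeasurableSpace.comap Z inferInstance)
  have h5 : P[fun ω => φ (Z ω) | MeasurableSpace.comap Z inferInstance] = fun ω => φ (Z ω) :=
    condExp_of_stronglyMeasurable hmodel.measurable_Z.comap_le
      (hmodel.measurable_phi.comp (comap_measurable Z)).stronglyMeasurable h1
  have h6 : errorTerm Y Z φ = Y - fun ω => φ (Z ω) := rfl
  rw [h6]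
  filter_upwards [h4, hφ₀.2, hexo] with ω h7 h8 h9
  rw [h7, Pi.sub_apply, ← h8, h5]
  exact sub_eq_zero.2 h9.symm

/-- The law of `W` is carried by its support, where `ν` is positive and the ratio bound can be
multiplied out. Moments under the law of `W` are thereby controlled by moments under `ν`. -/
theorem map_le_smul_weightMeasure [IsProbabilityMeasure P] {d : ℕ} {W : Ω → EuclideanSpace ℝ (Fin d)}
    {p ν : EuclideanSpace ℝ (Fin d) → ℝ} (hp : IsDensityOf P W p) (hν : IsWeightDensity P W ν)
    {η : ℝ} (hη : 0 ≤ η) (h : ∀ x ∈ (P.map W).support, p x / ν x ≤ η) :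
    P.map W ≤ ENNReal.ofReal η • weightMeasure ν := by
  have hS : MeasurableSet (P.map W).support := Measure.isClosed_support.measurableSet
  have hd : ∀ A, MeasurableSet A → P.map W A = ∫⁻ x in A, ENNReal.ofReal (p x) := fun A hA => by
    rw [hp.2.2, withDensity_apply _ hA]
  refine Measure.le_iff.2 fun s hs => ?_
  have h1 : P.map W s = P.map W (s ∩ (P.map W).support) :=
    measure_congr (by
      filter_upwards [Measure.support_mem_ae (μ := P.map W)] with x hx
      exact propext ⟨fun h => ⟨h, hx⟩, fun h => h.1⟩)
  rw [h1, hd _ (hs.inter hS), Measure.smul_apply, smul_eq_mul,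
    weightMeasure, withDensity_apply _ hs,
    ← lintegral_const_mul _ hν.measurable.ennreal_ofReal]
  refine (setLIntegral_mono' (hs.inter hS) fun x hx => ?_).trans
    (lintegral_mono_set Set.inter_subset_left)
  rw [← ENNReal.ofReal_mul hη]
  exact ENNReal.ofReal_le_ofReal ((div_le_iff₀ (hν.pos x hx.2)).1 (h x hx.2))

theorem integrable_fourth_moment [IsProbabilityMeasure P] {d : ℕ} {W : Ω → EuclideanSpace ℝ (Fin d)} (hW : Measurable W)
    {p ν : EuclideanSpace ℝ (Fin d) → ℝ} (hp : IsDensityOf P W p) (hν : IsWeightDensity P W ν)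
    {f : ℕ → EuclideanSpace ℝ (Fin d) → ℝ} (hf : ∀ l, Measurable (f l))
    (hA1 : AssumptionA1 P W p ν f) :
    ∃ K : ℝ, 0 ≤ K ∧ ∀ l, Integrable (fun ω => f l (W ω) ^ 4) P ∧ ∫ ω, f l (W ω) ^ 4 ∂P ≤ K := by
  obtain ⟨ηf, ηp, h1, h2, h3, h4⟩ := hA1
  have hle := map_le_smul_weightMeasure hp hν (by linarith) h4
  refine ⟨ηp * ηf, by positivity, fun l => ?_⟩
  have h5 : ∀ s, |f l s| ^ 4 = f l s ^ 4 := fun s => by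
    rw [← abs_pow, abs_of_nonneg (by positivity)]
  have h6 := h3 l
  simp only [h5] at h6
  have h7 : Integrable (fun s => f l s ^ 4) (ENNReal.ofReal ηp • weightMeasure ν) :=
    h6.1.smul_measure ENNReal.ofReal_ne_top
  have h8 := h7.mono_measure hle
  have hm : AEStronglyMeasurable (fun s => f l s ^ 4) (P.map W) :=
    ((hf l).pow_const 4).aestronglyMeasurable
  refine ⟨(integrable_map_measure hm hW.aemeasurable).1 h8, ?_⟩
  have h9 : ∫ ω, f l (W ω) ^ 4 ∂P = ∫ s, f l s ^ 4 ∂(P.map W) :=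
    (integral_map hW.aemeasurable hm).symm
  rw [h9]
  refine (integral_mono_measure hle (.of_forall fun s => by positivity) h7).trans ?_
  rw [integral_smul_measure, ENNReal.toReal_ofReal (by linarith), smul_eq_mul]
  exact mul_le_mul_of_nonneg_left h6.2 (by linarith)

/-- The partial sums are functions of `Z`, and the classes measurable with respect to `Z` form a
closed subspace of `L²`. The limit therefore factors through `Z`. -/
theorem exists_measurable_seriesProjection {E : Type*} [MeasurableSpace E] {Z : Ω → E}
    (hZ : Measurable Z) {e : ℕ → E → ℝ} (he : ∀ l, MemLp (fun ω => e l (Z ω)) 2 P)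
    (hv : Orthonormal ℝ (orthonormalized P Z e he)) {q : ℕ → E → ℝ} (hqm : ∀ l, Measurable (q l))
    (hq : ∀ l, orthonormalized P Z e he l =ᵐ[P] fun ω => q l (Z ω)) (x : Lp ℝ 2 P) :
    ∃ h : E → ℝ, Measurable h ∧ (∑' l, inner ℝ (orthonormalized P Z e he l) x •
      orthonormalized P Z e he l : Lp ℝ 2 P) =ᵐ[P] fun ω => h (Z ω) := by
  have h1 := isClosed_aestronglyMeasurable (F := ℝ) (p := 2) (μ := P) hZ.comap_le
  have h2 := h1.mem_of_tendsto (summable_inner_smul_of_orthonormal hv x).hasSum.tendsto_sum_nat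
    (.of_forall fun N => by
      have h3 := coeFn_sum_smul (Finset.range N)
        (fun l => inner ℝ (orthonormalized P Z e he l) x) fun l _ => hq l
      refine AEStronglyMeasurable.congr (Measurable.aestronglyMeasurable ?_) h3.symm
      exact Finset.measurable_sum _ fun l _ =>
        ((hqm l).comp (comap_measurable Z)).const_mul _)
  obtain ⟨g, hg, hxg⟩ := h2
  obtain ⟨h, hh, hgh⟩ := hg.exists_eq_measurable_comp
  refine ⟨h, hh.measurable, hxg.trans (.of_forall fun ω => ?_)⟩
  rw [hgh]
  rfl

end Model

end ExogeneityTest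
end

noncomputable section
namespace ExogeneityTest

/-! ### Fourth moments, approximation rates and passage to the sample -/

section FourthMoments

variable {Ω : Type*} [MeasurableSpace Ω] {P : Measure Ω} {g U : Ω → ℝ}

theorem memLp_two_of_integrable_pow_four [IsProbabilityMeasure P] (hg : AEStronglyMeasurable g P)
    (h4 : Integrable (fun ω => g ω ^ 4) P) :
    MemLp g 2 P ∧ ∫ ω, g ω ^ 2 ∂P ≤ 1 + ∫ ω, g ω ^ 4 ∂P := by
  have h1 : Integrable (fun ω => 1 + g ω ^ 4) P := (integrable_const 1).add h4
  have h2 : ∀ ω, g ω ^ 2 ≤ 1 + g ω ^ 4 := fun ω => by nlinarith [sq_nonneg (g ω ^ 2 - 1)]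
  have h3 : Integrable (fun ω => g ω ^ 2) P := h1.mono' (hg.pow 2) (.of_forall fun ω => by
    rw [Real.norm_of_nonneg (sq_nonneg _)]; exact h2 ω)
  refine ⟨(memLp_two_iff_integrable_sq hg).2 h3, (integral_mono h3 h1 h2).trans ?_⟩
  rw [integral_add (integrable_const 1) h4]
  simp

theorem memLp_mul_of_integrable_pow_four (hg : AEStronglyMeasurable g P)
    (hU : AEStronglyMeasurable U P) (hg4 : Integrable (fun ω => g ω ^ 4) P)
    (hU4 : Integrable (fun ω => U ω ^ 4) P) :
    MemLp (fun ω => g ω * U ω) 2 P ∧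
      ∫ ω, (g ω * U ω) ^ 2 ∂P ≤ ∫ ω, g ω ^ 4 ∂P + ∫ ω, U ω ^ 4 ∂P := by
  have h2 : ∀ ω, (g ω * U ω) ^ 2 ≤ g ω ^ 4 + U ω ^ 4 := fun ω => by
    nlinarith [sq_nonneg (g ω ^ 2 - U ω ^ 2), sq_nonneg (g ω ^ 2), sq_nonneg (U ω ^ 2)]
  have h3 : Integrable (fun ω => (g ω * U ω) ^ 2) P :=
    (hg4.add hU4).mono' ((hg.mul hU).pow 2) (.of_forall fun ω => by
      rw [Real.norm_of_nonneg (sq_nonneg _)]; exact h2 ω)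
  refine ⟨(memLp_two_iff_integrable_sq (hg.mul hU)).2 h3,
    (integral_mono h3 (hg4.add hU4) h2).trans (le_of_eq (integral_add hg4 hU4))⟩

end FourthMoments

/-- The hypothesis `n = O(w (k n))` turns the error `1 / w (k n)` into `1 / n`. Normalization and
monotonicity give `w (k n) ≥ 1` as soon as `k n ≥ 1`, which makes the inverse harmless. -/
theorem InApproximationClass.exists_sq_le {Ω E : Type*} [MeasurableSpace Ω] [MeasurableSpace E]
    [TopologicalSpace E] {P : Measure Ω} {Z : Ω → E} {e : ℕ → E → ℝ} {w : ℕ → ℝ} {k : ℕ → ℕ}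
    {φ₀ : E → ℝ} (h : InApproximationClass P Z e w k φ₀) (hw1 : w 1 = 1)
    (hwm : ∀ i j, 1 ≤ i → i ≤ j → w i ≤ w j)
    (hw : (fun n : ℕ => (n : ℝ)) =O[atTop] fun n => w (k n)) :
    ∃ β : ∀ n, Fin (k n) → ℝ, ∃ C : ℝ, 0 ≤ C ∧ ∀ᶠ n : ℕ in atTop, ∀ z ∈ (P.map Z).support,
      (φ₀ z - ∑ l : Fin (k n), e l z * β n l) ^ 2 ≤ C / n := by
  obtain ⟨-, β, C, hC⟩ := h
  obtain ⟨D, hD⟩ := hw.bound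
  refine ⟨β, |C| * |D|, by positivity, ?_⟩
  filter_upwards [hC, hD, (tendsto_atTop_of_isBigO hw).eventually_ge_atTop 1,
    eventually_ge_atTop 1] with n h1 h2 h3 h4 z hz
  have h5 : 1 ≤ w (k n) := hw1 ▸ hwm 1 (k n) le_rfl h3
  have h6 : (1 : ℝ) ≤ n := by exact_mod_cast h4
  have h7 := h1 z hz
  rw [sq_abs] at h7
  rw [Real.norm_natCast, Real.norm_of_nonneg (by linarith)] at h2
  have h8 : (w (k n))⁻¹ ≤ |D| / n := by
    rw [le_div_iff₀ (by linarith), inv_mul_le_iff₀ (by linarith), mul_comm]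
    exact h2.trans (mul_le_mul_of_nonneg_right (le_abs_self D) (by linarith))
  calc _ ≤ C * (w (k n))⁻¹ := h7
    _ ≤ |C| * (w (k n))⁻¹ := mul_le_mul_of_nonneg_right (le_abs_self C) (by positivity)
    _ ≤ |C| * (|D| / n) := mul_le_mul_of_nonneg_left h8 (abs_nonneg C)
    _ = _ := by ring

/-- An exchange of the order of summation. The coefficients `θ` depend on `C` and `b` alone, so the
same ones serve at every sample point. -/
theorem exists_sum_mul_eq_of_triangular (C : ℕ → ℕ → ℝ) {κ : ℕ} (b : Fin κ → ℝ) :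
    ∃ θ : ℕ → ℝ, ∀ x y : ℕ → ℝ, (∀ l, x l = ∑ i ∈ Finset.range (l + 1), C l i * y i) →
      ∑ l : Fin κ, x l * b l = ∑ i ∈ Finset.range κ, θ i * y i := by
  refine ⟨fun i => ∑ l : Fin κ, if i ≤ l then C l i * b l else 0, fun x y hx => ?_⟩
  simp only [Finset.sum_mul]
  rw [Finset.sum_comm]
  refine Finset.sum_congr rfl fun l _ => ?_
  have h3 : Finset.range (l + 1) ⊆ Finset.range κ := Finset.range_mono l.2
  rw [hx, Finset.sum_mul, ← Finset.sum_subset h3 fun i _ hi => by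
    rw [if_neg (by simpa using hi), zero_mul]]
  exact Finset.sum_congr rfl fun i hi => by
    rw [if_pos (Nat.lt_succ_iff.1 (Finset.mem_range.1 hi))]; ring

section Sample

variable {Ω : Type*} [MeasurableSpace Ω] {P : Measure Ω} {E F : Type*} [MeasurableSpace E]
  [MeasurableSpace F] {Y : Ω → ℝ} {Z : Ω → E} {W : Ω → F} {Ys : ℕ → Ω → ℝ} {Zs : ℕ → Ω → E}
  {Ws : ℕ → Ω → F}

theorem IsIIDSample.isIID (h : IsIIDSample P Y Z W Ys Zs Ws) :
    IsIID P (fun i ω => (Ys i ω, Zs i ω, Ws i ω)) (P.map fun ω => (Y ω, Z ω, W ω)) where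
  measurable i := (h.measurable_Y i).prodMk ((h.measurable_Z i).prodMk (h.measurable_W i))
  indep := h.indep
  law i := (h.identDistrib i).map_eq

end Sample

/-- The residuals of the series regression satisfy the normal equations for any functions that are
triangular linear combinations of the regressors. -/
theorem sum_residual_mul_triangular_eq_zero {E : Type*} {e q : ℕ → E → ℝ} {D : ℕ → ℕ → ℝ}
    (hq : ∀ l z, q l z = ∑ i ∈ Finset.range (l + 1), D l i * e i z) {n k : ℕ}
    {G : Matrix (Fin k) (Fin k) ℝ} {y : ℕ → ℝ} {z : ℕ → E}
    (h : IsGeneralizedInverse (designGram e n k z) G) {l : ℕ} (hl : l < k) :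
    ∑ i ∈ Finset.range n, (y i - seriesEstimator e n k G y z (z i)) * q l (z i) = 0 := by
  simp only [hq, Finset.mul_sum]
  rw [Finset.sum_comm]
  refine Finset.sum_eq_zero fun l' hl' => ?_
  have h1 := sum_residual_mul_eq_zero e (y := y) h
    ⟨l', (Finset.mem_range.1 hl').trans_le hl⟩
  have h2 : ∀ i, (y i - seriesEstimator e n k G y z (z i)) * (D l l' * e l' (z i)) =
      D l l' * ((y i - seriesEstimator e n k G y z (z i)) * e l' (z i)) := fun i => by ring
  simp only [h2]
  rw [← Finset.mul_sum, h1, mul_zero]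

end ExogeneityTest
end

noncomputable section
namespace ExogeneityTest

/-! ### Residuals of the series regression -/

section Regression

variable {Ω : Type*} [MeasurableSpace Ω] {P : Measure Ω} [IsProbabilityMeasure P]
  {E F : Type*} [MeasurableSpace E] [MeasurableSpace F]

/-- Replacing the errors by the residuals of a series regression amounts to replacing the functions
`F_j(W)` by their distance to the projection `h_j(Z)` on the span of the regressors. -/
theorem IsIID.tendstoInMeasure_series_residual_sub {Y : Ω → ℝ} {Z : Ω → E} {W : Ω → F}
    {X : ℕ → Ω → ℝ × E × F} (hX : IsIID P X (P.map fun ω => (Y ω, Z ω, W ω)))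
    (hYm : Measurable Y) (hZm : Measurable Z) (hWm : Measurable W)
    {φ : E → ℝ} (hφm : Measurable φ) {f : ℕ → F → ℝ} (hfm : ∀ j, Measurable (f j))
    (hfL : ∀ j, MemLp (fun ω => f j (W ω)) 2 P)
    (hfs : Summable fun j => ∫ ω, f j (W ω) ^ 2 ∂P)
    {Cv Cq Ca : ℝ} (hCq0 : 0 ≤ Cq) (hCa0 : 0 ≤ Ca)
    (hψU : ∀ ψ : E → ℝ, Measurable ψ → MemLp (fun ω => ψ (Z ω)) 2 P →
      MemLp (fun ω => ψ (Z ω) * errorTerm Y Z φ ω) 2 P ∧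
      ∫ ω, (ψ (Z ω) * errorTerm Y Z φ ω) ^ 2 ∂P ≤ Cv * ∫ ω, ψ (Z ω) ^ 2 ∂P ∧
      ∫ ω, ψ (Z ω) * errorTerm Y Z φ ω ∂P = 0)
    {v : ℕ → Lp ℝ 2 P} (hv : Orthonormal ℝ v) {q : ℕ → E → ℝ} (hqm : ∀ l, Measurable (q l))
    (hq : ∀ l, v l =ᵐ[P] fun ω => q l (Z ω)) {k m : ℕ → ℕ} (hk : Tendsto k atTop atTop)
    (hk2 : Tendsto (fun n => (k n : ℝ) ^ 2 / n) atTop (𝓝 0))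
    (hqb : ∀ᶠ n in atTop, ∀ᵐ ω ∂P, ∑ l ∈ Finset.range (k n), q l (Z ω) ^ 2 ≤ Cq * k n)
    {h : ℕ → E → ℝ} (hhm : ∀ j, Measurable (h j))
    (hh : ∀ j, (∑' l, inner ℝ (v l) ((hfL j).toLp _) • v l : Lp ℝ 2 P) =ᵐ[P] fun ω => h j (Z ω))
    (hgL : ∀ j, MemLp (fun ω => errorTerm Y Z φ ω * (f j (W ω) - h j (Z ω))) 2 P)
    (hg0 : ∀ j, ∫ ω, errorTerm Y Z φ ω * (f j (W ω) - h j (Z ω)) ∂P = 0)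
    (hgs : Summable fun j => ∫ ω, (errorTerm Y Z φ ω * (f j (W ω) - h j (Z ω))) ^ 2 ∂P)
    {a : ℕ → E → ℝ} (ham : ∀ n, Measurable (a n)) (haL : ∀ n, MemLp (fun ω => a n (Z ω)) 2 P)
    (hab : ∀ᶠ n : ℕ in atTop, ∀ᵐ ω ∂P, a n (Z ω) ^ 2 ≤ Ca / n)
    (hfa : ∀ n j, ∫ ω, (f j (W ω) - h j (Z ω)) * a n (Z ω) ∂P = 0)
    {r : ℕ → ℕ → Ω → ℝ}
    (hr : ∀ᶠ n in atTop, ∀ᵐ ω ∂P, ∃ θ : ℕ → ℝ, (∀ i ∈ Finset.range n, r n i ω =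
        (X i ω).1 - φ (X i ω).2.1 + a n (X i ω).2.1 -
          ∑ l ∈ Finset.range (k n), θ l * q l (X i ω).2.1) ∧
      ∀ l ∈ Finset.range (k n), ∑ i ∈ Finset.range n, r n i ω * q l (X i ω).2.1 = 0) :
    TendstoInMeasure P (fun n ω => ∑ j ∈ Finset.range (m n),
        ((√(n : ℝ))⁻¹ * ∑ i ∈ Finset.range n, r n i ω * f j (X i ω).2.2) ^ 2 -
      ∑ j ∈ Finset.range (m n),
        normSum X n (fun x => (x.1 - φ x.2.1) * (f j x.2.2 - h j x.2.1)) ω ^ 2) atTop 0 := by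
  set T : Ω → ℝ × E × F := fun ω => (Y ω, Z ω, W ω) with hT
  have hTm : Measurable T := hYm.prodMk (hZm.prodMk hWm)
  have tr : ∀ g : ℝ × E × F → ℝ, Measurable g → ∫ x, g x ∂(P.map T) = ∫ ω, g (T ω) ∂P :=
    fun g hg => integral_map hTm.aemeasurable hg.aestronglyMeasurable
  have trL : ∀ g : ℝ × E × F → ℝ, Measurable g → MemLp (fun ω => g (T ω)) 2 P →
      MemLp g 2 (P.map T) := fun g hg h =>
    (memLp_map_measure_iff hg.aestronglyMeasurable hTm.aemeasurable).2 h
  have tra : ∀ g : ℝ × E × F → ℝ, Measurable g → ∀ C, (∀ᵐ ω ∂P, g (T ω) ≤ C) →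
      ∀ᵐ x ∂(P.map T), g x ≤ C := fun g hg C h =>
    (ae_map_iff hTm.aemeasurable (measurableSet_le hg measurable_const)).2 h
  have hum : Measurable fun x : ℝ × E × F => x.1 - φ x.2.1 := by fun_prop
  have hqZm : ∀ l, Measurable fun x : ℝ × E × F => q l x.2.1 := fun l =>
    (hqm l).comp (measurable_fst.comp measurable_snd)
  have hhZm : ∀ j, Measurable fun x : ℝ × E × F => h j x.2.1 := fun j =>
    (hhm j).comp (measurable_fst.comp measurable_snd)
  have haZm : ∀ n, Measurable fun x : ℝ × E × F => a n x.2.1 := fun n =>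
    (ham n).comp (measurable_fst.comp measurable_snd)
  have hfWm : ∀ j, Measurable fun x : ℝ × E × F => f j x.2.2 := fun j =>
    (hfm j).comp (measurable_snd.comp measurable_snd)
  have hqL : ∀ l, MemLp (fun ω => q l (Z ω)) 2 P := fun l => (Lp.memLp _).ae_eq (hq l)
  have hqo : ∀ l l', ∫ ω, q l (Z ω) * q l' (Z ω) ∂P = if l = l' then 1 else 0 := fun l l' => by
    rw [← inner_eq_integral_of_ae_eq (hq l) (hq l')]
    exact orthonormal_iff_ite.1 hv l l'
  have hhL : ∀ j, MemLp (fun ω => h j (Z ω)) 2 P := fun j => (Lp.memLp _).ae_eq (hh j)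
  have hfq : ∀ j l, inner ℝ (v l) ((hfL j).toLp _) = ∫ ω, f j (W ω) * q l (Z ω) ∂P :=
    fun j l => by
      rw [real_inner_comm, inner_eq_integral_of_ae_eq (hfL j).coeFn_toLp (hq l)]
  have hhq : ∀ j l, ∫ ω, h j (Z ω) * q l (Z ω) ∂P = ∫ ω, f j (W ω) * q l (Z ω) ∂P := fun j l => by
    rw [← hfq, ← inner_tsum_inner_smul_of_orthonormal hv, real_inner_comm,
      inner_eq_integral_of_ae_eq (hh j) (hq l)]
  -- the projections on the span of finitely many functions
  let p : ℕ → ℕ → E → ℝ := fun n j z =>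
    ∑ l ∈ Finset.range (k n), (∫ ω, f j (W ω) * q l (Z ω) ∂P) * q l z
  have hpm : ∀ n j, Measurable (p n j) := fun n j =>
    Finset.measurable_sum _ fun l _ => (hqm l).const_mul _
  have hpL : ∀ n j, MemLp (fun ω => p n j (Z ω)) 2 P := fun n j =>
    memLp_finsetSum _ fun l _ => (hqL l).const_mul _
  have hhp : ∀ n j, ∫ ω, (h j (Z ω) - p n j (Z ω)) ^ 2 ∂P =
      ‖∑' l, inner ℝ (v l) ((hfL j).toLp _) • v l -
        ∑ l ∈ Finset.range (k n), inner ℝ (v l) ((hfL j).toLp _) • v l‖ ^ 2 := fun n j => by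
    refine (norm_sq_eq_integral_of_ae_eq ?_).symm
    filter_upwards [Lp.coeFn_sub (∑' l, inner ℝ (v l) ((hfL j).toLp _) • v l)
      (∑ l ∈ Finset.range (k n), inner ℝ (v l) ((hfL j).toLp _) • v l), hh j,
      coeFn_sum_smul (Finset.range (k n)) (fun l => inner ℝ (v l) ((hfL j).toLp _))
        fun l _ => hq l] with ω h1 h2 h3
    rw [h1, Pi.sub_apply, h2, h3]
    simp only [p, hfq]
  have hhpL : ∀ n j, MemLp (fun ω => h j (Z ω) - p n j (Z ω)) 2 P := fun n j =>
    (hhL j).sub (hpL n j)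
  -- the approximation error of the regression function
  let ρ : ℕ → E → ℝ := fun n z =>
    a n z - ∑ l ∈ Finset.range (k n), (∫ ω, a n (Z ω) * q l (Z ω) ∂P) * q l z
  have hρm : ∀ n, Measurable (ρ n) := fun n =>
    (ham n).sub (Finset.measurable_sum _ fun l _ => (hqm l).const_mul _)
  have hρL : ∀ n, MemLp (fun ω => ρ n (Z ω)) 2 P := fun n =>
    (haL n).sub (memLp_finsetSum _ fun l _ => (hqL l).const_mul _)
  have ha2 : ∀ᶠ n : ℕ in atTop, ∫ ω, a n (Z ω) ^ 2 ∂P ≤ Ca / n := by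
    filter_upwards [hab] with n hn
    refine (integral_mono_ae (haL n).integrable_sq (integrable_const _) hn).trans ?_
    simp
  have hρ2 : ∀ n, ∫ ω, ρ n (Z ω) ^ 2 ∂P ≤ ∫ ω, a n (Z ω) ^ 2 ∂P := fun n =>
    integral_sub_sum_sq_le (haL n) hqL hqo (k n)
  have hρq : ∀ n, ∀ l ∈ Finset.range (k n), ∫ ω, ρ n (Z ω) * q l (Z ω) ∂P = 0 := fun n l hl =>
    integral_sub_sum_mul_eq_zero (haL n) hqL hqo hl
  have hbessel : ∀ n, ∑ l ∈ Finset.range (k n), (∫ ω, a n (Z ω) * q l (Z ω) ∂P) ^ 2 ≤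
      ∫ ω, a n (Z ω) ^ 2 ∂P := fun n => by
    have h1 := hv.sum_inner_products_le ((haL n).toLp _) (s := Finset.range (k n))
    rw [norm_toLp_sq] at h1
    refine le_trans (Finset.sum_le_sum fun l _ => ?_) h1
    rw [real_inner_comm, inner_eq_integral_of_ae_eq (haL n).coeFn_toLp (hq l), Real.norm_eq_abs,
      sq_abs]
  -- The sup bound on `a n` is spoiled by the subtracted projection, but only by a factor `k n`: its
  -- coefficients have square sum `O(1 / n)` by Bessel, and `∑ q l ^ 2` is `O(k n)`.
  have hρb : ∀ᶠ n : ℕ in atTop, ∀ᵐ ω ∂P, ρ n (Z ω) ^ 2 ≤ (2 * Ca + 2 * Ca * Cq) * (k n / n) := by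
    filter_upwards [hab, ha2, hqb, hk.eventually_ge_atTop 1, eventually_ge_atTop 1] with n h1 h2 h3
      h4 h5
    filter_upwards [h1, h3] with ω h6 h7
    have h8 := Finset.sum_mul_sq_le_sq_mul_sq (Finset.range (k n))
      (fun l => ∫ ω, a n (Z ω) * q l (Z ω) ∂P) fun l => q l (Z ω)
    have h9 := (hbessel n).trans h2
    have h10 : (0 : ℝ) < n := by exact_mod_cast h5
    have h11 : (1 : ℝ) ≤ k n := by exact_mod_cast h4
    have h12 : (∑ l ∈ Finset.range (k n), (∫ ω, a n (Z ω) * q l (Z ω) ∂P) * q l (Z ω)) ^ 2 ≤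
        Ca / n * (Cq * k n) :=
      h8.trans (mul_le_mul h9 h7 (Finset.sum_nonneg fun _ _ => sq_nonneg _) (by positivity))
    have h13 : Ca / n ≤ Ca * (k n / n) := by
      rw [mul_div_assoc']
      exact div_le_div_of_nonneg_right (le_mul_of_one_le_right hCa0 h11) h10.le
    have h14 : Ca / n * (Cq * k n) = Ca * Cq * (k n / n) := by ring
    simp only [ρ]
    nlinarith [sq_nonneg (a n (Z ω) +
      ∑ l ∈ Finset.range (k n), (∫ ω, a n (Z ω) * q l (Z ω) ∂P) * q l (Z ω))]
  -- The decisive point for the bias: `f j - h j` is orthogonal to `a n` and to all `q l`, hence to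
  -- `ρ n`. So `f j` may be replaced by `h j`, and the bias gains the vanishing factor `‖h j - p n
  -- j‖`.
  have hhρ : ∀ n j, ∫ ω, (f j (W ω) - p n j (Z ω)) * ρ n (Z ω) ∂P =
      ∫ ω, (h j (Z ω) - p n j (Z ω)) * ρ n (Z ω) ∂P := fun n j => by
    have h1 : ∫ ω, (f j (W ω) - h j (Z ω)) * ρ n (Z ω) ∂P = 0 := by
      have h2 : ∀ ω, (f j (W ω) - h j (Z ω)) * ρ n (Z ω) = (f j (W ω) - h j (Z ω)) * a n (Z ω) -
          ∑ l ∈ Finset.range (k n), (∫ ω, a n (Z ω) * q l (Z ω) ∂P) *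
            (f j (W ω) * q l (Z ω) - h j (Z ω) * q l (Z ω)) := fun ω => by
        simp only [ρ]
        rw [mul_sub, Finset.mul_sum]
        congr 1
        exact Finset.sum_congr rfl fun l _ => by ring
      have h3 : ∀ l, Integrable (fun ω => f j (W ω) * q l (Z ω) - h j (Z ω) * q l (Z ω)) P :=
        fun l => ((hfL j).integrable_mul (hqL l)).sub ((hhL j).integrable_mul (hqL l))
      simp only [h2]
      rw [integral_sub (by exact ((hfL j).sub (hhL j)).integrable_mul (haL n))
        (integrable_finsetSum _ fun l _ => (h3 l).const_mul _), hfa, zero_sub, neg_eq_zero,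
        integral_finsetSum _ fun l _ => (h3 l).const_mul _]
      refine Finset.sum_eq_zero fun l _ => ?_
      rw [integral_const_mul, integral_sub (by exact (hfL j).integrable_mul (hqL l))
        (by exact (hhL j).integrable_mul (hqL l)), hhq, sub_self, mul_zero]
    have h4 : ∀ ω, (f j (W ω) - p n j (Z ω)) * ρ n (Z ω) =
        (f j (W ω) - h j (Z ω)) * ρ n (Z ω) + (h j (Z ω) - p n j (Z ω)) * ρ n (Z ω) := fun ω => by
      ring
    simp only [h4]
    rw [integral_add (by exact ((hfL j).sub (hhL j)).integrable_mul (hρL n))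
      (by exact (hhpL n j).integrable_mul (hρL n)), h1, zero_add]
  have hCρ : 0 ≤ 2 * Ca + 2 * Ca * Cq := by positivity
  have hmain := hX.tendstoInMeasure_residual_sub (q := fun l x => q l x.2.1)
    (F := fun j x => f j x.2.2) (h := fun j x => h j x.2.1) (u := fun x => x.1 - φ x.2.1)
    (ρ := fun n x => ρ n x.2.1) (k := k) (m := m) (r := r) (Cq := Cq) (Cu := Cv)
    (Cρ := 2 * Ca + 2 * Ca * Cq) (CF := ∑' j, ∫ ω, f j (W ω) ^ 2 ∂P)
    (CQ := ∑' j, ∫ ω, (errorTerm Y Z φ ω * (f j (W ω) - h j (Z ω))) ^ 2 ∂P)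
    (π := fun n j x => p n j x.2.1) hCq0 hCρ hqZm (fun l => trL _ (hqZm l) (hqL l))
    (fun l l' =>
      (tr (fun x => q l x.2.1 * q l' x.2.1) ((hqZm l).mul (hqZm l'))).trans (hqo l l'))
    (hqb.mono fun n hn => tra _ (Finset.measurable_sum _ fun l _ => (hqZm l).pow_const 2) _ hn)
    hfWm (fun j => trL _ (hfWm j) (hfL j)) ?_ hhZm hum
    (fun n => (hρm n).comp (measurable_fst.comp measurable_snd)) ?_ ?_ ?_ ?_ ?_ hk2 ?_ ?_ ?_ ?_
  · exact hmain
  · refine .of_forall fun n => ?_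
    have h1 : ∀ j, ∫ x, f j x.2.2 ^ 2 ∂(P.map T) = ∫ ω, f j (W ω) ^ 2 ∂P := fun j =>
      tr (fun x => f j x.2.2 ^ 2) ((hfWm j).pow_const 2)
    simp only [h1]
    exact hfs.sum_le_tsum _ fun j _ => integral_nonneg fun _ => sq_nonneg _
  · intro l
    have hm' := (hqZm l).mul hum
    have h1 := hψU (q l) (hqm l) (hqL l)
    refine ⟨trL (fun x => q l x.2.1 * (x.1 - φ x.2.1)) hm' h1.1,
      (tr (fun x => (q l x.2.1 * (x.1 - φ x.2.1)) ^ 2) (hm'.pow_const 2)).trans_le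
        (h1.2.1.trans ?_), (tr (fun x => q l x.2.1 * (x.1 - φ x.2.1)) hm').trans h1.2.2⟩
    have h2 := hqo l l
    simp only [← pow_two, if_true] at h2
    rw [h2, mul_one]
  · intro n j x
    refine Finset.sum_congr rfl fun l _ => ?_
    rw [tr (fun x => f j x.2.2 * q l x.2.1) ((hfWm j).mul (hqZm l))]
  · intro n j
    have hm1 : Measurable fun x : ℝ × E × F => h j x.2.1 - p n j x.2.1 :=
      ((hhm j).sub (hpm n j)).comp (measurable_fst.comp measurable_snd)
    have hm' := hm1.mul hum
    have h1 := hψU (fun z => h j z - p n j z) ((hhm j).sub (hpm n j)) (hhpL n j)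
    refine ⟨trL (fun x => (h j x.2.1 - p n j x.2.1) * (x.1 - φ x.2.1)) hm' h1.1, ?_,
      (tr (fun x => (h j x.2.1 - p n j x.2.1) * (x.1 - φ x.2.1)) hm').trans h1.2.2⟩
    rw [tr (fun x => ((h j x.2.1 - p n j x.2.1) * (x.1 - φ x.2.1)) ^ 2) (hm'.pow_const 2),
      tr (fun x => (h j x.2.1 - p n j x.2.1) ^ 2) (hm1.pow_const 2)]
    exact h1.2.1
  · filter_upwards [ha2, hρb, eventually_ge_atTop 1] with n h1 h2 h3
    have hn0 : (0 : ℝ) < n := by exact_mod_cast h3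
    have hρZm : Measurable fun x : ℝ × E × F => ρ n x.2.1 :=
      (hρm n).comp (measurable_fst.comp measurable_snd)
    have h4 : Ca / n ≤ (2 * Ca + 2 * Ca * Cq) / n :=
      div_le_div_of_nonneg_right (by nlinarith [mul_nonneg hCa0 hCq0]) hn0.le
    refine ⟨tra _ (hρZm.pow_const 2) _ h2, trL _ hρZm (hρL n), ?_, fun l hl => ?_, fun j => ?_⟩
    · rw [tr (fun x => ρ n x.2.1 ^ 2) (hρZm.pow_const 2)]
      exact (hρ2 n).trans (h1.trans h4)
    · rw [tr (fun x => q l x.2.1 * ρ n x.2.1) ((hqZm l).mul hρZm), ← hρq n l hl]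
      exact integral_congr_ae (.of_forall fun ω => mul_comm _ _)
    · have hm1 : Measurable fun x : ℝ × E × F => h j x.2.1 - p n j x.2.1 :=
        ((hhm j).sub (hpm n j)).comp (measurable_fst.comp measurable_snd)
      have hm2 : Measurable fun x : ℝ × E × F => f j x.2.2 - p n j x.2.1 :=
        (hfWm j).sub ((hpm n j).comp (measurable_fst.comp measurable_snd))
      rw [tr (fun x => (f j x.2.2 - p n j x.2.1) * ρ n x.2.1) (hm2.mul hρZm),
        tr (fun x => (h j x.2.1 - p n j x.2.1) ^ 2) (hm1.pow_const 2)]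
      have h5 := sq_integral_mul_le (hhpL n j) (hρL n)
      rw [← hhρ] at h5
      have h6 : 0 ≤ ∫ ω, (h j (Z ω) - p n j (Z ω)) ^ 2 ∂P := integral_nonneg fun _ => sq_nonneg _
      have h7 : n * ∫ ω, ρ n (Z ω) ^ 2 ∂P ≤ 2 * Ca + 2 * Ca * Cq := by
        rw [← le_div_iff₀' hn0]
        exact (hρ2 n).trans (h1.trans h4)
      calc n * (∫ ω, (f j (W ω) - p n j (Z ω)) * ρ n (Z ω) ∂P) ^ 2
          ≤ n * ((∫ ω, (h j (Z ω) - p n j (Z ω)) ^ 2 ∂P) * ∫ ω, ρ n (Z ω) ^ 2 ∂P) :=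
            mul_le_mul_of_nonneg_left h5 hn0.le
        _ = (n * ∫ ω, ρ n (Z ω) ^ 2 ∂P) * ∫ ω, (h j (Z ω) - p n j (Z ω)) ^ 2 ∂P := by ring
        _ ≤ _ := mul_le_mul_of_nonneg_right h7 h6
  · have h1 : ∀ n j, ∫ x, (h j x.2.1 - p n j x.2.1) ^ 2 ∂(P.map T) =
        ‖∑' l, inner ℝ (v l) ((hfL j).toLp _) • v l -
          ∑ l ∈ Finset.range (k n), inner ℝ (v l) ((hfL j).toLp _) • v l‖ ^ 2 := fun n j => by
      rw [← hhp]
      exact tr (fun x => (h j x.2.1 - p n j x.2.1) ^ 2)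
        ((((hhm j).sub (hpm n j)).comp (measurable_fst.comp measurable_snd)).pow_const 2)
    simp only [h1]
    exact tendsto_sum_norm_projection hv (x := fun j => (hfL j).toLp _)
      (by simpa only [norm_toLp_sq] using hfs) hk m
  · exact fun j => trL (fun x => (x.1 - φ x.2.1) * (f j x.2.2 - h j x.2.1))
      (hum.mul ((hfWm j).sub (hhZm j))) (hgL j)
  · exact fun j => (tr (fun x => (x.1 - φ x.2.1) * (f j x.2.2 - h j x.2.1))
      (hum.mul ((hfWm j).sub (hhZm j)))).trans (hg0 j)
  · refine .of_forall fun n => ?_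
    have h1 : ∀ j, ∫ x, ((x.1 - φ x.2.1) * (f j x.2.2 - h j x.2.1)) ^ 2 ∂(P.map T) =
        ∫ ω, (errorTerm Y Z φ ω * (f j (W ω) - h j (Z ω))) ^ 2 ∂P := fun j =>
      tr (fun x => ((x.1 - φ x.2.1) * (f j x.2.2 - h j x.2.1)) ^ 2)
        ((hum.mul ((hfWm j).sub (hhZm j))).pow_const 2)
    simp only [h1]
    exact hgs.sum_le_tsum _ fun j _ => integral_nonneg fun _ => sq_nonneg _
  · filter_upwards [hr] with n hn
    filter_upwards [hn] with ω hω
    obtain ⟨θ, h1, h2⟩ := hω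
    -- Passing from `a n` to `ρ n` removes the projection of `a n`, which is absorbed in the
    -- regression coefficients.
    refine ⟨fun l => θ l - ∫ ω, a n (Z ω) * q l (Z ω) ∂P, fun i hi => ?_, h2⟩
    rw [h1 i hi]
    simp only [ρ, sub_mul, Finset.sum_sub_distrib]
    ring

end Regression

end ExogeneityTest
end


/-! ### The limit distribution of the statistic -/

theorem mainTheorem6
    {Ω : Type*} [MeasurableSpace Ω] (P : Measure Ω) [IsProbabilityMeasure P]
    {dZ dW : ℕ}
    -- the population `(Y, Z, W)`, the sample and the structural function
    (Y : Ω → ℝ) (Z : Ω → EuclideanSpace ℝ (Fin dZ)) (W : Ω → EuclideanSpace ℝ (Fin dW))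
    (Ys : ℕ → Ω → ℝ) (Zs : ℕ → Ω → EuclideanSpace ℝ (Fin dZ))
    (Ws : ℕ → Ω → EuclideanSpace ℝ (Fin dW))
    (φ φ₀ : EuclideanSpace ℝ (Fin dZ) → ℝ)
    (hmodel : ExogeneityTest.IsIVModel P Y Z W φ)
    (hφ₀ : ExogeneityTest.IsRegressionFunction P Y Z φ₀)
    (hsample : ExogeneityTest.IsIIDSample P Y Z W Ys Zs Ws)
    -- the density of `W`, the weight density and the functions `f_l`, `e_l`
    (p ν : EuclideanSpace ℝ (Fin dW) → ℝ)
    (hp : ExogeneityTest.IsDensityOf P W p)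
    (hν : ExogeneityTest.IsWeightDensity P W ν)
    (f : ℕ → EuclideanSpace ℝ (Fin dW) → ℝ)
    (hf : ExogeneityTest.IsOrthonormalBasisOf ν f)
    (e : ℕ → EuclideanSpace ℝ (Fin dZ) → ℝ)
    (hemeas : ∀ l, Measurable (e l))
    (he : ∀ l, MemLp (fun ω => e l (Z ω)) 2 P)
    -- the weights, the dimensions and a choice of the generalized inverses
    (τ w : ℕ → ℝ) (k m : ℕ → ℕ)
    (G : ∀ n, Ω → Matrix (Fin (k n)) (Fin (k n)) ℝ)
    (hG : ∀ n ω, ExogeneityTest.IsGeneralizedInverse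
      (ExogeneityTest.designGram e n (k n) fun i => Zs i ω) (G n ω))
    -- the assumptions
    (hA1 : ExogeneityTest.AssumptionA1 P W p ν f)
    (hA2 : ExogeneityTest.AssumptionA2 P W (ExogeneityTest.errorTerm Y Z φ))
    (hA3 : ExogeneityTest.AssumptionA3 P Z W)
    (hA4 : ExogeneityTest.AssumptionA4 τ)
    (hA6 : ExogeneityTest.AssumptionA6 P Z e w k φ₀ (ExogeneityTest.errorTerm Y Z φ))
    -- the rates
    (hτ : (fun n => ∑ j ∈ Finset.range (m n), τ j) =O[atTop] fun _ => (1 : ℝ))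
    (hw : (fun n : ℕ => (n : ℝ)) =O[atTop] fun n => w (k n))
    (hk : (fun n => (k n : ℝ) ^ 3) =o[atTop] fun n : ℕ => (n : ℝ))
    (hm : Tendsto m atTop atTop)
    -- exogeneity
    (hexo : ExogeneityTest.Exogenous P Z φ φ₀)
    -- independent chi-square variables with one degree of freedom
    {Ω' : Type*} [MeasurableSpace Ω'] (P' : Measure Ω') [IsProbabilityMeasure P']
    (χ : ℕ → Ω' → ℝ) (hχ : ∀ j, HasLaw (χ j) ExogeneityTest.chiSquareOne P')
    (hχindep : iIndepFun χ P') :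
    (∃ ev : ℕ → ℝ, ExogeneityTest.IsOrderedEigenvalues
      (ExogeneityTest.scoreCovariance P Z W (ExogeneityTest.errorTerm Y Z φ) τ f e he) ev) ∧
    ∀ ev : ℕ → ℝ, ExogeneityTest.IsOrderedEigenvalues
      (ExogeneityTest.scoreCovariance P Z W (ExogeneityTest.errorTerm Y Z φ) τ f e he) ev →
      (∀ᵐ ω' ∂P', Summable fun j => ev j * χ j ω') ∧
      TendstoInDistribution
        (fun (n : ℕ) ω => (n : ℝ) * ExogeneityTest.testStatistic τ f e n (m n) (k n) (G n ω)
          (fun i => Ys i ω) (fun i => Zs i ω) (fun i => Ws i ω))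
        atTop (fun ω' => ∑' j, ev j * χ j ω') (fun _ => P) P' := by
  have hYm := hmodel.measurable_Y
  have hZm := hmodel.measurable_Z
  have hWm := hmodel.measurable_W
  have hφm := hmodel.measurable_phi
  set U := ExogeneityTest.errorTerm Y Z φ with hUdef
  have hUm : Measurable U := hYm.sub (hφm.comp hZm)
  have hUL : MemLp U 2 P := hmodel.memLp_error
  have hUi : Integrable U P := hUL.integrable (by norm_num)
  have hUZ := ExogeneityTest.condExp_errorTerm_eq_zero hmodel hφ₀ hexo
  rw [← hUdef] at hUZ
  have hfm := hf.1
  have hφ₀m := hφ₀.1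
  have hτ0 : ∀ j, 0 ≤ τ j := fun j => (hA4.1 j).le
  have hτs := ExogeneityTest.summable_of_sum_range_isBigO hτ0 hm hτ
  have hkt := ExogeneityTest.tendsto_atTop_of_isBigO hw
  have hk2 := ExogeneityTest.tendsto_sq_div_of_cube_isLittleO hk
  obtain ⟨K, hK0, hK⟩ := ExogeneityTest.integrable_fourth_moment hWm hp hν hfm hA1
  obtain ⟨-, -, hU4, -⟩ := hA2
  obtain ⟨Cv, hCv0, hCv⟩ : ∃ C : ℝ, 0 ≤ C ∧ ∀ᵐ ω ∂P,
      (P[fun ω => U ω ^ 2 | MeasurableSpace.comap Z inferInstance]) ω ≤ C := by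
    obtain ⟨C, hC⟩ := hA6.condVar_bound
    exact ⟨max C 0, le_max_right _ _, hC.mono fun ω h => h.trans (le_max_left _ _)⟩
  obtain ⟨c, hc0, hc⟩ := hA6.eigenvalue_bound
  obtain ⟨ηe, hηe, hsup⟩ := hA6.sup_bound
  obtain ⟨hv, q, hqm, hq, hqe, heq, hqsq⟩ :=
    ExogeneityTest.exists_orthonormalized_eq hemeas he hc0 hc
  set v := ExogeneityTest.orthonormalized P Z e he with hvdef
  choose D hD using hqe
  choose D' hD' using heq
  -- the functions of the instruments
  let F : ℕ → EuclideanSpace ℝ (Fin dW) → ℝ := fun j s => √(τ j) * f j s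
  have hFm : ∀ j, Measurable (F j) := fun j => (hfm j).const_mul _
  have hfWm : ∀ j, Measurable fun ω => f j (W ω) := fun j => (hfm j).comp hWm
  have hf2 : ∀ j, MemLp (fun ω => f j (W ω)) 2 P ∧ ∫ ω, f j (W ω) ^ 2 ∂P ≤ 1 + K := fun j => by
    have h1 := ExogeneityTest.memLp_two_of_integrable_pow_four (hfWm j).aestronglyMeasurable (hK j).1
    exact ⟨h1.1, h1.2.trans (by linarith [(hK j).2])⟩
  have hFL : ∀ j, MemLp (fun ω => F j (W ω)) 2 P := fun j => (hf2 j).1.const_mul _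
  have hF2 : ∀ j, ∫ ω, F j (W ω) ^ 2 ∂P ≤ τ j * (1 + K) := fun j => by
    have h1 : ∀ ω, F j (W ω) ^ 2 = τ j * f j (W ω) ^ 2 := fun ω => by
      simp only [F]; rw [mul_pow, Real.sq_sqrt (hτ0 j)]
    simp only [h1]
    rw [integral_const_mul]
    exact mul_le_mul_of_nonneg_left (hf2 j).2 (hτ0 j)
  have hFU : ∀ j, MemLp (fun ω => F j (W ω) * U ω) 2 P ∧
      ∫ ω, (F j (W ω) * U ω) ^ 2 ∂P ≤ τ j * (K + ∫ ω, U ω ^ 4 ∂P) := fun j => by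
    have h1 := ExogeneityTest.memLp_mul_of_integrable_pow_four (hfWm j).aestronglyMeasurable
      hUm.aestronglyMeasurable (hK j).1 hU4
    have h2 : ∀ ω, F j (W ω) * U ω = √(τ j) * (f j (W ω) * U ω) := fun ω => by
      simp only [F]; ring
    simp only [h2]
    refine ⟨h1.1.const_mul _, ?_⟩
    simp only [mul_pow, Real.sq_sqrt (hτ0 j)]
    rw [integral_const_mul]
    refine mul_le_mul_of_nonneg_left ?_ (hτ0 j)
    have h3 := h1.2.trans (add_le_add_left (hK j).2 _)
    simpa only [mul_pow] using h3
  have hFU0 : ∀ j, ∫ ω, F j (W ω) * U ω ∂P = 0 := fun j =>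
    ExogeneityTest.integral_comp_mul_eq_zero hWm hUi hmodel.condExp_error (hFm j)
      ((hFU j).1.integrable (by norm_num))
  -- multiplication of the error with functions of `Z`
  have hψU : ∀ ψ : EuclideanSpace ℝ (Fin dZ) → ℝ, Measurable ψ → MemLp (fun ω => ψ (Z ω)) 2 P →
      MemLp (fun ω => ψ (Z ω) * U ω) 2 P ∧
      ∫ ω, (ψ (Z ω) * U ω) ^ 2 ∂P ≤ Cv * ∫ ω, ψ (Z ω) ^ 2 ∂P ∧
      ∫ ω, ψ (Z ω) * U ω ∂P = 0 := fun ψ hψ hψ2 => by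
    have h1 := ExogeneityTest.memLp_comp_mul_of_condExp_sq_le hZm hUm hUL hCv0 hCv hψ hψ2
    exact ⟨h1.1, h1.2, ExogeneityTest.integral_comp_mul_eq_zero hZm hUi hUZ hψ
      (h1.1.integrable (by norm_num))⟩
  -- the projections
  let x : ℕ → Lp ℝ 2 P := fun j => (hFL j).toLp (fun ω => F j (W ω))
  have hxF : ∀ j, x j =ᵐ[P] fun ω => F j (W ω) := fun j => (hFL j).coeFn_toLp
  have hxs : Summable fun j => ‖x j‖ ^ 2 :=
    Summable.of_nonneg_of_le (fun _ => by positivity)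
      (fun j => by rw [ExogeneityTest.norm_toLp_sq]; exact hF2 j) (hτs.mul_right (1 + K))
  choose h hhm hh using fun j =>
    ExogeneityTest.exists_measurable_seriesProjection hZm he hv hqm hq (x j)
  rw [← hvdef] at hh
  have hproj : ∀ j, ExogeneityTest.seriesProjection P Z e he (fun ω' => √(τ j) * f j (W ω')) =
      ∑' l, inner ℝ (v l) (x j) • v l := fun j => by
    rw [ExogeneityTest.seriesProjection, ← hvdef]
    refine tsum_congr fun l => ?_
    rw [real_inner_comm, ExogeneityTest.inner_eq_integral_of_ae_eq (hxF j) (ae_eq_refl (v l))]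
  have hhL : ∀ j, MemLp (fun ω => h j (Z ω)) 2 P := fun j => (Lp.memLp _).ae_eq (hh j)
  have hqL : ∀ l, MemLp (fun ω => q l (Z ω)) 2 P := fun l => (Lp.memLp _).ae_eq (hq l)
  have hqo : ∀ l l', ∫ ω, q l (Z ω) * q l' (Z ω) ∂P = if l = l' then 1 else 0 := fun l l' => by
    rw [← ExogeneityTest.inner_eq_integral_of_ae_eq (hq l) (hq l')]
    exact orthonormal_iff_ite.1 hv l l'
  have hFq : ∀ j l, inner ℝ (v l) (x j) = ∫ ω, F j (W ω) * q l (Z ω) ∂P := fun j l => by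
    rw [real_inner_comm, ExogeneityTest.inner_eq_integral_of_ae_eq (hxF j) (hq l)]
  -- the scores
  have hgL : ∀ j, MemLp (fun ω => U ω * (F j (W ω) - h j (Z ω))) 2 P := fun j => by
    refine ((hFU j).1.sub (hψU (h j) (hhm j) (hhL j)).1).congr_norm
      (hUm.mul (((hFm j).comp hWm).sub ((hhm j).comp hZm))).aestronglyMeasurable
      (.of_forall fun ω => ?_)
    simp only [Pi.sub_apply]
    congr 1
    ring
  -- The two parts are centered for different reasons: `F j` by the instrument condition on `W`, and
  -- `h j` by exogeneity.
  have hg0 : ∀ j, ∫ ω, U ω * (F j (W ω) - h j (Z ω)) ∂P = 0 := fun j => by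
    have h1 : ∀ ω, U ω * (F j (W ω) - h j (Z ω)) = F j (W ω) * U ω - h j (Z ω) * U ω :=
      fun ω => by ring
    simp only [h1]
    rw [integral_sub ((hFU j).1.integrable (by norm_num))
      ((hψU (h j) (hhm j) (hhL j)).1.integrable (by norm_num)), hFU0,
      (hψU (h j) (hhm j) (hhL j)).2.2, sub_zero]
  have hh2 : ∀ j, ∫ ω, h j (Z ω) ^ 2 ∂P ≤ τ j * (1 + K) := fun j => by
    rw [← ExogeneityTest.norm_sq_eq_integral_of_ae_eq (hh j)]
    refine le_trans ?_ (hF2 j)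
    rw [← ExogeneityTest.norm_toLp_sq (hFL j)]
    exact pow_le_pow_left₀ (norm_nonneg _) (ExogeneityTest.norm_tsum_inner_smul_le hv (x j)) 2
  have hg2 : ∀ j, ∫ ω, (U ω * (F j (W ω) - h j (Z ω))) ^ 2 ∂P ≤
      τ j * (2 * (K + ∫ ω, U ω ^ 4 ∂P) + 2 * (Cv * (1 + K))) := fun j => by
    have h1 := hψU (h j) (hhm j) (hhL j)
    have h2 : ∫ ω, (U ω * (F j (W ω) - h j (Z ω))) ^ 2 ∂P ≤
        ∫ ω, (2 * (F j (W ω) * U ω) ^ 2 + 2 * (h j (Z ω) * U ω) ^ 2) ∂P := by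
      refine integral_mono (hgL j).integrable_sq (((hFU j).1.integrable_sq.const_mul _).add
        (h1.1.integrable_sq.const_mul _)) fun ω => ?_
      simp only
      nlinarith [sq_nonneg (F j (W ω) * U ω + h j (Z ω) * U ω)]
    rw [integral_add ((hFU j).1.integrable_sq.const_mul _) (h1.1.integrable_sq.const_mul _),
      integral_const_mul, integral_const_mul] at h2
    have h3 := mul_le_mul_of_nonneg_left (hh2 j) hCv0
    linarith [(hFU j).2, h1.2.1]
  have hgs : Summable fun j => ∫ ω, (U ω * (F j (W ω) - h j (Z ω))) ^ 2 ∂P :=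
    Summable.of_nonneg_of_le (fun _ => integral_nonneg fun _ => sq_nonneg _) hg2
      (hτs.mul_right _)
  have hscore : ∀ j, ExogeneityTest.scoreVariable P Z W U τ f e he j =ᵐ[P]
      fun ω => U ω * (F j (W ω) - h j (Z ω)) := fun j => by
    filter_upwards [hh j] with ω hω
    rw [ExogeneityTest.scoreVariable, hproj j, hω]
  -- Since the scores are centered, their covariance is a Gram matrix in `L²(P)`, to which the
  -- spectral results apply.
  have hcov : ExogeneityTest.scoreCovariance P Z W U τ f e he = fun j l =>
      ∫ ω, (U ω * (F j (W ω) - h j (Z ω))) * (U ω * (F l (W ω) - h l (Z ω))) ∂P := by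
    ext j l
    rw [ExogeneityTest.scoreCovariance, covariance, integral_congr_ae (hscore j),
      integral_congr_ae (hscore l), hg0, hg0]
    refine integral_congr_ae ?_
    filter_upwards [hscore j, hscore l] with ω h1 h2
    rw [h1, h2, sub_zero, sub_zero]
  refine ⟨?_, fun ev hev => ?_⟩
  · rw [hcov]
    have h1 := ExogeneityTest.exists_isOrderedEigenvalues_gram
      (fun j => (hgL j).toLp _) (by simpa only [ExogeneityTest.norm_toLp_sq] using hgs)
    simpa only [ExogeneityTest.inner_toLp] using h1
  rw [hcov] at hev
  have hX := hsample.isIID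
  set T : Ω → ℝ × EuclideanSpace ℝ (Fin dZ) × EuclideanSpace ℝ (Fin dW) :=
    fun ω => (Y ω, Z ω, W ω) with hT
  have hTm : Measurable T := hYm.prodMk (hZm.prodMk hWm)
  have hgm : ∀ j, Measurable fun x : ℝ × EuclideanSpace ℝ (Fin dZ) × EuclideanSpace ℝ (Fin dW) =>
      (x.1 - φ x.2.1) * (F j x.2.2 - h j x.2.1) := fun j =>
    (measurable_fst.sub (hφm.comp (measurable_fst.comp measurable_snd))).mul
      (((hFm j).comp (measurable_snd.comp measurable_snd)).sub
        ((hhm j).comp (measurable_fst.comp measurable_snd)))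
  have hclt := hX.tendstoInDistribution_sum_range_normSum_sq (m := m) (ev := ev) hgm
    (fun j => (memLp_map_measure_iff (hgm j).aestronglyMeasurable hTm.aemeasurable).2 (hgL j))
    (fun j => (integral_map hTm.aemeasurable (hgm j).aestronglyMeasurable).trans (hg0 j))
    (hgs.congr fun j =>
      (integral_map hTm.aemeasurable ((hgm j).pow_const 2).aestronglyMeasurable).symm)
    (by
      convert hev using 3 with j l
      exact integral_map hTm.aemeasurable ((hgm j).mul (hgm l)).aestronglyMeasurable)
    hm hχ hχindep
  -- Slutsky: it remains to show that the statistic and the quadratic form of the scores differ by a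
  -- term tending to zero in probability.
  refine ⟨hclt.1, tendstoInDistribution_of_tendstoInMeasure_sub _ _ hclt.2 ?_ fun n =>
    (ExogeneityTest.measurable_mul_testStatistic hfm hemeas hsample.measurable_Y
      hsample.measurable_Z hsample.measurable_W (hG n)).aemeasurable⟩
  obtain ⟨β, Ca, hCa0, hβ⟩ := hA6.approx.exists_sq_le hA6.w_one hA6.w_mono hw
  let a : ℕ → EuclideanSpace ℝ (Fin dZ) → ℝ := fun n z =>
    φ₀ z - ∑ l : Fin (k n), e l z * β n l
  have ham : ∀ n, Measurable (a n) := fun n =>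
    hφ₀m.sub (Finset.measurable_sum _ fun l _ => (hemeas l).mul_const _)
  have heβL : ∀ n, MemLp (fun ω => ∑ l : Fin (k n), e l (Z ω) * β n l) 2 P := fun n =>
    memLp_finsetSum _ fun l _ => (he l).mul_const _
  have haL : ∀ n, MemLp (fun ω => a n (Z ω)) 2 P := fun n => hA6.approx.1.sub (heβL n)
  have hsuppZ : ∀ᵐ ω ∂P, Z ω ∈ (P.map Z).support :=
    ae_of_ae_map hZm.aemeasurable Measure.support_mem_ae
  have hab : ∀ᶠ n : ℕ in atTop, ∀ᵐ ω ∂P, a n (Z ω) ^ 2 ≤ Ca / n := by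
    filter_upwards [hβ] with n hn
    filter_upwards [hsuppZ] with ω hω
    exact hn _ hω
  have hqb : ∀ᶠ n in atTop, ∀ᵐ ω ∂P, ∑ l ∈ Finset.range (k n), q l (Z ω) ^ 2 ≤
      c⁻¹ * ηe * k n := by
    filter_upwards [eventually_ge_atTop 1] with n hn
    filter_upwards [hsuppZ] with ω hω
    have h1 := hsup n hn _ hω
    rw [Fin.sum_univ_eq_sum_range fun l => e l (Z ω) ^ 2] at h1
    rw [mul_assoc]
    exact (hqsq (k n) (Z ω)).trans (mul_le_mul_of_nonneg_left h1 (inv_nonneg.2 hc0.le))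
  have hspan : ∀ l, (he l).toLp (fun ω => e l (Z ω)) ∈ Submodule.span ℝ (Set.range v) :=
    fun l => by
      rw [hD' l]
      exact Submodule.sum_mem _ fun i _ => Submodule.smul_mem _ _ (Submodule.subset_span ⟨i, rfl⟩)
  have horth : ∀ j (ψ : EuclideanSpace ℝ (Fin dZ) → ℝ) (hψ : MemLp (fun ω => ψ (Z ω)) 2 P)
      (s : ℕ → Lp ℝ 2 P), (∀ n, s n ∈ Submodule.span ℝ (Set.range v)) →
      Tendsto s atTop (𝓝 (hψ.toLp _)) →
      ∫ ω, (F j (W ω) - h j (Z ω)) * ψ (Z ω) ∂P = 0 := fun j ψ hψ s hs hsψ => by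
    rw [← ExogeneityTest.inner_sub_tsum_eq_zero hv (x j) hs hsψ]
    refine (ExogeneityTest.inner_eq_integral_of_ae_eq ?_ hψ.coeFn_toLp).symm
    filter_upwards [Lp.coeFn_sub (x j) (∑' l, inner ℝ (v l) (x j) • v l), hxF j, hh j] with ω h1 h2 h3
    rw [h1, Pi.sub_apply, h2, h3]
  have hFe : ∀ j l, ∫ ω, (F j (W ω) - h j (Z ω)) * e l (Z ω) ∂P = 0 := fun j l =>
    horth j (e l) (he l) _ (fun _ => hspan l) tendsto_const_nhds
  -- The approximation class places `φ₀(Z)` in the `L²` closure of the span of the `e l (Z)`, since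
  -- the approximants `∑ β n l * e l` converge to it. Hence the approximation errors `a n` are also
  -- orthogonal to `F j - h j`.
  have hFφ : ∀ j, ∫ ω, (F j (W ω) - h j (Z ω)) * φ₀ (Z ω) ∂P = 0 := fun j => by
    refine horth j φ₀ hA6.approx.1 (fun n => ∑ l : Fin (k n), β n l • (he l).toLp _)
      (fun n => Submodule.sum_mem _ fun l _ => Submodule.smul_mem _ _ (hspan l)) ?_
    rw [tendsto_iff_norm_sub_tendsto_zero]
    have h1 : ∀ n, ‖∑ l : Fin (k n), β n l • (he l).toLp (fun ω => e l (Z ω)) -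
        hA6.approx.1.toLp _‖ ^ 2 = ∫ ω, a n (Z ω) ^ 2 ∂P := fun n => by
      rw [norm_sub_rev]
      refine ExogeneityTest.norm_sq_eq_integral_of_ae_eq ?_
      filter_upwards [Lp.coeFn_sub (hA6.approx.1.toLp _)
        (∑ l : Fin (k n), β n l • (he l).toLp (fun ω => e l (Z ω))), hA6.approx.1.coeFn_toLp,
        ExogeneityTest.coeFn_sum_smul Finset.univ (β n) fun (l : Fin (k n)) _ => (he l).coeFn_toLp]
        with ω h1 h2 h3
      rw [h1, Pi.sub_apply, h2, h3]
      simp only [a, mul_comm]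
    have h2 : Tendsto (fun n => ∫ ω, a n (Z ω) ^ 2 ∂P) atTop (𝓝 0) := by
      refine squeeze_zero' (.of_forall fun n => integral_nonneg fun _ => sq_nonneg _) ?_
        (tendsto_const_div_atTop_nhds_zero_nat Ca)
      filter_upwards [hab] with n hn
      refine (integral_mono_ae (haL n).integrable_sq (integrable_const _) hn).trans ?_
      simp
    have h3 := h2.sqrt
    rw [Real.sqrt_zero] at h3
    refine h3.congr fun n => ?_
    rw [← h1, Real.sqrt_sq (norm_nonneg _)]
  have hFa : ∀ n j, ∫ ω, (F j (W ω) - h j (Z ω)) * a n (Z ω) ∂P = 0 := fun n j => by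
    have hFh := (hFL j).sub (hhL j)
    have h1 : ∀ ω, (F j (W ω) - h j (Z ω)) * a n (Z ω) = (F j (W ω) - h j (Z ω)) * φ₀ (Z ω) -
        ∑ l : Fin (k n), β n l * ((F j (W ω) - h j (Z ω)) * e l (Z ω)) := fun ω => by
      simp only [a]
      rw [mul_sub, Finset.mul_sum]
      congr 1
      exact Finset.sum_congr rfl fun l _ => by ring
    have h2 : ∀ l, Integrable (fun ω => (F j (W ω) - h j (Z ω)) * e l (Z ω)) P := fun l =>
      hFh.integrable_mul (he l)
    simp only [h1]
    rw [integral_sub (by exact hFh.integrable_mul hA6.approx.1)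
      (integrable_finsetSum _ fun (l : Fin (k n)) _ => (h2 l).const_mul _), hFφ,
      integral_finsetSum _ fun (l : Fin (k n)) _ => (h2 l).const_mul _]
    simp only [integral_const_mul, hFe, mul_zero, Finset.sum_const_zero, sub_zero]
  -- the residuals
  have heqZ : ∀ᵐ ω ∂P, ∀ l, e l (Z ω) = ∑ i ∈ Finset.range (l + 1), D' l i * q i (Z ω) :=
    ae_all_iff.2 fun l => by
      have h1 := ExogeneityTest.coeFn_sum_smul (Finset.range (l + 1)) (D' l) fun i _ => hq i
      rw [← hD' l] at h1
      exact (he l).coeFn_toLp.symm.trans h1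
  have hZs : ∀ p : EuclideanSpace ℝ (Fin dZ) → Prop, MeasurableSet {z | p z} →
      (∀ᵐ ω ∂P, p (Z ω)) → ∀ᵐ ω ∂P, ∀ i, p (Zs i ω) := fun p hp hpZ => by
    refine hX.ae (p := fun x => p x.2.1) ((ae_map_iff hTm.aemeasurable ?_).2 hpZ)
    exact (measurable_fst.comp measurable_snd) hp
  have heqs := hZs (fun z => ∀ l, e l z = ∑ i ∈ Finset.range (l + 1), D' l i * q i z)
    (by
      rw [Set.ofPred_forall]
      exact MeasurableSet.iInter fun l => measurableSet_eq_fun (hemeas l)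
        (Finset.measurable_sum _ fun i _ => (hqm i).const_mul _)) heqZ
  have hφs := hZs (fun z => φ z = φ₀ z) (measurableSet_eq_fun hφm hφ₀m) hexo
  have hmain := hX.tendstoInMeasure_series_residual_sub hYm hZm hWm hφm hFm hFL
    (Summable.of_nonneg_of_le (fun _ => integral_nonneg fun _ => sq_nonneg _) hF2
      (hτs.mul_right (1 + K))) (by positivity) hCa0 hψU hv hqm hq hkt hk2 hqb hhm hh hgL hg0 hgs
    ham haL hab hFa (m := m)
    (r := fun n i ω => Ys i ω - ExogeneityTest.seriesEstimator e n (k n) (G n ω)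
      (fun i => Ys i ω) (fun i => Zs i ω) (Zs i ω)) ?_
  · refine hmain.congr' ?_ ae_eq_rfl
    filter_upwards [eventually_ne_atTop 0] with n hn
    refine .of_forall fun ω => ?_
    simp only [Pi.sub_apply]
    rw [ExogeneityTest.mul_testStatistic_eq hτ0 f e hn]
  · refine .of_forall fun n => ?_
    filter_upwards [heqs, hφs] with ω h1 h2
    -- On the sample `φ = φ₀`, so the residual is the error plus `a n` minus `∑ b l * e l`. The
    -- coefficients `b` are the estimated minus the approximating ones, rewritten next in terms of
    -- the `q l`.
    let b : Fin (k n) → ℝ := fun l => ExogeneityTest.seriesCoef e n (k n) (G n ω)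
      (fun i => Ys i ω) (fun i => Zs i ω) l - β n l
    obtain ⟨θ, hθ⟩ := ExogeneityTest.exists_sum_mul_eq_of_triangular D' b
    refine ⟨θ, fun i _ => ?_, fun l hl =>
      ExogeneityTest.sum_residual_mul_triangular_eq_zero hD (hG n ω) (Finset.mem_range.1 hl)⟩
    have h3 := hθ (fun l => e l (Zs i ω)) (fun l => q l (Zs i ω)) (h1 i)
    rw [← h3, h2 i]
    simp only [a, b, ExogeneityTest.seriesEstimator, mul_sub, Finset.sum_sub_distrib]
    ring
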